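/- Let $n\ge 1$. For $\varepsilon>0$ and real polynomials $p^{\pm}(x,y)=\sum_{0\le i+j\le n}a^{\pm}_{ij}x^iy^j$, $q^{\pm}(x,y)=\sum_{0\le i+j\le n}b^{\pm}_{ij}x^iy^j$, consider the planar piecewise smooth system $$(\dot x,\dot y)=\begin{cases}\big(-y+\varepsilon p^{+}(x,y),\ 1-x+\varepsilon q^{+}(x,y)\big), & x\ge 0,\\ \big(-y+\varepsilon p^{-}(x,y),\ x+\varepsilon q^{-}(x,y)\big), & x<0,\end{cases}$$ with solutions understood in the sense of Filippov. For $\varepsilon=0$ it is piecewise linear and Hamiltonian, with Hamiltonians $H^+=\frac12((x-1)^2-y^2)$ and $H^-=-\frac12(x^2+y^2)$; it has a center at the origin, and the closed orbits around the origin fill the region bounded by the compound homoclinic loop $$L_0=\{0\le x\le 1,\ (x-1)^2=y^2\}\cup\{x<0,\ x^2+y^2=1\}$$ through the saddle $(1,0)$. A closed orbit is a simple closed curve traced by a periodic solution. A limit cycle is a closed orbit $\Gamma$ such that (i) $\Gamma$ crosses the line $x=0$ transversally, that is, at each of its points on this line the first components of the left and the right vector field have the same nonzero sign; (ii) $\Gamma$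 meets this line in exactly two points $(0,y_1)$, $(0,y_2)$ with $y_1<0<y_2$ (so $\Gamma$ surrounds the origin); (iii) some neighborhood of $\Gamma$ contains no other closed orbit. For a compact set $S$, say that $k$ limit cycles can bifurcate from $S$ if for every neighborhood $U$ of $S$ there are $p^\pm,q^\pm$ as above and $\varepsilon_0>0$ such that for all $0<\varepsilon<\varepsilon_0$ the system has at least $k$ limit cycles contained in $U$. Let $N_{Hopf}(n)$ and $N_{homoc}(n)$ in $\{0,1,2,\dots\}\cup\{\infty\}$ be the supremum of the $k$ for which $k$ limit cycles can bifurcate from $\{(0,0)\}$ and from $L_0$, respectively. Then $$(1)\quad N_{Hopf}(n)\ \ge\ n+\Big[\frac{n+1}{2}\Big],\qquad (2)\quad N_{homoc}(n)\ \ge\ n+\Big[\frac{n+1}{2}\Big],$$ where $[\cdot]$ denotes the integer part. -/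

import Mathlib

namespace PiecewiseHam

noncomputable section

open Set Topology MeasureTheory

/-- The polynomial `∑_{0 ≤ i + j ≤ n} c i j * x ^ i * y ^ j`, with arbitrary real coefficients. -/
def poly (n : ℕ) (c : ℕ → ℕ → ℝ) (z : ℝ × ℝ) : ℝ :=
  ∑ l ∈ Finset.range (n + 1), ∑ ij ∈ Finset.HasAntidiagonal.antidiagonal l,
    c ij.1 ij.2 * z.1 ^ ij.1 * z.2 ^ ij.2

/-- The coefficients of the four perturbing polynomials
`p⁺ = ∑ a⁺ᵢⱼ xⁱ yʲ`, `q⁺ = ∑ b⁺ᵢⱼ xⁱ yʲ`, `p⁻ = ∑ a⁻ᵢⱼ xⁱ yʲ`, `q⁻ = ∑ b⁻ᵢⱼ xⁱ yʲ`. -/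
structure Coeffs where
  aPlus : ℕ → ℕ → ℝ
  bPlus : ℕ → ℕ → ℝ
  aMinus : ℕ → ℕ → ℝ
  bMinus : ℕ → ℕ → ℝ

/-- The right vector field `(-y + ε p⁺, 1 - x + ε q⁺)`; for `ε = 0` it is the Hamiltonian vector
field `(H_y, -H_x)` of `H⁺ = ((x - 1)² - y²) / 2`. -/
def rightField (n : ℕ) (c : Coeffs) (ε : ℝ) (z : ℝ × ℝ) : ℝ × ℝ :=
  (-z.2 + ε * poly n c.aPlus z, 1 - z.1 + ε * poly n c.bPlus z)

/-- The left vector field `(-y + ε p⁻, x + ε q⁻)`; for `ε = 0` it is the Hamiltonian vector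
field `(H_y, -H_x)` of `H⁻ = -(x² + y²) / 2`. -/
def leftField (n : ℕ) (c : Coeffs) (ε : ℝ) (z : ℝ × ℝ) : ℝ × ℝ :=
  (-z.2 + ε * poly n c.aMinus z, z.1 + ε * poly n c.bMinus z)

/-- The Filippov set-valued field of the planar system that is `R` for `x > 0` and `L` for
`x < 0`: on the switching line `x = 0` it is the segment between the two vectors. -/
def filippov (R L : ℝ × ℝ → ℝ × ℝ) (z : ℝ × ℝ) : Set (ℝ × ℝ) :=
  {v | (0 < z.1 ∧ v = R z) ∨ (z.1 < 0 ∧ v = L z) ∨ (z.1 = 0 ∧ v ∈ segment ℝ (L z) (R z))}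

/-- Solutions (in the sense of Filippov) on the whole time axis. -/
def IsSolution (R L : ℝ × ℝ → ℝ × ℝ) (γ : ℝ → ℝ × ℝ) : Prop :=
  (∀ s t : ℝ, AbsolutelyContinuousOnInterval γ s t) ∧
    ∀ᵐ t : ℝ, ∃ v ∈ filippov R L (γ t), HasDerivAt γ v t

/-- `Γ` is a closed orbit: the simple closed curve traced by a periodic solution. -/
def IsClosedOrbit (R L : ℝ × ℝ → ℝ × ℝ) (Γ : Set (ℝ × ℝ)) : Prop :=
  ∃ (γ : ℝ → ℝ × ℝ) (T : ℝ), 0 < T ∧ IsSolution R L γ ∧ Function.Periodic γ T ∧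
    InjOn γ (Ico 0 T) ∧ range γ = Γ

/-- `Γ` is a (crossing) limit cycle around the origin: a closed orbit which
* passes through the switching line wherever it meets it (both fields point strictly to the same
  side of the line there, so there is neither sliding nor tangency),
* meets the switching line in exactly two points, one on either side of the origin, so that it
  encloses the origin,
* is isolated among all closed orbits of the system, sliding ones included. -/
def IsLimitCycle (R L : ℝ × ℝ → ℝ × ℝ) (Γ : Set (ℝ × ℝ)) : Prop :=
  IsClosedOrbit R L Γ ∧
  (∀ z ∈ Γ, z.1 = 0 → 0 < (R z).1 * (L z).1) ∧
  (∃ y₁ y₂ : ℝ, y₁ < 0 ∧ 0 < y₂ ∧ Γ ∩ {z | z.1 = 0} = {(0, y₁), (0, y₂)}) ∧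
  ∃ U : Set (ℝ × ℝ), IsOpen U ∧ Γ ⊆ U ∧ ∀ Γ', IsClosedOrbit R L Γ' → Γ' ⊆ U → Γ' = Γ

/-- The limit cycles, lying in `U`, of the perturbed system. -/
def limitCyclesIn (n : ℕ) (c : Coeffs) (ε : ℝ) (U : Set (ℝ × ℝ)) : Set (Set (ℝ × ℝ)) :=
  {Γ | IsLimitCycle (rightField n c ε) (leftField n c ε) Γ ∧ Γ ⊆ U}

/-- The compound homoclinic loop through the saddle `(1, 0)` of the unperturbed system: the
level `H⁺ = 0` over `0 ≤ x ≤ 1` together with the level `H⁻ = -1/2` over `x < 0`. -/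
def homoclinicLoop : Set (ℝ × ℝ) :=
  {z | 0 ≤ z.1 ∧ z.1 ≤ 1 ∧ ((z.1 - 1) ^ 2 - z.2 ^ 2) / 2 = 0} ∪
    {z | z.1 < 0 ∧ -(z.1 ^ 2 + z.2 ^ 2) / 2 = -1 / 2}

/-- `k` limit cycles can bifurcate from the set `S`, with perturbations of degree `n`:
arbitrarily close to `S` there are, for suitable coefficients and all sufficiently small `ε > 0`,
at least `k` limit cycles. -/
def CanBifurcate (n : ℕ) (S : Set (ℝ × ℝ)) (k : ℕ) : Prop :=
  ∀ U ∈ 𝓝ˢ S, ∃ c : Coeffs, ∃ ε₀ : ℝ, 0 < ε₀ ∧ ∀ ε ∈ Ioo (0 : ℝ) ε₀,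
    (k : ℕ∞) ≤ (limitCyclesIn n c ε U).encard

/-- The maximal number of limit cycles in Hopf bifurcation near the origin. -/
def NHopf (n : ℕ) : ℕ∞ :=
  ⨆ (k : ℕ) (_ : CanBifurcate n {(0, 0)} k), (k : ℕ∞)

/-- The maximal number of limit cycles in homoclinic bifurcation near the compound loop. -/
def NHomoc (n : ℕ) : ℕ∞ :=
  ⨆ (k : ℕ) (_ : CanBifurcate n homoclinicLoop k), (k : ℕ∞)

end

end PiecewiseHam

namespace PiecewiseHam

open Set Filter Topology MeasureTheory

/-! ### A scalar differential equation with a small right-hand side -/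

/-! Only `p⁺` and `p⁻` are perturbed; `q⁺` and `q⁻` are zero. The unperturbed closed orbits are
labelled by the height `ρ ∈ (0, 1)` at which they cross the positive `y`-axis. To first order in
`ε`, a half turn on the left changes `ρ` by `ε ∫ cos s · p⁻ ds` along the half circle of radius `ρ`,
and a half turn on the right changes it by `ε ∫ p⁺ ds` along the arc `y = ρ s`, `-1 ≤ s ≤ 1`, of the
hyperbola `(x - 1)² - y² = 1 - ρ²`. The sum of the two integrals is the Melnikov function.

The monomials `xⁱ`, `i ≤ n`, on the left contribute nonzero multiples of `ρⁱ`. The polynomials `(1 -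
x) ((1 - x)² - y²)ʲ`, `2j + 1 ≤ n`, on the right contribute `(1 - ρ²)ʲ S(ρ)` with `S = 1 + (1 -
ρ²)/(2ρ) · log((1 + ρ)/(1 - ρ))`. The logarithm is not rational (`eq_zero_of_eval_eq_mul_log`), so
these `n + 1 + [(n + 1)/2]` functions are independent on every subinterval of `(0, 1)`, and the
constants are among their combinations.

A space of dimension `k + 1` of this kind has an element with alternating values `±1` at `k + 1`
points of a prescribed interval. Subtracting a regular value from `(-1, 1)`, which exists by Sard,
leaves `k` simple zeros (`exists_simple_zeros`). The interval may lie near `0` (Hopf) or near `1`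
(homoclinic). No asymptotic expansion at either end is needed: once the neighborhood is given, the
zeros are fixed points of `(0, 1)`, and only then does `ε` tend to zero.

A simple zero persists as a limit cycle (`eventually_exists_limitCycle`): the return map is `ρ + ε
M(ρ) + o(ε)`, with control of its difference quotients (`exists_scalar_timeMap`), so it has a fixed
point around which it strictly contracts or expands. Since `q^± = 0`, the coordinate `y` decreases
in `x < 0` and increases in `0 < x < 1`. Hence the orbit is a simple curve, and every closed orbit
in `x < 1` meets the switching line. The return map then excludes other closed orbits nearby,
sliding ones included (`exists_limitCycle`). -/

theorem exists_uniform_of_forall_eventually {a b r : ℝ} {Q : ℝ → ℝ → ℝ → Prop}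
    (h : ∀ s ∈ Icc a b, ∀ᶠ z : ℝ × ℝ × ℝ in 𝓝 (s, r, 0), Q z.1 z.2.1 z.2.2) :
    ∃ κ > 0, ∀ s ∈ Icc a b, ∀ u e, |u - r| ≤ κ → |e| ≤ κ → Q s u e := by
  have key : ∀ᶠ w : ℝ × ℝ in 𝓝 (r, 0), ∀ s ∈ Icc a b, Q s w.1 w.2 := by
    refine (isCompact_Icc (a := a) (b := b)).eventually_forall_of_forall_eventually ?_
    intro s hs
    have hc : Continuous fun z : (ℝ × ℝ) × ℝ => (z.2, z.1.1, z.1.2) := by fun_prop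
    exact (hc.tendsto ((r, 0), s)).eventually (h s hs)
  obtain ⟨κ, hκ, hball⟩ := Metric.eventually_nhds_iff.1 key
  refine ⟨κ / 2, by positivity, fun s hs u e hu he => hball (y := (u, e)) ?_ s hs⟩
  rw [Prod.dist_eq, max_lt_iff, Real.dist_eq, Real.dist_eq, sub_zero]
  constructor <;> linarith

/-- Strict differentiability at `(s, r, 0)` gives the estimate near each single `s`. The partial
derivative is continuous, so it may be evaluated at the nearby parameter instead, and compactness of
`[a, b]` makes `κ` uniform. -/
theorem exists_uniform_strict_deriv {f : ℝ × ℝ × ℝ → ℝ} {a b r : ℝ}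
    (hf : ∀ s ∈ Icc a b, ContDiffAt ℝ 1 f (s, r, 0)) {η : ℝ} (hη : 0 < η) :
    ∃ κ > 0, ∀ s ∈ Icc a b, ∀ u v e, |u - r| ≤ κ → |v - r| ≤ κ → |e| ≤ κ →
      |f (s, u, e) - f (s, v, e) - fderiv ℝ f (s, r, 0) (0, 1, 0) * (u - v)| ≤ η * |u - v| := by
  have key : ∀ᶠ w : ℝ × ℝ × ℝ in 𝓝 (r, r, 0), ∀ s ∈ Icc a b,
      |f (s, w.1, w.2.2) - f (s, w.2.1, w.2.2)
        - fderiv ℝ f (s, r, 0) (0, 1, 0) * (w.1 - w.2.1)| ≤ η * |w.1 - w.2.1| := by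
    refine (isCompact_Icc (a := a) (b := b)).eventually_forall_of_forall_eventually ?_
    intro s hs
    have hstrict := (hf s hs).hasStrictFDerivAt one_ne_zero
    have h1 := hstrict.isLittleO.def (half_pos hη)
    have hc : Continuous fun z : (ℝ × ℝ × ℝ) × ℝ =>
        (((z.2, z.1.1, z.1.2.2), (z.2, z.1.2.1, z.1.2.2)) :
          (ℝ × ℝ × ℝ) × (ℝ × ℝ × ℝ)) := by fun_prop
    have h2 := (hc.tendsto ((r, r, 0), s)).eventually h1
    have hcd : ContinuousAt (fun x => fderiv ℝ f x (0, 1, 0)) (s, r, 0) :=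
      ((hf s hs).continuousAt_fderiv one_ne_zero).clm_apply continuousAt_const
    have hc' : Continuous fun z : (ℝ × ℝ × ℝ) × ℝ => ((z.2, r, 0) : ℝ × ℝ × ℝ) := by fun_prop
    have h3 := (hc'.tendsto ((r, r, 0), s)).eventually
      (Metric.continuousAt_iff'.1 hcd (η / 2) (half_pos hη))
    filter_upwards [h2, h3] with z hz2 hz3
    obtain ⟨⟨u, v, e⟩, s'⟩ := z
    simp only [Prod.mk_sub_mk, sub_self] at hz2 hz3 ⊢
    have e1 : fderiv ℝ f (s, r, 0) (0, u - v, 0)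
        = fderiv ℝ f (s, r, 0) (0, 1, 0) * (u - v) := by
      have : ((0, u - v, 0) : ℝ × ℝ × ℝ) = (u - v) • (0, 1, 0) := by simp
      rw [this, map_smul, smul_eq_mul, mul_comm]
    have e2 : ‖((0, u - v, 0) : ℝ × ℝ × ℝ)‖ = |u - v| := by
      simp [Prod.norm_def]
    rw [e1, e2, Real.norm_eq_abs] at hz2
    rw [Real.dist_eq] at hz3
    have : f (s', u, e) - f (s', v, e) - fderiv ℝ f (s', r, 0) (0, 1, 0) * (u - v)
        = (f (s', u, e) - f (s', v, e) - fderiv ℝ f (s, r, 0) (0, 1, 0) * (u - v))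
        - (fderiv ℝ f (s', r, 0) (0, 1, 0) - fderiv ℝ f (s, r, 0) (0, 1, 0)) * (u - v) := by ring
    rw [this]
    refine (abs_sub _ _).trans ?_
    rw [abs_mul]
    have := mul_le_mul_of_nonneg_right hz3.le (abs_nonneg (u - v))
    linarith
  obtain ⟨κ, hκ, hball⟩ := Metric.eventually_nhds_iff.1 key
  refine ⟨κ / 2, by positivity, fun s hs u v e hu hv he => hball (y := (u, v, e)) ?_ s hs⟩
  simp only [Prod.dist_eq, max_lt_iff, Real.dist_eq, sub_zero]
  refine ⟨?_, ?_, ?_⟩ <;> linarith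

theorem continuousOn_partial_deriv {f : ℝ × ℝ × ℝ → ℝ} {a b r : ℝ}
    (hf : ∀ s ∈ Icc a b, ContDiffAt ℝ 1 f (s, r, 0)) :
    ContinuousOn (fun s => fderiv ℝ f (s, r, 0) (0, 1, 0)) (Icc a b) := by
  intro s hs
  have hcd : ContinuousAt (fun x => fderiv ℝ f x (0, 1, 0)) (s, r, 0) :=
    ((hf s hs).continuousAt_fderiv one_ne_zero).clm_apply continuousAt_const
  have hc : Continuous fun s : ℝ => ((s, r, 0) : ℝ × ℝ × ℝ) := by fun_prop
  exact (ContinuousAt.comp (f := fun s : ℝ => ((s, r, 0) : ℝ × ℝ × ℝ)) hcd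
    hc.continuousAt).continuousWithinAt

/-- Global solvability of a scalar equation whose right-hand side is small and Lipschitz on a
strip. -/
theorem exists_scalar_solution {F : ℝ → ℝ → ℝ} {a b r δ C K : ℝ} (hab : a ≤ b) (hδ : 0 < δ)
    (hK : 0 ≤ K)
    (hcont : ∀ u, |u - r| ≤ 2 * δ → ContinuousOn (fun s => F s u) (Icc a b))
    (hlip : ∀ s ∈ Icc a b, ∀ u v, |u - r| ≤ 2 * δ → |v - r| ≤ 2 * δ →
      |F s u - F s v| ≤ K * |u - v|)
    (hbound : ∀ s ∈ Icc a b, ∀ u, |u - r| ≤ 2 * δ → |F s u| ≤ C)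
    (hC : C * (b - a + 1) ≤ δ) {ρ : ℝ} (hρ : |ρ - r| ≤ δ) :
    ∃ u : ℝ → ℝ, u a = ρ ∧ ∀ s ∈ Icc a b, HasDerivAt u (F s (u s)) s ∧
      |u s - ρ| ≤ C * (b - a + 1) := by
  have hC0 : 0 ≤ C := (abs_nonneg _).trans
    (hbound a ⟨le_rfl, hab⟩ r (by rw [sub_self, abs_zero]; linarith))
  -- The state is clamped to the strip and the time to `[a, b]`, which makes the right-hand side
  -- globally bounded and Lipschitz in the state. By `hC` the solution never leaves the strip, so
  -- the clamping has no effect on `[a, b]`.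
  let cl : ℝ → ℝ := fun x => max (r - 2 * δ) (min (r + 2 * δ) x)
  have hcl : ∀ x, |cl x - r| ≤ 2 * δ := by
    intro x
    rw [abs_le]
    constructor
    · have := le_max_left (r - 2 * δ) (min (r + 2 * δ) x)
      simp only [cl]; linarith
    · have : cl x ≤ r + 2 * δ := max_le (by linarith) (min_le_left _ _)
      linarith
  have hcl_eq : ∀ x, |x - r| ≤ 2 * δ → cl x = x := by
    intro x hx
    rw [abs_le] at hx
    simp only [cl]
    rw [min_eq_right (by linarith), max_eq_right (by linarith)]
  have hcl_lip : ∀ x y, |cl x - cl y| ≤ |x - y| := by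
    intro x y
    calc |cl x - cl y| ≤ max |r - 2 * δ - (r - 2 * δ)| |min (r + 2 * δ) x - min (r + 2 * δ) y| :=
          abs_max_sub_max_le_max _ _ _ _
      _ ≤ |min (r + 2 * δ) x - min (r + 2 * δ) y| := by simp
      _ ≤ max |r + 2 * δ - (r + 2 * δ)| |x - y| := abs_min_sub_min_le_max _ _ _ _
      _ = |x - y| := by simp
  let pr : ℝ → ℝ := fun s => (projIcc a b hab s : ℝ)
  have hpr : ∀ s, pr s ∈ Icc a b := fun s => (projIcc a b hab s).2
  have hpr_eq : ∀ s ∈ Icc a b, pr s = s := fun s hs => by simp [pr, projIcc_of_mem hab hs]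
  have hprc : Continuous pr := continuous_subtype_val.comp continuous_projIcc
  -- Solving on `[a - 1, b + 1]` makes the derivatives at `a` and `b` two-sided; this is the origin
  -- of the length `b - a + 1`.
  have hpl : IsPicardLindelof (fun s x => F (pr s) (cl x)) (tmin := a - 1) (tmax := b + 1)
      ⟨a, by constructor <;> linarith⟩ ρ (Real.toNNReal (C * (b - a + 1))) 0 C.toNNReal
      K.toNNReal := by
    refine ⟨?_, ?_, ?_, ?_⟩
    · intro s _
      refine LipschitzOnWith.of_dist_le_mul fun x _ y _ => ?_
      rw [Real.dist_eq, Real.dist_eq, Real.coe_toNNReal _ hK]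
      exact (hlip _ (hpr s) _ _ (hcl x) (hcl y)).trans
        (mul_le_mul_of_nonneg_left (hcl_lip x y) hK)
    · intro x _
      exact ((hcont _ (hcl x)).comp_continuous hprc hpr).continuousOn
    · intro s _ x _
      rw [Real.coe_toNNReal _ hC0]
      exact hbound _ (hpr s) _ (hcl x)
    · rw [Real.coe_toNNReal _ hC0, Real.coe_toNNReal _ (mul_nonneg hC0 (by linarith))]
      have : max (b + 1 - a) (a - (a - 1)) = b - a + 1 := by
        rw [max_eq_left (by linarith)]; ring
      simp only [NNReal.coe_zero, sub_zero, this, le_refl]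
  obtain ⟨u, hu0, hu⟩ := hpl.exists_eq_forall_mem_Icc_hasDerivWithinAt
    (x := ρ) (Metric.mem_closedBall_self le_rfl)
  simp only at hu0
  have hclose : ∀ s ∈ Icc a b, |u s - ρ| ≤ C * (b - a + 1) := by
    have h1 := norm_image_sub_le_of_norm_deriv_le_segment' (f := u) (a := a) (b := b)
      (f' := fun s => F (pr s) (cl (u s))) (C := C)
      (fun s hs => (hu s ⟨by linarith [hs.1], by linarith [hs.2]⟩).mono
        (Icc_subset_Icc (by linarith) (by linarith)))
      (fun s _ => hbound _ (hpr s) _ (hcl _))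
    intro s hs
    have h2 := h1 s hs
    rw [hu0, Real.norm_eq_abs] at h2
    exact h2.trans (mul_le_mul_of_nonneg_left (by linarith [hs.2]) hC0)
  refine ⟨u, hu0, fun s hs => ⟨?_, hclose s hs⟩⟩
  have h1 := (hu s ⟨by linarith [hs.1], by linarith [hs.2]⟩).hasDerivAt
    (Icc_mem_nhds (by linarith [hs.1]) (by linarith [hs.2]))
  have h2 : |u s - r| ≤ 2 * δ := by
    have := abs_sub_le (u s) ρ r
    linarith [hclose s hs]
  simpa [hpr_eq s hs, hcl_eq _ h2] using h1

theorem abs_sub_le_of_scalar_solutions {F : ℝ → ℝ → ℝ} {a b K : ℝ} (hK : 0 ≤ K)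
    {I : Set ℝ} (hlip : ∀ s ∈ Icc a b, ∀ u ∈ I, ∀ v ∈ I, |F s u - F s v| ≤ K * |u - v|)
    {u v : ℝ → ℝ} (hu : ∀ s ∈ Icc a b, HasDerivAt u (F s (u s)) s ∧ u s ∈ I)
    (hv : ∀ s ∈ Icc a b, HasDerivAt v (F s (v s)) s ∧ v s ∈ I) {s : ℝ} (hs : s ∈ Icc a b) :
    |u s - v s| ≤ |u a - v a| * Real.exp (K * (s - a)) := by
  have := dist_le_of_trajectories_ODE_of_mem (v := F) (K := K.toNNReal) (s := fun _ => I)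
    (f := u) (g := v) (a := a) (b := b) (δ := |u a - v a|)
    (fun t ht => LipschitzOnWith.of_dist_le_mul fun x hx y hy => by
      rw [Real.dist_eq, Real.dist_eq, Real.coe_toNNReal _ hK]
      exact hlip t (Ico_subset_Icc_self ht) x hx y hy)
    (fun t ht => (hu t ht).1.continuousAt.continuousWithinAt)
    (fun t ht => (hu t (Ico_subset_Icc_self ht)).1.hasDerivWithinAt)
    (fun t ht => (hu t (Ico_subset_Icc_self ht)).2)
    (fun t ht => (hv t ht).1.continuousAt.continuousWithinAt)
    (fun t ht => (hv t (Ico_subset_Icc_self ht)).1.hasDerivWithinAt)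
    (fun t ht => (hv t (Ico_subset_Icc_self ht)).2)
    (le_of_eq (Real.dist_eq _ _)) s hs
  rwa [Real.dist_eq, Real.coe_toNNReal _ hK] at this

/-- Differentiation under the integral sign. It identifies the slope of the time map with the
derivative of the Melnikov integral, which is known explicitly. -/
theorem hasDerivAt_integral_of_contDiffAt {f : ℝ × ℝ × ℝ → ℝ} {a b r : ℝ} (hab : a ≤ b)
    (hf : ∀ s ∈ Icc a b, ContDiffAt ℝ 1 f (s, r, 0)) :
    HasDerivAt (fun ρ => ∫ s in a..b, f (s, ρ, 0))
      (∫ s in a..b, fderiv ℝ f (s, r, 0) (0, 1, 0)) r := by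
  have hcont : ∃ κ > 0, ∀ s ∈ Icc a b, ∀ u e, |u - r| ≤ κ → |e| ≤ κ →
      ContinuousAt f (s, u, e) := by
    refine exists_uniform_of_forall_eventually fun s hs => ?_
    exact ((hf s hs).eventually (by simp)).mono fun z hz => hz.continuousAt
  obtain ⟨κ₁, hκ₁, hc⟩ := hcont
  have hint : ∀ u, |u - r| ≤ κ₁ → IntervalIntegrable (fun s => f (s, u, 0)) volume a b := by
    intro u hu
    apply ContinuousOn.intervalIntegrable
    rw [uIcc_of_le hab]
    intro s hs
    exact (ContinuousAt.comp (f := fun s : ℝ => ((s, u, 0) : ℝ × ℝ × ℝ))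
      (hc s hs u 0 hu (by simpa using hκ₁.le)) (by fun_prop)).continuousWithinAt
  have hintd : IntervalIntegrable (fun s => fderiv ℝ f (s, r, 0) (0, 1, 0)) volume a b := by
    apply ContinuousOn.intervalIntegrable
    rw [uIcc_of_le hab]
    exact continuousOn_partial_deriv hf
  rw [hasDerivAt_iff_isLittleO, Asymptotics.isLittleO_iff]
  intro c hc0
  obtain ⟨κ, hκ, hs⟩ := exists_uniform_strict_deriv hf
    (η := c / (b - a + 1)) (by have : 0 < b - a + 1 := by linarith
                               positivity)
  have hmem : Metric.ball r (min κ κ₁) ∈ 𝓝 r := Metric.ball_mem_nhds _ (lt_min hκ hκ₁)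
  filter_upwards [hmem] with u hu
  rw [Metric.mem_ball, Real.dist_eq, lt_min_iff] at hu
  have e : (∫ s in a..b, f (s, u, 0)) - (∫ s in a..b, f (s, r, 0))
      - (u - r) • ∫ s in a..b, fderiv ℝ f (s, r, 0) (0, 1, 0)
      = ∫ s in a..b, (f (s, u, 0) - f (s, r, 0)
        - fderiv ℝ f (s, r, 0) (0, 1, 0) * (u - r)) := by
    rw [intervalIntegral.integral_sub ((hint u hu.2.le).sub (hint r (by simpa using hκ₁.le)))
      (hintd.mul_const _), intervalIntegral.integral_sub (hint u hu.2.le)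
      (hint r (by simpa using hκ₁.le)), intervalIntegral.integral_mul_const, smul_eq_mul]
    ring
  rw [e]
  refine (intervalIntegral.norm_integral_le_of_norm_le_const
    (C := c / (b - a + 1) * |u - r|) fun s hs' => ?_).trans ?_
  · rw [uIoc_of_le hab] at hs'
    exact hs s (Ioc_subset_Icc_self hs') u r 0 hu.1.le (by simpa using hκ.le)
      (by simpa using hκ.le)
  · rw [abs_of_nonneg (by linarith : 0 ≤ b - a), Real.norm_eq_abs]
    have h1 : c / (b - a + 1) * (b - a) ≤ c := by
      rw [div_mul_eq_mul_div, div_le_iff₀ (by linarith)]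
      nlinarith
    nlinarith [abs_nonneg (u - r)]

/-- Expansion, to first order in the small parameter `ε`, of the time map of
`dρ/ds = ε f(s, ρ, ε)` and of its difference quotients. -/
theorem exists_scalar_timeMap {f : ℝ × ℝ × ℝ → ℝ} {a b r : ℝ} (hab : a < b)
    (hf : ∀ s ∈ Icc a b, ContDiffAt ℝ 1 f (s, r, 0)) {η : ℝ} (hη : 0 < η) :
    ∀ᶠ δ in 𝓝[>] (0 : ℝ), ∀ η₂ > 0, ∀ᶠ e in 𝓝[>] (0 : ℝ), ∃ u : ℝ → ℝ → ℝ,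
      (∀ ρ, |ρ - r| ≤ δ → u ρ a = ρ ∧ ∀ s ∈ Icc a b,
        HasDerivAt (u ρ) (e * f (s, u ρ s, e)) s ∧ |u ρ s - ρ| ≤ η₂) ∧
      |u r b - r - e * ∫ s in a..b, f (s, r, 0)| ≤ η₂ * e ∧
      ∀ ρ ρ', |ρ - r| ≤ δ → |ρ' - r| ≤ δ →
        |u ρ b - u ρ' b - (1 + e * ∫ s in a..b, fderiv ℝ f (s, r, 0) (0, 1, 0)) * (ρ - ρ')|
          ≤ e * η * |ρ - ρ'| := by
  have hba : 0 < b - a := sub_pos.2 hab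
  set d : ℝ → ℝ := fun s => fderiv ℝ f (s, r, 0) (0, 1, 0) with hd
  have hdc : ContinuousOn d (Icc a b) := continuousOn_partial_deriv hf
  obtain ⟨D, hD⟩ := isCompact_Icc.exists_bound_of_continuousOn hdc
  have hD0 : 0 ≤ D := (norm_nonneg _).trans (hD a ⟨le_rfl, hab.le⟩)
  -- The integrand of the slope error will be at most `4 e η₁ |Δ|`, over an interval of length `b -
  -- a`.
  set η₁ : ℝ := η / (4 * (b - a)) with hη₁
  have hη₁0 : 0 < η₁ := by positivity
  obtain ⟨κ₁, hκ₁, hstrict⟩ := exists_uniform_strict_deriv hf hη₁0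
  have hcont : ∃ κ > 0, ∀ s ∈ Icc a b, ∀ u e, |u - r| ≤ κ → |e| ≤ κ →
      ContinuousAt f (s, u, e) := by
    refine exists_uniform_of_forall_eventually fun s hs => ?_
    exact ((hf s hs).eventually (by simp)).mono fun z hz => hz.continuousAt
  obtain ⟨κ₂, hκ₂, hc⟩ := hcont
  have hf0c : ContinuousOn (fun s => f (s, r, 0)) (Icc a b) := fun s hs =>
    (ContinuousAt.comp (f := fun s : ℝ => ((s, r, 0) : ℝ × ℝ × ℝ))
      (hf s hs).continuousAt (by fun_prop)).continuousWithinAt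
  obtain ⟨C₀, hC₀⟩ := isCompact_Icc.exists_bound_of_continuousOn hf0c
  have hC₀0 : 0 ≤ C₀ := (norm_nonneg _).trans (hC₀ a ⟨le_rfl, hab.le⟩)
  have hnear : ∀ η₃ > 0, ∃ κ > 0, ∀ s ∈ Icc a b, ∀ u e, |u - r| ≤ κ → |e| ≤ κ →
      |f (s, u, e) - f (s, r, 0)| ≤ η₃ := by
    intro η₃ hη₃
    refine exists_uniform_of_forall_eventually
      (Q := fun s u e => |f (s, u, e) - f (s, r, 0)| ≤ η₃) fun s hs => ?_
    have h1 := Metric.continuousAt_iff'.1 (hf s hs).continuousAt (η₃ / 2) (half_pos hη₃)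
    have hcp : Continuous fun z : ℝ × ℝ × ℝ => ((z.1, r, 0) : ℝ × ℝ × ℝ) := by fun_prop
    have h2 := (hcp.tendsto (s, r, 0)).eventually h1
    filter_upwards [h1, h2] with z hz1 hz2
    rw [Real.dist_eq] at hz1 hz2
    have := abs_sub_le (f z) (f (s, r, 0)) (f (z.1, r, 0))
    rw [abs_sub_comm (f (s, r, 0))] at this
    simp only [Prod.mk.eta]
    linarith
  obtain ⟨κ₃, hκ₃, hone⟩ := hnear 1 one_pos
  set C : ℝ := C₀ + 1 with hCdef
  have hCpos : 0 < C := by positivity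
  set K : ℝ := D + η₁ with hKdef
  have hK0 : 0 ≤ K := by positivity
  set κ := min κ₁ (min κ₂ κ₃) with hκdef
  have hκ : 0 < κ := lt_min hκ₁ (lt_min hκ₂ hκ₃)
  have hκ1 : κ ≤ κ₁ := min_le_left _ _
  have hκ2 : κ ≤ κ₂ := (min_le_right _ _).trans (min_le_left _ _)
  have hκ3 : κ ≤ κ₃ := (min_le_right _ _).trans (min_le_right _ _)
  have hlip : ∀ e, |e| ≤ κ → ∀ s ∈ Icc a b, ∀ u v, |u - r| ≤ κ → |v - r| ≤ κ →
      |f (s, u, e) - f (s, v, e)| ≤ K * |u - v| := by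
    intro e he s hs u v hu hv
    have h1 := hstrict s hs u v e (hu.trans hκ1) (hv.trans hκ1) (he.trans hκ1)
    have h2 := abs_sub_abs_le_abs_sub (f (s, u, e) - f (s, v, e)) (d s * (u - v))
    rw [abs_mul] at h2
    have h3 := mul_le_mul_of_nonneg_right (hD s hs) (abs_nonneg (u - v))
    rw [Real.norm_eq_abs] at h3
    rw [hKdef, add_mul]
    linarith
  have hbd : ∀ e, |e| ≤ κ → ∀ s ∈ Icc a b, ∀ u, |u - r| ≤ κ → |f (s, u, e)| ≤ C := by
    intro e he s hs u hu
    have h1 := hone s hs u e (hu.trans hκ3) (he.trans hκ3)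
    have h2 := abs_sub_abs_le_abs_sub (f (s, u, e)) (f (s, r, 0))
    have h3 := hC₀ s hs
    rw [Real.norm_eq_abs] at h3
    linarith
  -- The window `δ` is chosen before `η₂` because `η₂` will later have to be small compared with
  -- `δ`.
  filter_upwards [Ioo_mem_nhdsGT (half_pos hκ)] with δ hδ η₂ hη₂
  obtain ⟨κ₄, hκ₄, hclose⟩ := hnear (η₂ / (b - a)) (by positivity)
  have hsmall : ∀ A : ℝ, ∀ B > 0, ∀ᶠ e in 𝓝[>] (0 : ℝ), e * A < B := by
    intro A B hB
    have : Tendsto (fun e : ℝ => e * A) (𝓝[>] 0) (𝓝 (0 * A)) :=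
      (tendsto_id.mul_const A).mono_left nhdsWithin_le_nhds
    rw [zero_mul] at this
    exact this.eventually_lt_const hB
  filter_upwards [self_mem_nhdsWithin, hsmall 1 κ hκ, hsmall 1 κ₄ hκ₄,
    hsmall (C * (b - a + 1)) (min (min δ κ₄) η₂) (lt_min (lt_min hδ.1 hκ₄) hη₂),
    hsmall (K * (b - a)) (Real.log 2) (Real.log_pos one_lt_two),
    hsmall (D * K * (b - a)) η₁ hη₁0] with e he0 he1 he2 he3 he4 he5
  have he0 : 0 < e := he0
  rw [mul_one] at he1 he2
  have heκ : |e| ≤ κ := by rw [abs_of_pos he0]; exact he1.le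
  have h2δ : 2 * δ ≤ κ := by linarith [hδ.2]
  have hex : ∀ ρ, |ρ - r| ≤ δ → ∃ u : ℝ → ℝ, u a = ρ ∧ ∀ s ∈ Icc a b,
      HasDerivAt u (e * f (s, u s, e)) s ∧ |u s - ρ| ≤ e * C * (b - a + 1) := by
    intro ρ hρ
    refine exists_scalar_solution (F := fun s x => e * f (s, x, e)) (K := e * K) hab.le hδ.1
      (by positivity) ?_ ?_ ?_ ?_ hρ
    · intro x hx s hs
      refine ContinuousWithinAt.mul continuousWithinAt_const ?_
      exact (ContinuousAt.comp (f := fun s : ℝ => ((s, x, e) : ℝ × ℝ × ℝ))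
        (hc s hs x e (by linarith) (by linarith)) (by fun_prop)).continuousWithinAt
    · intro s hs x y hx hy
      rw [← mul_sub, abs_mul, abs_of_pos he0, mul_assoc]
      exact mul_le_mul_of_nonneg_left (hlip e heκ s hs x y (hx.trans h2δ) (hy.trans h2δ)) he0.le
    · intro s hs x hx
      rw [abs_mul, abs_of_pos he0]
      exact mul_le_mul_of_nonneg_left (hbd e heκ s hs x (hx.trans h2δ)) he0.le
    · rw [mul_assoc]
      exact (he3.le.trans (min_le_left _ _)).trans (min_le_left _ _)
  choose! u hu0 hu using hex
  have hmove : e * C * (b - a + 1) < min (min δ κ₄) η₂ := by rw [mul_assoc]; exact he3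
  have hmem : ∀ ρ, |ρ - r| ≤ δ → ∀ s ∈ Icc a b, |u ρ s - r| ≤ κ := by
    intro ρ hρ s hs
    have h1 := abs_sub_le (u ρ s) ρ r
    have h2 := (hu ρ hρ s hs).2
    have h3 := hmove.le.trans ((min_le_left _ _).trans (min_le_left _ _))
    linarith
  have hFc : ∀ ρ, |ρ - r| ≤ δ → ContinuousOn (fun s => e * f (s, u ρ s, e)) (Icc a b) := by
    intro ρ hρ s hs
    refine ContinuousWithinAt.mul continuousWithinAt_const ?_
    refine (ContinuousAt.comp (f := fun s : ℝ => ((s, u ρ s, e) : ℝ × ℝ × ℝ))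
      (hc s hs _ e ((hmem ρ hρ s hs).trans hκ2) (heκ.trans hκ2)) ?_).continuousWithinAt
    exact continuousAt_id.prodMk ((hu ρ hρ s hs).1.continuousAt.prodMk continuousAt_const)
  have hFi : ∀ ρ, |ρ - r| ≤ δ →
      IntervalIntegrable (fun s => e * f (s, u ρ s, e)) volume a b := by
    intro ρ hρ
    apply ContinuousOn.intervalIntegrable
    rw [uIcc_of_le hab.le]
    exact hFc ρ hρ
  have hFTC : ∀ ρ, |ρ - r| ≤ δ → ∫ s in a..b, e * f (s, u ρ s, e) = u ρ b - ρ := by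
    intro ρ hρ
    have := intervalIntegral.integral_eq_sub_of_hasDerivAt (f := u ρ)
      (f' := fun s => e * f (s, u ρ s, e)) (a := a) (b := b)
      (fun s hs => (hu ρ hρ s (by rwa [uIcc_of_le hab.le] at hs)).1) (hFi ρ hρ)
    rwa [hu0 ρ hρ] at this
  have hrr : |r - r| ≤ δ := by simpa using hδ.1.le
  refine ⟨u, fun ρ hρ => ⟨hu0 ρ hρ, fun s hs => ⟨(hu ρ hρ s hs).1, ?_⟩⟩, ?_, ?_⟩
  · exact (hu ρ hρ s hs).2.trans (hmove.le.trans (min_le_right _ _))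
  · have hi0 : IntervalIntegrable (fun s => e * f (s, r, 0)) volume a b := by
      apply ContinuousOn.intervalIntegrable
      rw [uIcc_of_le hab.le]
      exact continuousOn_const.mul hf0c
    rw [← hFTC r hrr, ← intervalIntegral.integral_const_mul,
      ← intervalIntegral.integral_sub (hFi r hrr) hi0, ← Real.norm_eq_abs]
    refine (intervalIntegral.norm_integral_le_of_norm_le_const
      (C := e * (η₂ / (b - a))) fun s hs => ?_).trans ?_
    · rw [uIoc_of_le hab.le] at hs
      have hs' := Ioc_subset_Icc_self hs
      rw [← mul_sub, norm_mul, Real.norm_eq_abs, Real.norm_eq_abs, abs_of_pos he0]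
      refine mul_le_mul_of_nonneg_left (hclose s hs' _ e ?_ ?_) he0.le
      · exact (hu r hrr s hs').2.trans (hmove.le.trans ((min_le_left _ _).trans (min_le_right _ _)))
      · rw [abs_of_pos he0]; exact he2.le
    · rw [abs_of_pos hba]
      apply le_of_eq
      field_simp
  · intro ρ ρ' hρ hρ'
    set Δ := ρ - ρ' with hΔ
    have hE : ∀ s ∈ Icc a b, |u ρ s - u ρ' s| ≤ 2 * |Δ| := by
      intro s hs
      have h1 := abs_sub_le_of_scalar_solutions (F := fun s x => e * f (s, x, e)) (a := a)
        (b := b) (K := e * K) (by positivity) (I := {x | |x - r| ≤ κ})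
        (fun s hs x hx y hy => by
          rw [← mul_sub, abs_mul, abs_of_pos he0, mul_assoc]
          exact mul_le_mul_of_nonneg_left (hlip e heκ s hs x y hx hy) he0.le)
        (u := u ρ) (v := u ρ') (fun s hs => ⟨(hu ρ hρ s hs).1, hmem ρ hρ s hs⟩)
        (fun s hs => ⟨(hu ρ' hρ' s hs).1, hmem ρ' hρ' s hs⟩) hs
      rw [hu0 ρ hρ, hu0 ρ' hρ'] at h1
      have h2 : Real.exp (e * K * (s - a)) ≤ 2 := by
        rw [← Real.le_log_iff_exp_le two_pos]
        refine le_trans ?_ he4.le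
        rw [mul_assoc]
        exact mul_le_mul_of_nonneg_left (mul_le_mul_of_nonneg_left (by linarith [hs.2]) hK0) he0.le
      calc _ ≤ _ := h1
        _ ≤ |Δ| * 2 := mul_le_mul_of_nonneg_left h2 (abs_nonneg _)
        _ = 2 * |Δ| := mul_comm _ _
    have hW : ∀ s ∈ Icc a b, |u ρ s - u ρ' s - Δ| ≤ e * (K * (2 * |Δ|)) * (b - a) := by
      have h1 := norm_image_sub_le_of_norm_deriv_le_segment' (f := fun s => u ρ s - u ρ' s)
        (f' := fun s => e * f (s, u ρ s, e) - e * f (s, u ρ' s, e)) (a := a) (b := b)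
        (C := e * (K * (2 * |Δ|)))
        (fun s hs => ((hu ρ hρ s hs).1.sub (hu ρ' hρ' s hs).1).hasDerivWithinAt)
        (fun s hs => by
          have hs' := Ico_subset_Icc_self hs
          rw [← mul_sub, norm_mul, Real.norm_eq_abs, Real.norm_eq_abs, abs_of_pos he0]
          refine mul_le_mul_of_nonneg_left ?_ he0.le
          exact (hlip e heκ s hs' _ _ (hmem ρ hρ s hs') (hmem ρ' hρ' s hs')).trans
            (mul_le_mul_of_nonneg_left (hE s hs') hK0))
      intro s hs
      have h2 := h1 s hs
      simp only [hu0 ρ hρ, hu0 ρ' hρ', Real.norm_eq_abs] at h2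
      exact h2.trans (mul_le_mul_of_nonneg_left (by linarith [hs.2]) (by positivity))
    have hdi : IntervalIntegrable (fun s => e * Δ * d s) volume a b := by
      apply ContinuousOn.intervalIntegrable
      rw [uIcc_of_le hab.le]
      exact continuousOn_const.mul hdc
    have e1 : u ρ b - u ρ' b - (1 + e * ∫ s in a..b, d s) * Δ
        = ∫ s in a..b, (e * f (s, u ρ s, e) - e * f (s, u ρ' s, e) - e * Δ * d s) := by
      rw [intervalIntegral.integral_sub ((hFi ρ hρ).sub (hFi ρ' hρ')) hdi,
        intervalIntegral.integral_sub (hFi ρ hρ) (hFi ρ' hρ'), hFTC ρ hρ, hFTC ρ' hρ',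
        intervalIntegral.integral_const_mul, hΔ]
      ring
    rw [e1, ← Real.norm_eq_abs]
    refine (intervalIntegral.norm_integral_le_of_norm_le_const
      (C := e * (4 * η₁ * |Δ|)) fun s hs => ?_).trans ?_
    · rw [uIoc_of_le hab.le] at hs
      have hs' := Ioc_subset_Icc_self hs
      -- Two errors, each at most `2 η₁ |Δ|`: linearizing `f` between the two solutions, and
      -- replacing their current distance by the initial one `Δ`.
      have e2 : e * f (s, u ρ s, e) - e * f (s, u ρ' s, e) - e * Δ * d s
          = e * ((f (s, u ρ s, e) - f (s, u ρ' s, e) - d s * (u ρ s - u ρ' s))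
            + d s * (u ρ s - u ρ' s - Δ)) := by ring
      rw [e2, norm_mul, Real.norm_eq_abs, Real.norm_eq_abs, abs_of_pos he0]
      refine mul_le_mul_of_nonneg_left ((abs_add_le _ _).trans ?_) he0.le
      have h1 := hstrict s hs' (u ρ s) (u ρ' s) e ((hmem ρ hρ s hs').trans hκ1)
        ((hmem ρ' hρ' s hs').trans hκ1) (heκ.trans hκ1)
      have h2 := mul_le_mul_of_nonneg_left (hE s hs') hη₁0.le
      have h3 : |d s * (u ρ s - u ρ' s - Δ)| ≤ D * (e * (K * (2 * |Δ|)) * (b - a)) := by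
        rw [abs_mul]
        exact mul_le_mul (hD s hs') (hW s hs') (abs_nonneg _) hD0
      have h4 : D * (e * (K * (2 * |Δ|)) * (b - a)) = e * (D * K * (b - a)) * (2 * |Δ|) := by ring
      have h5 := mul_le_mul_of_nonneg_right he5.le (by positivity : 0 ≤ 2 * |Δ|)
      linarith
    · rw [abs_of_pos hba, hη₁]
      apply le_of_eq
      field_simp

end PiecewiseHam


namespace PiecewiseHam

open Set Filter Topology MeasureTheory

/-! ### Arcs of a vector field between two visits of the switching line -/

/-- A curve that traces, up to a change of time, an integral curve of `X` can be reparametrized. -/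
theorem exists_integralCurve_of_reparam {E : Type*} [NormedAddCommGroup E] [NormedSpace ℝ E]
    {X : E → E} {Z : ℝ → E} {g : ℝ → ℝ} {a b : ℝ} (hab : a < b) (hg : ContinuousOn g (Icc a b))
    (hpos : ∀ s ∈ Icc a b, 0 < g s) (hZ : ∀ s ∈ Icc a b, HasDerivAt Z (g s • X (Z s)) s) :
    ∃ (T : ℝ) (ζ : ℝ → E), 0 < T ∧ ζ 0 = Z a ∧ ζ T = Z b ∧
      (∀ t ∈ Icc 0 T, HasDerivAt ζ (X (ζ t)) t) ∧
      (∀ t ∈ Icc 0 T, ∃ s ∈ Icc a b, ζ t = Z s) ∧ ∀ t ∈ Ioo 0 T, ∃ s ∈ Ioo a b, ζ t = Z s := by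
  obtain ⟨s₀, hs₀, hmin⟩ := isCompact_Icc.exists_isMinOn ⟨a, le_rfl, hab.le⟩ hg
  set c := g s₀ with hc
  have hc0 : 0 < c := hpos s₀ hs₀
  -- Extending `g` by its end values makes the time function `τ` a bijection of the whole line with
  -- slope at least `c`, so its inverse is differentiable at the end points too.
  let pr : ℝ → ℝ := fun s => (projIcc a b hab.le s : ℝ)
  have hpr : ∀ s, pr s ∈ Icc a b := fun s => (projIcc a b hab.le s).2
  have hpr_eq : ∀ s ∈ Icc a b, pr s = s := fun s hs => by simp [pr, projIcc_of_mem hab.le hs]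
  have hprc : Continuous pr := continuous_subtype_val.comp continuous_projIcc
  have hGc : Continuous fun s => g (pr s) := hg.comp_continuous hprc hpr
  have hGmin : ∀ s, c ≤ g (pr s) := fun s => hmin (hpr s)
  let τ : ℝ → ℝ := fun s => ∫ x in a..s, g (pr x)
  have hτ : ∀ s, HasDerivAt τ (g (pr s)) s := fun s => (hGc.integral_hasStrictDerivAt a s).hasDerivAt
  have hτa : τ a = 0 := intervalIntegral.integral_same
  have hmono : StrictMono τ := strictMono_of_hasDerivAt_pos hτ fun s => hc0.trans_le (hGmin s)
  have hmono' : Monotone fun s => τ s - c * s := by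
    refine monotone_of_hasDerivAt_nonneg (f' := fun s => g (pr s) - c) (fun s => ?_)
      fun s => sub_nonneg.2 (hGmin s)
    simpa using (hτ s).fun_sub ((hasDerivAt_id' s).const_mul c)
  have hcont : Continuous τ := continuous_iff_continuousAt.2 fun s => (hτ s).continuousAt
  have htop : Tendsto τ atTop atTop := by
    refine tendsto_atTop_mono' (f₁ := fun s => c * s - c * a) atTop ?_ ?_
    · filter_upwards [eventually_ge_atTop a] with s hs
      have := hmono' hs
      simp only [hτa] at this
      linarith
    · exact tendsto_atTop_add_const_right _ _ (tendsto_id.const_mul_atTop hc0)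
  have hbot : Tendsto τ atBot atBot := by
    refine tendsto_atBot_mono' (f₁ := fun s => c * s - c * a) atBot ?_ ?_
    · filter_upwards [eventually_le_atBot a] with s hs
      have := hmono' hs
      simp only [hτa] at this
      linarith
    · exact tendsto_atBot_add_const_right _ _ (tendsto_id.const_mul_atBot hc0)
  let φ := hmono.orderIsoOfSurjective τ (hcont.surjective htop hbot)
  have hφ : ∀ s, φ s = τ s := fun s => rfl
  have hφs : ∀ t, τ (φ.symm t) = t := fun t => φ.apply_symm_apply t
  have hs0 : φ.symm 0 = a := by rw [OrderIso.symm_apply_eq, hφ, hτa]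
  have hsT : φ.symm (τ b) = b := by rw [OrderIso.symm_apply_eq, hφ]
  have hmemIcc : ∀ t ∈ Icc 0 (τ b), φ.symm t ∈ Icc a b := by
    intro t ht
    constructor
    · rw [← hs0]; exact φ.symm.monotone ht.1
    · rw [← hsT]; exact φ.symm.monotone ht.2
  refine ⟨τ b, fun t => Z (φ.symm t), ?_, congrArg Z hs0, congrArg Z hsT, ?_, ?_, ?_⟩
  · rw [← hτa]; exact hmono hab
  · intro t ht
    have hmem := hmemIcc t ht
    have h1 : HasDerivAt φ.symm (g (pr (φ.symm t)))⁻¹ t :=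
      HasDerivAt.of_local_left_inverse φ.symm.continuous.continuousAt (hτ _)
        (hc0.trans_le (hGmin _)).ne' (Eventually.of_forall hφs)
    have h2 := (hZ _ hmem).scomp t h1
    rw [hpr_eq _ hmem, smul_smul, inv_mul_cancel₀ (hpos _ hmem).ne', one_smul] at h2
    exact h2
  · exact fun t ht => ⟨φ.symm t, hmemIcc t ht, rfl⟩
  · refine fun t ht => ⟨φ.symm t, ⟨?_, ?_⟩, rfl⟩
    · rw [← hs0]; exact φ.symm.strictMono ht.1
    · rw [← hsT]; exact φ.symm.strictMono ht.2

/-- `ζ` is, on `[0, T]`, an integral curve of `X` from `z₀` to `z₁`, that lies strictly on the side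
`σ * x < 0` of the switching line in between. -/
structure IsArc (X : ℝ × ℝ → ℝ × ℝ) (σ : ℝ) (z₀ z₁ : ℝ × ℝ) (T : ℝ) (ζ : ℝ → ℝ × ℝ) : Prop where
  pos : 0 < T
  source : ζ 0 = z₀
  target : ζ T = z₁
  hasDerivAt : ∀ t ∈ Icc 0 T, HasDerivAt ζ (X (ζ t)) t
  side : ∀ t ∈ Ioo 0 T, σ * (ζ t).1 < 0

/-- Near `r` and for small parameters `e`, the fields `X e` have arcs in `V` from `(0, σ ρ)` to
`(0, -σ P(ρ))` with `P(ρ) = ρ + e m(ρ) + o(e)`, where `m` is the value of this function at `r`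
and `m'` that of its derivative. -/
def IsHalfMap (X : ℝ → ℝ × ℝ → ℝ × ℝ) (σ r m m' : ℝ) (V : Set (ℝ × ℝ)) : Prop :=
  ∀ η > 0, ∀ᶠ δ in 𝓝[>] (0 : ℝ), ∀ η₂ > 0, ∀ᶠ e in 𝓝[>] (0 : ℝ), ∃ P : ℝ → ℝ,
    |P r - r - e * m| ≤ η₂ * e ∧
    (∀ ρ ρ', |ρ - r| ≤ δ → |ρ' - r| ≤ δ →
      |P ρ - P ρ' - (1 + e * m') * (ρ - ρ')| ≤ e * η * |ρ - ρ'|) ∧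
    ∀ ρ, |ρ - r| ≤ δ → |P ρ - ρ| ≤ η₂ ∧
      ∃ (T : ℝ) (ζ : ℝ → ℝ × ℝ), IsArc (X e) σ (0, σ * ρ) (0, -(σ * P ρ)) T ζ ∧
        ∀ t ∈ Icc 0 T, ζ t ∈ V

/-- Arcs from a scalar equation `dρ/ds = e f(s, ρ, e)` in coordinates `(x, y) = Φ(s, ρ)`. -/
theorem isHalfMap_of_coordinates {X : ℝ → ℝ × ℝ → ℝ × ℝ} {σ r a b κ : ℝ} {V : Set (ℝ × ℝ)}
    {f g : ℝ × ℝ × ℝ → ℝ} {Φ : ℝ → ℝ → ℝ × ℝ} (hab : a < b) (hκ : 0 < κ)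
    (hf : ∀ s ∈ Icc a b, ContDiffAt ℝ 1 f (s, r, 0))
    (hg : ∀ s ∈ Icc a b, ∀ ρ e, |ρ - r| ≤ κ → |e| ≤ κ →
      ContinuousAt g (s, ρ, e) ∧ 0 < g (s, ρ, e))
    (hΦ : ∀ s ∈ Icc a b, ∀ (u : ℝ → ℝ) (e : ℝ), |u s - r| ≤ κ → |e| ≤ κ →
      HasDerivAt u (e * f (s, u s, e)) s →
      HasDerivAt (fun x => Φ x (u x)) (g (s, u s, e) • X e (Φ s (u s))) s)
    (hΦa : ∀ ρ, |ρ - r| ≤ κ → Φ a ρ = (0, σ * ρ))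
    (hΦb : ∀ ρ, |ρ - r| ≤ κ → Φ b ρ = (0, -(σ * ρ)))
    (hside : ∀ s ∈ Ioo a b, ∀ ρ, |ρ - r| ≤ κ → σ * (Φ s ρ).1 < 0)
    (hV : ∀ s ∈ Icc a b, ∀ ρ, |ρ - r| ≤ κ → Φ s ρ ∈ V) :
    IsHalfMap X σ r (∫ s in a..b, f (s, r, 0))
      (∫ s in a..b, fderiv ℝ f (s, r, 0) (0, 1, 0)) V := by
  intro η hη
  filter_upwards [exists_scalar_timeMap hab hf hη, Ioo_mem_nhdsGT (half_pos hκ)] with δ hδ hδκ η₂ hη₂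
  filter_upwards [hδ (min η₂ (κ / 2)) (lt_min hη₂ (half_pos hκ)), Ioo_mem_nhdsGT hκ]
    with e ⟨u, hu, hm, hquot⟩ heκ
  have heκ' : |e| ≤ κ := by rw [abs_of_pos heκ.1]; exact heκ.2.le
  refine ⟨fun ρ => u ρ b, hm.trans (mul_le_mul_of_nonneg_right (min_le_left _ _) heκ.1.le), hquot,
    fun ρ hρ => ⟨((hu ρ hρ).2 b ⟨hab.le, le_rfl⟩).2.trans (min_le_left _ _), ?_⟩⟩
  obtain ⟨hua, hus⟩ := hu ρ hρ
  have hmem : ∀ s ∈ Icc a b, |u ρ s - r| ≤ κ := by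
    intro s hs
    have h1 := abs_sub_le (u ρ s) ρ r
    have h2 := (hus s hs).2.trans (min_le_right _ _)
    linarith [hδκ.2]
  obtain ⟨T, ζ, hT, h0, h1, hder, hin, hin'⟩ := exists_integralCurve_of_reparam
    (X := X e) (Z := fun s => Φ s (u ρ s)) (g := fun s => g (s, u ρ s, e)) hab
    (fun s hs => (ContinuousAt.comp (f := fun s : ℝ => ((s, u ρ s, e) : ℝ × ℝ × ℝ))
      (hg s hs _ e (hmem s hs) heκ').1 (continuousAt_id.prodMk
        ((hus s hs).1.continuousAt.prodMk continuousAt_const))).continuousWithinAt)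
    (fun s hs => (hg s hs _ e (hmem s hs) heκ').2)
    (fun s hs => hΦ s hs (u ρ) e (hmem s hs) heκ' (hus s hs).1)
  refine ⟨T, ζ, ⟨hT, ?_, ?_, hder, ?_⟩, ?_⟩
  · rw [h0, hΦa _ (hmem a ⟨le_rfl, hab.le⟩), hua]
  · rw [h1, hΦb _ (hmem b ⟨hab.le, le_rfl⟩)]
  · intro t ht
    obtain ⟨s, hs, hts⟩ := hin' t ht
    rw [hts]
    exact hside s hs _ (hmem s (Ioo_subset_Icc_self hs))
  · intro t ht
    obtain ⟨s, hs, hts⟩ := hin t ht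
    rw [hts]
    exact hV s hs _ (hmem s hs)

/-! ### The explicit scalar equations on the two sides -/

/-- The right-hand side `α G ρ / (ρ - e β G)` of the scalar equation, with `G` the value of the
perturbation at the point `Φ s ρ`. -/
noncomputable def scalarField (p : ℝ × ℝ → ℝ) (α β : ℝ → ℝ) (Φ : ℝ → ℝ → ℝ × ℝ)
    (z : ℝ × ℝ × ℝ) : ℝ :=
  α z.1 * p (Φ z.1 z.2.1) * (z.2.1 / (z.2.1 - z.2.2 * (β z.1 * p (Φ z.1 z.2.1))))

theorem contDiffAt_scalarField {p : ℝ × ℝ → ℝ} (hp : ContDiff ℝ 1 p) {α β : ℝ → ℝ}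
    (hα : ContDiff ℝ 1 α) (hβ : ContDiff ℝ 1 β) {Φ : ℝ → ℝ → ℝ × ℝ} {s r : ℝ} (hr : r ≠ 0)
    (hΦ : ContDiffAt ℝ 1 (fun z : ℝ × ℝ => Φ z.1 z.2) (s, r)) :
    ContDiffAt ℝ 1 (scalarField p α β Φ) (s, r, 0) := by
  have h1 : ContDiffAt ℝ 1 (fun z : ℝ × ℝ × ℝ => Φ z.1 z.2.1) (s, r, 0) :=
    ContDiffAt.comp (f := fun z : ℝ × ℝ × ℝ => (z.1, z.2.1)) (s, r, 0) hΦ (by fun_prop)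
  have h2 : ContDiffAt ℝ 1 (fun z : ℝ × ℝ × ℝ => p (Φ z.1 z.2.1)) (s, r, 0) :=
    hp.contDiffAt.comp (s, r, 0) h1
  have h3 : ContDiffAt ℝ 1 (fun z : ℝ × ℝ × ℝ => α z.1) (s, r, 0) :=
    hα.contDiffAt.comp (s, r, 0) contDiffAt_fst
  have h4 : ContDiffAt ℝ 1 (fun z : ℝ × ℝ × ℝ => β z.1) (s, r, 0) :=
    hβ.contDiffAt.comp (s, r, 0) contDiffAt_fst
  have h5 : ContDiffAt ℝ 1 (fun z : ℝ × ℝ × ℝ => z.2.1) (s, r, 0) := by fun_prop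
  have h6 : ContDiffAt ℝ 1 (fun z : ℝ × ℝ × ℝ => z.2.2) (s, r, 0) := by fun_prop
  exact (h3.mul h2).mul (h5.div (h5.sub (h6.mul (h4.mul h2))) (by simpa using hr))

theorem integral_scalarField {p : ℝ × ℝ → ℝ} {α β : ℝ → ℝ} {Φ : ℝ → ℝ → ℝ × ℝ} {a b r : ℝ}
    (hr : r ≠ 0) :
    ∫ s in a..b, scalarField p α β Φ (s, r, 0) = ∫ s in a..b, α s * p (Φ s r) := by
  congr 1
  ext s
  simp [scalarField, hr]

/-- For `e = 0` and `ρ ≠ 0` the scalar field is just `α s * p (Φ s ρ)`, so the partial derivative in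
`ρ` need never be computed. -/
theorem integral_fderiv_scalarField {p : ℝ × ℝ → ℝ} {α β : ℝ → ℝ} {Φ : ℝ → ℝ → ℝ × ℝ} {a b r m' : ℝ}
    (hr : r ≠ 0) (hab : a ≤ b)
    (hf : ∀ s ∈ Icc a b, ContDiffAt ℝ 1 (scalarField p α β Φ) (s, r, 0))
    (hm : HasDerivAt (fun ρ => ∫ s in a..b, α s * p (Φ s ρ)) m' r) :
    ∫ s in a..b, fderiv ℝ (scalarField p α β Φ) (s, r, 0) (0, 1, 0) = m' := by
  refine (hasDerivAt_integral_of_contDiffAt hab hf).unique (hm.congr_of_eventuallyEq ?_)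
  filter_upwards [isOpen_ne.mem_nhds hr] with ρ hρ
  exact integral_scalarField hρ

/-- Points of the level `ρ` on the left, in polar coordinates. -/
noncomputable def leftChart (s ρ : ℝ) : ℝ × ℝ := (ρ * Real.cos s, ρ * Real.sin s)

/-- Points of the level `ρ` on the right. -/
noncomputable def rightChart (s ρ : ℝ) : ℝ × ℝ := (1 - √(1 - ρ ^ 2 + ρ ^ 2 * s ^ 2), ρ * s)

theorem exists_denominator_pos {p : ℝ × ℝ → ℝ} (hp : Continuous p) {β : ℝ → ℝ} (hβ : Continuous β)
    {Φ : ℝ → ℝ → ℝ × ℝ} (hΦ : Continuous fun z : ℝ × ℝ => Φ z.1 z.2) {a b r : ℝ} (hr : 0 < r) :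
    ∃ κ > 0, ∀ s ∈ Icc a b, ∀ ρ e, |ρ - r| ≤ κ → |e| ≤ κ →
      0 < ρ ∧ 0 < ρ - e * (β s * p (Φ s ρ)) := by
  refine exists_uniform_of_forall_eventually
    (Q := fun s ρ e => 0 < ρ ∧ 0 < ρ - e * (β s * p (Φ s ρ))) fun s _ => ?_
  have h0 : Continuous fun z : ℝ × ℝ × ℝ => Φ z.1 z.2.1 :=
    hΦ.comp (f := fun z : ℝ × ℝ × ℝ => (z.1, z.2.1)) (by fun_prop)
  have h1 : Continuous fun z : ℝ × ℝ × ℝ => z.2.1 - z.2.2 * (β z.1 * p (Φ z.1 z.2.1)) := by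
    fun_prop
  have h2 : Continuous fun z : ℝ × ℝ × ℝ => z.2.1 := by fun_prop
  exact ((h2.tendsto (s, r, 0)).eventually_const_lt hr).and
    (h1.continuousAt.eventually_const_lt (by simpa using hr))

theorem continuous_leftChart : Continuous fun z : ℝ × ℝ => leftChart z.1 z.2 := by
  unfold leftChart; fun_prop

theorem continuous_rightChart : Continuous fun z : ℝ × ℝ => rightChart z.1 z.2 := by
  unfold rightChart; fun_prop

/-- In polar coordinates `ρ' = e cos s · p` and `s' = 1 - e sin s · p / ρ`. Dividing gives the
scalar field with `α = cos` and `β = sin`; the time change is `dt/ds = ρ / (ρ - e sin s · p)`. -/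
theorem isHalfMap_left {p : ℝ × ℝ → ℝ} (hp : ContDiff ℝ 1 p) {r m' : ℝ} (hr : 0 < r)
    {J : Set ℝ} (hJ : J ∈ 𝓝 r) {V : Set (ℝ × ℝ)}
    (hV : ∀ ρ ∈ J, ∀ s ∈ Icc (Real.pi / 2) (3 * Real.pi / 2), leftChart s ρ ∈ V)
    (hm : HasDerivAt (fun ρ => ∫ s in (Real.pi / 2)..(3 * Real.pi / 2),
      Real.cos s * p (leftChart s ρ)) m' r) :
    IsHalfMap (fun e z => (-z.2 + e * p z, z.1)) 1 r
      (∫ s in (Real.pi / 2)..(3 * Real.pi / 2), Real.cos s * p (leftChart s r)) m' V := by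
  have hab : Real.pi / 2 < 3 * Real.pi / 2 := by linarith [Real.pi_pos]
  have hcd : ContDiff ℝ 1 fun z : ℝ × ℝ => leftChart z.1 z.2 := by unfold leftChart; fun_prop
  have hf : ∀ s ∈ Icc (Real.pi / 2) (3 * Real.pi / 2),
      ContDiffAt ℝ 1 (scalarField p Real.cos Real.sin leftChart) (s, r, 0) := fun s _ =>
    contDiffAt_scalarField hp Real.contDiff_cos Real.contDiff_sin hr.ne' hcd.contDiffAt
  obtain ⟨κ₁, hκ₁, hden⟩ := exists_denominator_pos (a := Real.pi / 2) (b := 3 * Real.pi / 2)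
    hp.continuous Real.continuous_sin continuous_leftChart hr
  obtain ⟨κ₂, hκ₂, hball⟩ := Metric.mem_nhds_iff.1 hJ
  set κ := min κ₁ (κ₂ / 2) with hκ
  have hκ0 : 0 < κ := lt_min hκ₁ (half_pos hκ₂)
  rw [← integral_scalarField (β := Real.sin) hr.ne',
    ← integral_fderiv_scalarField hr.ne' hab.le hf hm]
  refine isHalfMap_of_coordinates (κ := κ) (Φ := leftChart)
    (g := fun z => z.2.1 / (z.2.1 - z.2.2 * (Real.sin z.1 * p (leftChart z.1 z.2.1)))) hab hκ0 hf
    ?_ ?_ ?_ ?_ ?_ ?_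
  · intro s hs ρ e hρ he
    obtain ⟨h1, h2⟩ := hden s hs ρ e (hρ.trans (min_le_left _ _)) (he.trans (min_le_left _ _))
    refine ⟨?_, div_pos h1 h2⟩
    have h0 : Continuous fun z : ℝ × ℝ × ℝ => p (leftChart z.1 z.2.1) :=
      hp.continuous.comp (continuous_leftChart.comp
        (f := fun z : ℝ × ℝ × ℝ => (z.1, z.2.1)) (by fun_prop))
    refine ContinuousAt.div ?_ (Continuous.continuousAt ?_) h2.ne'
    · fun_prop
    · fun_prop
  · intro s hs u e hu he hder
    obtain ⟨h1, h2⟩ := hden s hs (u s) e (hu.trans (min_le_left _ _)) (he.trans (min_le_left _ _))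
    have hx := hder.mul (Real.hasDerivAt_cos s)
    have hy := hder.mul (Real.hasDerivAt_sin s)
    refine (hx.prodMk hy).congr_deriv ?_
    simp only [scalarField, leftChart, Prod.smul_mk, smul_eq_mul, Prod.mk.injEq] at h2 ⊢
    set G := p (u s * Real.cos s, u s * Real.sin s)
    have h3 := Real.sin_sq_add_cos_sq s
    have hq : u s / (u s - e * (Real.sin s * G)) * (u s - e * (Real.sin s * G)) = u s :=
      div_mul_cancel₀ _ h2.ne'
    set q := u s / (u s - e * (Real.sin s * G))
    constructor
    · linear_combination Real.sin s * hq + e * G * q * h3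
    · linear_combination -Real.cos s * hq
  · intro ρ _
    simp [leftChart]
  · intro ρ _
    have h1 : 3 * Real.pi / 2 = Real.pi / 2 + Real.pi := by ring
    simp [leftChart, h1, Real.cos_add_pi, Real.sin_add_pi]
  · intro s hs ρ hρ
    obtain ⟨h1, -⟩ := hden s (Ioo_subset_Icc_self hs) ρ 0 (hρ.trans (min_le_left _ _))
      (by simpa using hκ₁.le)
    have := Real.cos_neg_of_pi_div_two_lt_of_lt hs.1 (by linarith [hs.2])
    simp only [leftChart, one_mul]
    exact mul_neg_of_pos_of_neg h1 this
  · intro s hs ρ hρ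
    refine hV ρ (hball ?_) s hs
    rw [Metric.mem_ball, Real.dist_eq]
    have : κ ≤ κ₂ / 2 := min_le_right _ _
    linarith

/-- With `ρ² = 1 - (1 - x)² + y²` and `s = y / ρ` one finds `ρ ρ' = e (1 - x) p` and `s' = ((1 -
x)/ρ)(1 - e s p / ρ)`. The factor `1 - x` cancels in `dρ/ds`, leaving `α = 1` and `β = s`, and
survives only in `dt/ds`. The bound `r < 1` keeps the orbit away from the saddle, where this factor
vanishes. -/
theorem isHalfMap_right {p : ℝ × ℝ → ℝ} (hp : ContDiff ℝ 1 p) {r m' : ℝ} (hr : 0 < r)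
    (hr1 : r < 1) {J : Set ℝ} (hJ : J ∈ 𝓝 r) {V : Set (ℝ × ℝ)}
    (hV : ∀ ρ ∈ J, ∀ s ∈ Icc (-1 : ℝ) 1, rightChart s ρ ∈ V)
    (hm : HasDerivAt (fun ρ => ∫ s in (-1 : ℝ)..1, 1 * p (rightChart s ρ)) m' r) :
    IsHalfMap (fun e z => (-z.2 + e * p z, 1 - z.1)) (-1) r
      (∫ s in (-1 : ℝ)..1, 1 * p (rightChart s r)) m' V := by
  have hab : (-1 : ℝ) < 1 := by norm_num
  have hrad : ∀ ρ : ℝ, 0 < ρ → ρ < 1 → ∀ s : ℝ, 0 < 1 - ρ ^ 2 + ρ ^ 2 * s ^ 2 := by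
    intro ρ h0 h1 s
    have : ρ ^ 2 < 1 := by nlinarith
    have := mul_nonneg (sq_nonneg ρ) (sq_nonneg s)
    linarith
  have hcd : ∀ s, ContDiffAt ℝ 1 (fun z : ℝ × ℝ => rightChart z.1 z.2) (s, r) := by
    intro s
    have h1 : ContDiffAt ℝ 1 (fun z : ℝ × ℝ => 1 - z.2 ^ 2 + z.2 ^ 2 * z.1 ^ 2) (s, r) := by
      fun_prop
    have h2 : ContDiffAt ℝ 1 (fun z : ℝ × ℝ => z.2 * z.1) (s, r) := by fun_prop
    exact (contDiffAt_const.sub (h1.sqrt (hrad r hr hr1 s).ne')).prodMk h2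
  have hf : ∀ s ∈ Icc (-1 : ℝ) 1,
      ContDiffAt ℝ 1 (scalarField p (fun _ => 1) id rightChart) (s, r, 0) := fun s _ =>
    contDiffAt_scalarField hp contDiff_const contDiff_id hr.ne' (hcd s)
  obtain ⟨κ₁, hκ₁, hden⟩ := exists_denominator_pos (a := -1) (b := 1)
    hp.continuous continuous_id continuous_rightChart hr
  obtain ⟨κ₂, hκ₂, hball⟩ := Metric.mem_nhds_iff.1 hJ
  set κ := min κ₁ (min (κ₂ / 2) ((1 - r) / 2)) with hκ
  have hκ0 : 0 < κ := lt_min hκ₁ (lt_min (half_pos hκ₂) (by linarith))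
  have hlt : ∀ ρ, |ρ - r| ≤ κ → ρ < 1 := by
    intro ρ hρ
    have : κ ≤ (1 - r) / 2 := (min_le_right _ _).trans (min_le_right _ _)
    have := (abs_le.1 hρ).2
    linarith
  rw [← integral_scalarField (β := id) (α := fun _ => 1) hr.ne',
    ← integral_fderiv_scalarField (α := fun _ => 1) hr.ne' hab.le hf hm]
  refine isHalfMap_of_coordinates (κ := κ) (Φ := rightChart)
    (g := fun z => z.2.1 / (z.2.1 - z.2.2 * (z.1 * p (rightChart z.1 z.2.1))) *
      (z.2.1 / √(1 - z.2.1 ^ 2 + z.2.1 ^ 2 * z.1 ^ 2))) hab hκ0 hf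
    ?_ ?_ ?_ ?_ ?_ ?_
  · intro s hs ρ e hρ he
    obtain ⟨h1, h2⟩ := hden s hs ρ e (hρ.trans (min_le_left _ _)) (he.trans (min_le_left _ _))
    have h3 := Real.sqrt_pos.2 (hrad ρ h1 (hlt ρ hρ) s)
    refine ⟨?_, mul_pos (div_pos h1 h2) (div_pos h1 h3)⟩
    have h0 : Continuous fun z : ℝ × ℝ × ℝ => p (rightChart z.1 z.2.1) :=
      hp.continuous.comp (continuous_rightChart.comp
        (f := fun z : ℝ × ℝ × ℝ => (z.1, z.2.1)) (by fun_prop))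
    refine ContinuousAt.mul (ContinuousAt.div ?_ (Continuous.continuousAt
      (f := fun z : ℝ × ℝ × ℝ => z.2.1 - z.2.2 * (z.1 * p (rightChart z.1 z.2.1))) ?_) h2.ne')
      (ContinuousAt.div ?_ (Continuous.continuousAt ?_) h3.ne')
    · fun_prop
    · exact continuous_snd.fst.sub (continuous_snd.snd.mul (continuous_fst.mul h0))
    · fun_prop
    · fun_prop
  · intro s hs u e hu he hder
    obtain ⟨h1, h2⟩ := hden s hs (u s) e (hu.trans (min_le_left _ _)) (he.trans (min_le_left _ _))
    have h3 := hrad (u s) h1 (hlt _ hu) s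
    have hw := Real.sqrt_pos.2 h3
    have hq : HasDerivAt (fun x => 1 - u x ^ 2 + u x ^ 2 * x ^ 2)
        (-(2 * u s * (e * scalarField p (fun _ => 1) id rightChart (s, u s, e)))
          + (2 * u s * (e * scalarField p (fun _ => 1) id rightChart (s, u s, e)) * s ^ 2
            + u s ^ 2 * (2 * s))) s := by
      have hsq := hder.pow 2
      have hs2 := (hasDerivAt_id s).pow 2
      refine ((hsq.const_sub 1).add (hsq.mul hs2)).congr_deriv ?_
      simp
    have hx := (hq.sqrt h3.ne').const_sub 1
    have hy := hder.mul (hasDerivAt_id s)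
    refine (hx.prodMk hy).congr_deriv ?_
    simp only [scalarField, Prod.smul_mk, smul_eq_mul, Prod.mk.injEq, id] at h2 ⊢
    have hG1 : (rightChart s (u s)).1 = 1 - √(1 - u s ^ 2 + u s ^ 2 * s ^ 2) := rfl
    have hG2 : (rightChart s (u s)).2 = u s * s := rfl
    rw [hG1, hG2]
    set G := p (rightChart s (u s))
    set w := √(1 - u s ^ 2 + u s ^ 2 * s ^ 2)
    have hq : u s / (u s - e * (s * G)) * (u s - e * (s * G)) = u s :=
      div_mul_cancel₀ _ h2.ne'
    have hw' : u s / w * (1 - (1 - w)) = u s := by rw [sub_sub_cancel, div_mul_cancel₀ _ hw.ne']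
    set q := u s / (u s - e * (s * G))
    constructor
    · linear_combination (u s * s / w) * hq
    · linear_combination -hq - q * hw'
  · intro ρ hρ
    simp [rightChart]
  · intro ρ hρ
    simp [rightChart]
  · intro s hs ρ hρ
    obtain ⟨h1, -⟩ := hden s (Ioo_subset_Icc_self hs) ρ 0 (hρ.trans (min_le_left _ _))
      (by simpa using hκ₁.le)
    have h2 : 1 - ρ ^ 2 + ρ ^ 2 * s ^ 2 < 1 := by
      have h3 : s ^ 2 < 1 := by nlinarith [hs.1, hs.2]
      have h4 : 0 < ρ ^ 2 := by positivity
      nlinarith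
    have h3 : √(1 - ρ ^ 2 + ρ ^ 2 * s ^ 2) < 1 := by
      rw [Real.sqrt_lt' one_pos]; simpa using h2
    simp only [rightChart]
    linarith
  · intro s hs ρ hρ
    refine hV ρ (hball ?_) s hs
    rw [Metric.mem_ball, Real.dist_eq]
    have : κ ≤ κ₂ / 2 := (min_le_right _ _).trans (min_le_left _ _)
    linarith

end PiecewiseHam


namespace PiecewiseHam

open Set Filter Topology MeasureTheory

/-! ### Filippov solutions away from and across the switching line -/

theorem _root_.AbsolutelyContinuousOnInterval.of_dist_le {E F : Type*} [PseudoMetricSpace E]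
    [PseudoMetricSpace F] {f : ℝ → E} {g : ℝ → F} {a b : ℝ}
    (hf : AbsolutelyContinuousOnInterval f a b) (h : ∀ s t, dist (g s) (g t) ≤ dist (f s) (f t)) :
    AbsolutelyContinuousOnInterval g a b := by
  rw [absolutelyContinuousOnInterval_iff] at hf ⊢
  intro ε hε
  obtain ⟨δ, hδ, H⟩ := hf ε hε
  exact ⟨δ, hδ, fun E hE hlen => (Finset.sum_le_sum fun i _ => h _ _).trans_lt (H E hE hlen)⟩

variable {R L : ℝ × ℝ → ℝ × ℝ} {γ : ℝ → ℝ × ℝ}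

theorem IsSolution.fst (h : IsSolution R L γ) (s t : ℝ) :
    AbsolutelyContinuousOnInterval (fun u => (γ u).1) s t :=
  (h.1 s t).of_dist_le fun _ _ => by rw [Prod.dist_eq]; exact le_max_left _ _

theorem IsSolution.snd (h : IsSolution R L γ) (s t : ℝ) :
    AbsolutelyContinuousOnInterval (fun u => (γ u).2) s t :=
  (h.1 s t).of_dist_le fun _ _ => by rw [Prod.dist_eq]; exact le_max_right _ _

theorem IsSolution.continuous (h : IsSolution R L γ) : Continuous γ := by
  rw [continuous_iff_continuousAt]
  intro t
  have := (h.1 (t - 1) (t + 1)).continuousOn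
  rw [uIcc_of_le (by linarith)] at this
  exact this.continuousAt (Icc_mem_nhds (by linarith) (by linarith))

theorem _root_.HasDerivAt.prod_fst {γ : ℝ → ℝ × ℝ} {v : ℝ × ℝ} {t : ℝ} (h : HasDerivAt γ v t) :
    HasDerivAt (fun u => (γ u).1) v.1 t :=
  (hasFDerivAt_fst (𝕜 := ℝ) (p := γ t)).comp_hasDerivAt t h

theorem _root_.HasDerivAt.prod_snd {γ : ℝ → ℝ × ℝ} {v : ℝ × ℝ} {t : ℝ} (h : HasDerivAt γ v t) :
    HasDerivAt (fun u => (γ u).2) v.2 t :=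
  (hasFDerivAt_snd (𝕜 := ℝ) (p := γ t)).comp_hasDerivAt t h

/-- As long as only one of the two fields is involved, a Filippov solution is a classical one. -/
theorem IsSolution.hasDerivWithinAt (h : IsSolution R L γ) {X : ℝ × ℝ → ℝ × ℝ} (hX : Continuous X)
    {a b : ℝ} (hmem : ∀ t ∈ Ioo a b, filippov R L (γ t) ⊆ {X (γ t)}) :
    ∀ t ∈ Icc a b, HasDerivWithinAt γ (X (γ t)) (Icc a b) t := by
  have hXγ : Continuous fun t => X (γ t) := hX.comp h.continuous
  have hae : ∀ t ∈ Icc a b, ∀ᵐ u : ℝ, u ∈ uIoc a t → HasDerivAt γ (X (γ u)) u := by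
    intro t ht
    have hb : ∀ᵐ u : ℝ, u ≠ b := by simp [ae_iff]
    filter_upwards [h.2, hb] with u ⟨v, hv, hder⟩ hub hu
    rw [uIoc_of_le ht.1] at hu
    have := hmem u ⟨hu.1, lt_of_le_of_ne (hu.2.trans ht.2) hub⟩ hv
    rw [mem_singleton_iff] at this
    rwa [← this]
  -- Absolute continuity recovers `γ` from its almost everywhere derivative. That derivative agrees
  -- with a continuous function, so the integral is differentiable everywhere.
  have e1 : ∀ t ∈ Icc a b, (γ t).1 = (γ a).1 + ∫ u in a..t, (X (γ u)).1 := by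
    intro t ht
    have h1 := (h.fst a t).integral_deriv_eq_sub
    have h2 : ∫ u in a..t, deriv (fun u => (γ u).1) u = ∫ u in a..t, (X (γ u)).1 := by
      refine intervalIntegral.integral_congr_ae ?_
      filter_upwards [hae t ht] with u hu hut
      exact (hu hut).prod_fst.deriv
    linarith
  have e2 : ∀ t ∈ Icc a b, (γ t).2 = (γ a).2 + ∫ u in a..t, (X (γ u)).2 := by
    intro t ht
    have h1 := (h.snd a t).integral_deriv_eq_sub
    have h2 : ∫ u in a..t, deriv (fun u => (γ u).2) u = ∫ u in a..t, (X (γ u)).2 := by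
      refine intervalIntegral.integral_congr_ae ?_
      filter_upwards [hae t ht] with u hu hut
      exact (hu hut).prod_snd.deriv
    linarith
  intro t ht
  have d1 := (hXγ.fst.integral_hasStrictDerivAt a t).hasDerivAt.const_add (γ a).1
  have d2 := (hXγ.snd.integral_hasStrictDerivAt a t).hasDerivAt.const_add (γ a).2
  refine (d1.prodMk d2).hasDerivWithinAt.congr_of_mem (fun u hu => ?_) ht
  rw [← e1 u hu, ← e2 u hu]

/-- If both fields point to the side `σ x < 0`, then a solution moves there immediately. -/
theorem IsSolution.exists_crossing (h : IsSolution R L γ) (hR : Continuous R) (hL : Continuous L)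
    {σ t₀ : ℝ} (h0 : (γ t₀).1 = 0) (hRσ : σ * (R (γ t₀)).1 < 0) (hLσ : σ * (L (γ t₀)).1 < 0) :
    ∃ κ > 0, ∀ t ∈ Ioo t₀ (t₀ + κ), σ * (γ t).1 < 0 := by
  -- Near `t₀` both fields have `σ`-component below `c < 0`, hence so does every convex combination,
  -- and integration gives `σ x ≤ c (t - t₀)`, whether or not the solution slides.
  obtain ⟨c, hc1, hc0⟩ := exists_between (max_lt hRσ hLσ)
  have cR : Continuous fun t => σ * (R (γ t)).1 := continuous_const.mul (hR.comp h.continuous).fst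
  have cL : Continuous fun t => σ * (L (γ t)).1 := continuous_const.mul (hL.comp h.continuous).fst
  have hev := ((cR.tendsto t₀).eventually_lt_const ((le_max_left _ _).trans_lt hc1)).and
    ((cL.tendsto t₀).eventually_lt_const ((le_max_right _ _).trans_lt hc1))
  obtain ⟨κ, hκ, hball⟩ := Metric.eventually_nhds_iff.1 hev
  refine ⟨κ, hκ, fun t ht => ?_⟩
  have hac : AbsolutelyContinuousOnInterval (fun u => σ * (γ u).1) t₀ t := (h.fst t₀ t).const_mul σ
  have h1 := hac.integral_deriv_eq_sub
  have h2 : ∫ u in t₀..t, deriv (fun u => σ * (γ u).1) u ≤ ∫ _ in t₀..t, c := by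
    refine intervalIntegral.integral_mono_ae_restrict ht.1.le hac.intervalIntegrable_deriv
      intervalIntegrable_const ?_
    refine (ae_restrict_iff' measurableSet_Icc).2 ?_
    filter_upwards [h.2] with u ⟨v, hv, hder⟩ hu
    rw [(hder.prod_fst.const_mul σ).deriv]
    have hdist : dist u t₀ < κ := by
      rw [Real.dist_eq, abs_of_nonneg (sub_nonneg.2 hu.1)]
      linarith [hu.2, ht.2]
    obtain ⟨hr, hl⟩ := hball hdist
    rcases hv with ⟨-, rfl⟩ | ⟨-, rfl⟩ | ⟨-, hseg⟩
    · exact hr.le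
    · exact hl.le
    · obtain ⟨p, q, hp, hq, hpq, rfl⟩ := hseg
      simp only [Prod.fst_add, Prod.smul_fst, smul_eq_mul]
      nlinarith
  rw [intervalIntegral.integral_const, smul_eq_mul] at h2
  rw [h0, mul_zero, sub_zero] at h1
  nlinarith [ht.1]

/-- Two integral curves of a `C¹` field that agree at time `0` agree. -/
theorem eqOn_of_hasDerivWithinAt {X : ℝ × ℝ → ℝ × ℝ} (hX : ContDiff ℝ 1 X) {T : ℝ}
    {f g : ℝ → ℝ × ℝ} (hf : ∀ t ∈ Icc 0 T, HasDerivWithinAt f (X (f t)) (Icc 0 T) t)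
    (hg : ∀ t ∈ Icc 0 T, HasDerivWithinAt g (X (g t)) (Icc 0 T) t) (h0 : f 0 = g 0) :
    EqOn f g (Icc 0 T) := by
  have hfc : ContinuousOn f (Icc 0 T) := fun t ht => (hf t ht).continuousWithinAt
  have hgc : ContinuousOn g (Icc 0 T) := fun t ht => (hg t ht).continuousWithinAt
  obtain ⟨M₁, hM₁⟩ := isCompact_Icc.exists_bound_of_continuousOn hfc
  obtain ⟨M₂, hM₂⟩ := isCompact_Icc.exists_bound_of_continuousOn hgc
  obtain ⟨K, hK⟩ := (hX.contDiffOn (s := Metric.closedBall 0 (max M₁ M₂))).exists_lipschitzOnWith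
    one_ne_zero (convex_closedBall _ _) (isCompact_closedBall _ _)
  refine ODE_solution_unique_of_mem_Icc_right (v := fun _ => X) (K := K)
    (s := fun _ => Metric.closedBall 0 (max M₁ M₂)) (fun _ _ => hK) hfc
    (fun t ht => ?_) (fun t ht => ?_) hgc (fun t ht => ?_) (fun t ht => ?_) h0
  · exact (hf t (Ico_subset_Icc_self ht)).mono_of_mem_nhdsWithin (Icc_mem_nhdsGE_of_mem ht)
  · rw [mem_closedBall_zero_iff]
    exact (hM₁ t (Ico_subset_Icc_self ht)).trans (le_max_left _ _)
  · exact (hg t (Ico_subset_Icc_self ht)).mono_of_mem_nhdsWithin (Icc_mem_nhdsGE_of_mem ht)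
  · rw [mem_closedBall_zero_iff]
    exact (hM₂ t (Ico_subset_Icc_self ht)).trans (le_max_right _ _)

theorem IsSolution.comp_add (h : IsSolution R L γ) {X : ℝ × ℝ → ℝ × ℝ} (hX : Continuous X)
    {t₀ T : ℝ}
    (hmem : ∀ t ∈ Ioo 0 T, filippov R L (γ (t₀ + t)) ⊆ {X (γ (t₀ + t))}) :
    ∀ t ∈ Icc 0 T, HasDerivWithinAt (fun u => γ (t₀ + u)) (X (γ (t₀ + t))) (Icc 0 T) t := by
  have h1 := h.hasDerivWithinAt hX (a := t₀) (b := t₀ + T) fun t ht => by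
    have := hmem (t - t₀) ⟨by linarith [ht.1], by linarith [ht.2]⟩
    rwa [add_sub_cancel] at this
  intro t ht
  have h2 := h1 (t₀ + t) ⟨by linarith [ht.1], by linarith [ht.2]⟩
  have h3 : HasDerivWithinAt (fun u : ℝ => t₀ + u) 1 (Icc 0 T) t :=
    ((hasDerivAt_id' t).const_add t₀).hasDerivWithinAt
  have h4 := h2.scomp t h3 fun u hu => ⟨by linarith [hu.1], by linarith [hu.2]⟩
  rwa [one_smul] at h4

/-- A Filippov solution that starts on the switching line follows the arc starting there. -/
theorem IsSolution.follow (h : IsSolution R L γ) (hR : Continuous R) (hL : Continuous L)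
    {X : ℝ × ℝ → ℝ × ℝ} (hX : ContDiff ℝ 1 X) {σ : ℝ}
    (hXσ : ∀ z : ℝ × ℝ, σ * z.1 < 0 → filippov R L z ⊆ {X z}) {z₀ z₁ : ℝ × ℝ} {T : ℝ}
    {ζ : ℝ → ℝ × ℝ} (hζ : IsArc X σ z₀ z₁ T ζ) {t₀ : ℝ} (ht₀ : γ t₀ = z₀) (h0 : z₀.1 = 0)
    (hRσ : σ * (R z₀).1 < 0) (hLσ : σ * (L z₀).1 < 0) :
    ∀ t ∈ Icc 0 T, γ (t₀ + t) = ζ t := by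
  have heq : ∀ T', 0 ≤ T' → T' ≤ T → (∀ t ∈ Ioo 0 T', σ * (γ (t₀ + t)).1 < 0) →
      ∀ t ∈ Icc 0 T', γ (t₀ + t) = ζ t := by
    intro T' hT' hT'T hside
    refine eqOn_of_hasDerivWithinAt (f := fun t => γ (t₀ + t)) hX
      (h.comp_add hX.continuous fun t ht => hXσ _ (hside t ht)) (fun t ht => ?_) ?_
    · exact (hζ.hasDerivAt t ⟨ht.1, ht.2.trans hT'T⟩).hasDerivWithinAt
    · simp only [add_zero]
      rw [ht₀, hζ.source]
  refine heq T hζ.pos.le le_rfl ?_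
  by_contra hcon
  push Not at hcon
  obtain ⟨t', ht', hbad⟩ := hcon
  rw [← ht₀] at h0 hRσ hLσ
  obtain ⟨κ, hκ, hcross⟩ := h.exists_crossing hR hL h0 hRσ hLσ
  have hκt : κ ≤ t' := by
    by_contra hlt
    push Not at hlt
    exact absurd (hcross (t₀ + t') ⟨by linarith [ht'.1], by linarith⟩) (not_lt.2 hbad)
  have hc : Continuous fun t => σ * (γ (t₀ + t)).1 :=
    continuous_const.mul (h.continuous.comp (continuous_const.add continuous_id)).fst
  -- The least element `t₁` is the first time after the start at which the solution is not strictly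
  -- on its side. Until then it coincides with the arc, which is still strictly inside at `t₁ < T`.
  -- Starting at `κ / 2` excludes the initial point, which lies on the line.
  have hcomp : IsCompact (Icc (κ / 2) t' ∩ {t | 0 ≤ σ * (γ (t₀ + t)).1}) :=
    isCompact_Icc.inter_right (isClosed_le continuous_const hc)
  obtain ⟨t₁, ⟨⟨h1a, h1b⟩, h1c⟩, hleast⟩ :=
    hcomp.exists_isLeast ⟨t', ⟨by linarith, le_rfl⟩, hbad⟩
  have h2 := heq t₁ (by linarith) (h1b.trans ht'.2.le) (fun t ht => by
    by_contra hge
    push Not at hge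
    rcases lt_or_ge t (κ / 2) with hlt | hge'
    · exact absurd (hcross (t₀ + t) ⟨by linarith [ht.1], by linarith⟩) (not_lt.2 hge)
    · have := hleast ⟨⟨hge', by linarith [ht.2]⟩, hge⟩
      linarith [ht.2]) t₁ ⟨by linarith, le_rfl⟩
  have h3 := hζ.side t₁ ⟨by linarith, by linarith [ht'.2]⟩
  rw [← h2] at h3
  exact absurd h3 (not_lt.2 h1c)

end PiecewiseHam


namespace PiecewiseHam

open Set Filter Topology MeasureTheory

/-! ### Closed orbits made of two arcs -/

variable {R L : ℝ × ℝ → ℝ × ℝ}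

theorem filippov_left {z : ℝ × ℝ} (hz : 1 * z.1 < 0) : filippov R L z ⊆ {L z} := by
  rw [one_mul] at hz
  rintro v (⟨h, -⟩ | ⟨-, h⟩ | ⟨h, -⟩)
  · exact absurd h (not_lt.2 hz.le)
  · exact h
  · exact absurd h hz.ne

theorem filippov_right {z : ℝ × ℝ} (hz : -1 * z.1 < 0) : filippov R L z ⊆ {R z} := by
  have hz' : 0 < z.1 := by linarith
  rintro v (⟨-, h⟩ | ⟨h, -⟩ | ⟨h, -⟩)
  · exact h
  · exact absurd h (not_lt.2 hz'.le)
  · exact absurd h hz'.ne'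

theorem hasDerivWithinAt_Ici_of_eqOn {f g : ℝ → ℝ × ℝ} {v : ℝ × ℝ} {t b : ℝ} (htb : t < b)
    (hg : HasDerivAt g v t) (h : ∀ u ∈ Icc t b, f u = g u) : HasDerivWithinAt f v (Ici t) t := by
  refine hg.hasDerivWithinAt.congr_of_eventuallyEq ?_ (h t ⟨le_rfl, htb.le⟩)
  filter_upwards [Icc_mem_nhdsGE htb] with u hu using h u hu

/-- A left arc and a right arc with common end points make up a periodic Filippov solution. -/
theorem exists_periodic_of_arcs (hR : Continuous R) (hL : Continuous L) {z₀ z₁ : ℝ × ℝ}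
    {T₁ T₂ : ℝ} {ζ₁ ζ₂ : ℝ → ℝ × ℝ} (h₁ : IsArc L 1 z₀ z₁ T₁ ζ₁) (h₂ : IsArc R (-1) z₁ z₀ T₂ ζ₂) :
    ∃ γ : ℝ → ℝ × ℝ, IsSolution R L γ ∧ Function.Periodic γ (T₁ + T₂) ∧
      (∀ t ∈ Icc 0 T₁, γ t = ζ₁ t) ∧ ∀ t ∈ Icc 0 T₂, γ (T₁ + t) = ζ₂ t := by
  have hT₁ := h₁.pos
  have hT₂ := h₂.pos
  set T := T₁ + T₂ with hTdef
  have hT : 0 < T := by positivity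
  have : Fact (0 < T) := ⟨hT⟩
  let γ₀ : ℝ → ℝ × ℝ := fun t => if t ≤ T₁ then ζ₁ t else ζ₂ (t - T₁)
  have hγ₀1 : ∀ t ≤ T₁, γ₀ t = ζ₁ t := fun t ht => if_pos ht
  have hγ₀2 : ∀ t, T₁ ≤ t → γ₀ t = ζ₂ (t - T₁) := by
    intro t ht
    rcases ht.eq_or_lt with rfl | hlt
    · rw [hγ₀1 _ le_rfl, sub_self, h₁.target, h₂.source]
    · exact if_neg (not_le.2 hlt)
  have hζ₂ : ∀ t ∈ Icc T₁ T, HasDerivAt (fun u => ζ₂ (u - T₁)) (R (ζ₂ (t - T₁))) t := by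
    intro t ht
    have := (h₂.hasDerivAt (t - T₁) ⟨by linarith [ht.1], by linarith [ht.2]⟩).comp_sub_const t T₁
    exact this
  have hcont0 : ContinuousOn γ₀ (Icc 0 T) := by
    have hu : Icc 0 T = Icc 0 T₁ ∪ Icc T₁ T := (Icc_union_Icc_eq_Icc hT₁.le (by linarith)).symm
    rw [hu]
    refine ContinuousOn.union_of_isClosed ?_ ?_ isClosed_Icc isClosed_Icc
    · refine ContinuousOn.congr (f := ζ₁) ?_ fun t ht => hγ₀1 t ht.2
      exact fun t ht => (h₁.hasDerivAt t ht).continuousAt.continuousWithinAt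
    · refine ContinuousOn.congr (f := fun u => ζ₂ (u - T₁)) ?_ fun t ht => hγ₀2 t ht.1
      exact fun t ht => (hζ₂ t ht).continuousAt.continuousWithinAt
  have hends : γ₀ 0 = γ₀ T := by
    rw [hγ₀1 0 hT₁.le, hγ₀2 T (by linarith), h₁.source]
    have : T - T₁ = T₂ := by rw [hTdef]; ring
    rw [this, h₂.target]
  let γ : ℝ → ℝ × ℝ := fun t => AddCircle.liftIco T 0 γ₀ (t : AddCircle T)
  have hper : Function.Periodic γ T := fun t => by simp [γ]
  have hγc : Continuous γ :=
    (AddCircle.liftIco_zero_continuous hends hcont0).comp (AddCircle.continuous_mk' T)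
  have hγ : ∀ t ∈ Icc 0 T, γ t = γ₀ t := by
    intro t ht
    rcases ht.2.eq_or_lt with heq | hlt
    · rw [heq, ← hends, ← zero_add T, hper 0]
      exact AddCircle.liftIco_zero_coe_apply ⟨le_rfl, hT⟩
    · exact AddCircle.liftIco_zero_coe_apply ⟨ht.1, hlt⟩
  have hγ1 : ∀ t ∈ Icc 0 T₁, γ t = ζ₁ t := fun t ht => by
    rw [hγ t ⟨ht.1, by linarith [ht.2]⟩, hγ₀1 t ht.2]
  have hγ2 : ∀ t ∈ Icc T₁ T, γ t = ζ₂ (t - T₁) := fun t ht => by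
    rw [hγ t ⟨by linarith [ht.1], ht.2⟩, hγ₀2 t ht.1]
  have hshift : ∀ t : ℝ, ∃ k : ℤ, ∃ t' ∈ Ico 0 T, t = t' + k * T := by
    intro t
    refine ⟨toIcoDiv hT 0 t, toIcoMod hT 0 t, ?_, ?_⟩
    · simpa using toIcoMod_mem_Ico hT 0 t
    · have := toIcoMod_add_toIcoDiv_zsmul hT 0 t
      rw [zsmul_eq_mul] at this
      exact this.symm
  have hperk : ∀ (k : ℤ) (t : ℝ), γ (t - k * T) = γ t := by
    intro k t
    exact hper.sub_int_mul_eq k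
  -- A right derivative exists at every time and is bounded along the compact orbit, which makes `γ`
  -- Lipschitz and so absolutely continuous. The two-sided derivative may fail only at the countably
  -- many gluing times.
  have hbase : ∀ t ∈ Ico 0 T, ∃ v, HasDerivWithinAt γ v (Ici t) t ∧ (v = L (γ t) ∨ v = R (γ t)) ∧
      (t ≠ 0 → t ≠ T₁ → HasDerivAt γ v t ∧ v ∈ filippov R L (γ t)) := by
    intro t ht
    rcases lt_or_ge t T₁ with hlt | hge
    · have htm : t ∈ Icc 0 T₁ := ⟨ht.1, hlt.le⟩
      refine ⟨L (γ t), ?_, Or.inl rfl, fun h0 _ => ⟨?_, Or.inr (Or.inl ⟨?_, rfl⟩)⟩⟩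
      · rw [hγ1 t htm]
        exact hasDerivWithinAt_Ici_of_eqOn hlt (h₁.hasDerivAt t htm)
          fun u hu => hγ1 u ⟨ht.1.trans hu.1, hu.2⟩
      · rw [hγ1 t htm]
        refine (h₁.hasDerivAt t htm).congr_of_eventuallyEq ?_
        filter_upwards [Icc_mem_nhds (lt_of_le_of_ne ht.1 (Ne.symm h0)) hlt] with u hu
          using hγ1 u hu
      · rw [hγ1 t htm]
        simpa using h₁.side t ⟨lt_of_le_of_ne ht.1 (Ne.symm h0), hlt⟩
    · have htm : t ∈ Icc T₁ T := ⟨hge, ht.2.le⟩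
      refine ⟨R (γ t), ?_, Or.inr rfl, fun _ h1 => ⟨?_, Or.inl ⟨?_, rfl⟩⟩⟩
      · rw [hγ2 t htm]
        exact hasDerivWithinAt_Ici_of_eqOn ht.2 (hζ₂ t htm)
          fun u hu => hγ2 u ⟨hge.trans hu.1, hu.2⟩
      · rw [hγ2 t htm]
        refine (hζ₂ t htm).congr_of_eventuallyEq ?_
        filter_upwards [Icc_mem_nhds (lt_of_le_of_ne hge (Ne.symm h1)) ht.2] with u hu
          using hγ2 u hu
      · rw [hγ2 t htm]
        have := h₂.side (t - T₁)
          ⟨by linarith [lt_of_le_of_ne hge (Ne.symm h1)], by linarith [ht.2]⟩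
        linarith
  have hall : ∀ t : ℝ, ∃ v, HasDerivWithinAt γ v (Ici t) t ∧ (v = L (γ t) ∨ v = R (γ t)) ∧
      ((∀ k : ℤ, t ≠ k * T) → (∀ k : ℤ, t ≠ T₁ + k * T) →
        HasDerivAt γ v t ∧ v ∈ filippov R L (γ t)) := by
    intro t
    obtain ⟨k, t', ht', rfl⟩ := hshift t
    obtain ⟨v, hv1, hv2, hv3⟩ := hbase t' ht'
    have hfun : γ = fun u => γ (u - k * T) := funext fun u => (hperk k u).symm
    have hval : γ (t' + k * T) = γ t' := by rw [← hperk k (t' + k * T), add_sub_cancel_right]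
    rw [hval]
    refine ⟨v, ?_, hv2, fun h0 h1 => ?_⟩
    · rw [hfun]
      have h3 : HasDerivWithinAt (fun u : ℝ => u - k * T) 1 (Ici (t' + k * T)) (t' + k * T) :=
        ((hasDerivAt_id' (t' + k * T)).sub_const _).hasDerivWithinAt
      have h4 : HasDerivWithinAt γ v (Ici t') (t' + k * T - k * T) := by
        rwa [add_sub_cancel_right]
      have h5 := h4.scomp (t' + k * T) h3 fun u hu => by
        simp only [mem_Ici] at hu ⊢
        linarith
      rwa [one_smul] at h5
    · obtain ⟨h3, h4⟩ := hv3 (fun h => h0 k (by rw [h, zero_add])) (fun h => h1 k (by rw [h]))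
      refine ⟨?_, h4⟩
      rw [hfun]
      have h5 : HasDerivAt γ v (t' + k * T - k * T) := by rwa [add_sub_cancel_right]
      exact h5.comp_sub_const (t' + k * T) (k * T)
  refine ⟨γ, ⟨?_, ?_⟩, hper, hγ1, fun t ht => ?_⟩
  · have hcpt : IsCompact (range γ) := hper.compact_of_continuous hT.ne' hγc
    obtain ⟨C₁, hC₁⟩ := hcpt.exists_bound_of_continuousOn hL.continuousOn
    obtain ⟨C₂, hC₂⟩ := hcpt.exists_bound_of_continuousOn hR.continuousOn
    set C := max C₁ C₂
    have hC0 : 0 ≤ C := (norm_nonneg _).trans ((hC₁ (γ 0) ⟨0, rfl⟩).trans (le_max_left _ _))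
    choose v hv using hall
    have hvC : ∀ t, ‖v t‖ ≤ C := by
      intro t
      rcases (hv t).2.1 with h | h
      · rw [h]; exact (hC₁ _ ⟨t, rfl⟩).trans (le_max_left _ _)
      · rw [h]; exact (hC₂ _ ⟨t, rfl⟩).trans (le_max_right _ _)
    have key : ∀ s t, s ≤ t → ‖γ t - γ s‖ ≤ C * (t - s) := fun s t hst =>
      norm_image_sub_le_of_norm_deriv_right_le_segment hγc.continuousOn
        (fun u _ => (hv u).1) (fun u _ => hvC u) t ⟨hst, le_rfl⟩
    have hlip : LipschitzWith C.toNNReal γ := by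
      refine LipschitzWith.of_dist_le_mul fun s t => ?_
      rw [Real.coe_toNNReal _ hC0]
      rcases le_total s t with hst | hst
      · rw [dist_comm, dist_eq_norm, dist_comm, Real.dist_eq, abs_of_nonneg (sub_nonneg.2 hst)]
        exact key s t hst
      · rw [dist_eq_norm, Real.dist_eq, abs_of_nonneg (sub_nonneg.2 hst)]
        exact key t s hst
    exact fun s t => (hlip.lipschitzOnWith (s := uIcc s t)).absolutelyContinuousOnInterval
  · have hc : (range (fun k : ℤ => (k : ℝ) * T) ∪ range fun k : ℤ => T₁ + k * T).Countable :=
      (countable_range _).union (countable_range _)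
    filter_upwards [hc.ae_notMem volume] with t ht
    obtain ⟨v, -, -, hv⟩ := hall t
    obtain ⟨h1, h2⟩ := hv (fun k hk => ht (Or.inl ⟨k, hk.symm⟩)) fun k hk => ht (Or.inr ⟨k, hk.symm⟩)
    exact ⟨v, h2, h1⟩
  · rw [hγ2 (T₁ + t) ⟨by linarith [ht.1], by linarith [ht.2]⟩, add_sub_cancel_left]

theorem IsArc.strictAntiOn_snd {σ : ℝ} {z₀ z₁ : ℝ × ℝ} {T : ℝ} {ζ : ℝ → ℝ × ℝ}
    (h : IsArc L σ z₀ z₁ T ζ) (hneg : ∀ t ∈ Ioo 0 T, (L (ζ t)).2 < 0) :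
    StrictAntiOn (fun t => (ζ t).2) (Icc 0 T) := by
  refine strictAntiOn_of_deriv_neg (convex_Icc _ _)
    (fun t ht => (h.hasDerivAt t ht).prod_snd.continuousAt.continuousWithinAt) fun t ht => ?_
  rw [interior_Icc] at ht
  rw [(h.hasDerivAt t (Ioo_subset_Icc_self ht)).prod_snd.deriv]
  exact hneg t ht

theorem IsArc.strictMonoOn_snd {σ : ℝ} {z₀ z₁ : ℝ × ℝ} {T : ℝ} {ζ : ℝ → ℝ × ℝ}
    (h : IsArc R σ z₀ z₁ T ζ) (hpos : ∀ t ∈ Ioo 0 T, 0 < (R (ζ t)).2) :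
    StrictMonoOn (fun t => (ζ t).2) (Icc 0 T) := by
  refine strictMonoOn_of_deriv_pos (convex_Icc _ _)
    (fun t ht => (h.hasDerivAt t ht).prod_snd.continuousAt.continuousWithinAt) fun t ht => ?_
  rw [interior_Icc] at ht
  rw [(h.hasDerivAt t (Ioo_subset_Icc_self ht)).prod_snd.deriv]
  exact hpos t ht

/-- A periodic solution that stays in `x < 1` meets the switching line. -/
theorem IsSolution.exists_fst_eq_zero {γ : ℝ → ℝ × ℝ} (h : IsSolution R L γ) (hR : Continuous R)
    (hL : Continuous L) (hR2 : ∀ z : ℝ × ℝ, 0 < z.1 → z.1 < 1 → 0 < (R z).2)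
    (hL2 : ∀ z : ℝ × ℝ, z.1 < 0 → (L z).2 < 0) {T : ℝ} (hT : 0 < T)
    (hper : Function.Periodic γ T) (hlt : ∀ t, (γ t).1 < 1) : ∃ t, (γ t).1 = 0 := by
  by_contra hcon
  push Not at hcon
  have h0T : γ T = γ 0 := by rw [← zero_add T, hper 0]
  have hc := h.continuous.fst
  have hsign : (∀ t, (γ t).1 < 0) ∨ ∀ t, 0 < (γ t).1 := by
    by_contra hno
    push Not at hno
    obtain ⟨⟨s, hs⟩, t, ht⟩ := hno
    obtain ⟨u, hu⟩ := mem_range_of_exists_le_of_exists_ge hc ⟨t, ht⟩ ⟨s, hs⟩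
    exact hcon u hu
  have hcs : ContinuousOn (fun t => (γ t).2) (Icc 0 T) := h.continuous.snd.continuousOn
  rcases hsign with hs | hs
  · have hd := h.hasDerivWithinAt hL (a := 0) (b := T) fun t _ =>
      filippov_left (by simpa using hs t)
    have hanti : StrictAntiOn (fun t => (γ t).2) (Icc 0 T) := by
      refine strictAntiOn_of_deriv_neg (convex_Icc _ _) hcs fun t ht => ?_
      rw [interior_Icc] at ht
      have hdt := (hd t (Ioo_subset_Icc_self ht)).hasDerivAt (Icc_mem_nhds ht.1 ht.2)
      rw [hdt.prod_snd.deriv]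
      exact hL2 _ (hs t)
    have := hanti ⟨le_rfl, hT.le⟩ ⟨hT.le, le_rfl⟩ hT
    simp only [h0T, lt_self_iff_false] at this
  · have hd := h.hasDerivWithinAt hR (a := 0) (b := T) fun t _ =>
      filippov_right (by linarith [hs t])
    have hmono : StrictMonoOn (fun t => (γ t).2) (Icc 0 T) := by
      refine strictMonoOn_of_deriv_pos (convex_Icc _ _) hcs fun t ht => ?_
      rw [interior_Icc] at ht
      have hdt := (hd t (Ioo_subset_Icc_self ht)).hasDerivAt (Icc_mem_nhds ht.1 ht.2)
      rw [hdt.prod_snd.deriv]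
      exact hR2 _ (hs t) (hlt t)
    have := hmono ⟨le_rfl, hT.le⟩ ⟨hT.le, le_rfl⟩ hT
    simp only [h0T, lt_self_iff_false] at this

/-- An isolated fixed point of the return map gives a limit cycle. -/
theorem exists_limitCycle (hR : ContDiff ℝ 1 R) (hL : ContDiff ℝ 1 L)
    (hR2 : ∀ z : ℝ × ℝ, 0 < z.1 → z.1 < 1 → 0 < (R z).2)
    (hL2 : ∀ z : ℝ × ℝ, z.1 < 0 → (L z).2 < 0) {V : Set (ℝ × ℝ)} (hV : ∀ z ∈ V, z.1 < 1)
    {A B : ℝ → ℝ} {a b a' b' : ℝ} (ha : 0 ≤ a) (ha' : 0 ≤ a')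
    (hA : ∀ ρ ∈ Ioo a b, A ρ ∈ Ioo a' b' ∧
      ∃ T ζ, IsArc L 1 (0, ρ) (0, -A ρ) T ζ ∧ ∀ t ∈ Icc 0 T, ζ t ∈ V)
    (hB : ∀ ρ ∈ Ioo a' b', 0 < B ρ ∧
      ∃ T ζ, IsArc R (-1) (0, -ρ) (0, B ρ) T ζ ∧ ∀ t ∈ Icc 0 T, ζ t ∈ V)
    (htop : ∀ ρ ∈ Ioo a b, (R (0, ρ)).1 < 0 ∧ (L (0, ρ)).1 < 0)
    (hbot : ∀ ρ ∈ Ioo a' b', 0 < (R (0, -ρ)).1 ∧ 0 < (L (0, -ρ)).1)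
    {ρ₀ : ℝ} (hρ₀ : ρ₀ ∈ Ioo a b) (hfix : B (A ρ₀) = ρ₀)
    (hiso : (∀ ρ ∈ Ioo a b, ρ ≠ ρ₀ → |ρ - ρ₀| < |B (A ρ) - ρ₀|) ∨
      ∀ ρ ∈ Ioo a b, ρ ≠ ρ₀ → |B (A ρ) - ρ₀| < |ρ - ρ₀|) :
    ∃ Γ, IsLimitCycle R L Γ ∧ Γ ⊆ V ∧ (0, ρ₀) ∈ Γ := by
  obtain ⟨hA₀, T₁, ζ₁, hζ₁, hζ₁V⟩ := hA ρ₀ hρ₀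
  obtain ⟨hB₀, T₂, ζ₂, hζ₂, hζ₂V⟩ := hB (A ρ₀) hA₀
  rw [hfix] at hB₀ hζ₂
  have hRc := hR.continuous
  have hLc := hL.continuous
  have hT₁ := hζ₁.pos
  have hT₂ := hζ₂.pos
  obtain ⟨γ, hsol, hper, hγ1, hγ2⟩ := exists_periodic_of_arcs hRc hLc hζ₁ hζ₂
  have hγ0 : γ 0 = (0, ρ₀) := by rw [hγ1 0 ⟨le_rfl, hT₁.le⟩, hζ₁.source]
  have hγ2' : ∀ t ∈ Icc T₁ (T₁ + T₂), γ t = ζ₂ (t - T₁) := fun t ht => by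
    rw [← hγ2 (t - T₁) ⟨by linarith [ht.1], by linarith [ht.2]⟩, add_sub_cancel]
  have hleft : ∀ t ∈ Ioo 0 T₁, (γ t).1 < 0 := fun t ht => by
    rw [hγ1 t (Ioo_subset_Icc_self ht)]
    simpa using hζ₁.side t ht
  have hright : ∀ t ∈ Ioo T₁ (T₁ + T₂), 0 < (γ t).1 := fun t ht => by
    rw [hγ2' t (Ioo_subset_Icc_self ht)]
    linarith [hζ₂.side (t - T₁) ⟨by linarith [ht.1], by linarith [ht.2]⟩]
  have hγT₁ : γ T₁ = (0, -A ρ₀) := by rw [hγ1 T₁ ⟨hT₁.le, le_rfl⟩, hζ₁.target]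
  have hanti := hζ₁.strictAntiOn_snd fun t ht => hL2 _ (by simpa using hζ₁.side t ht)
  have hmono := hζ₂.strictMonoOn_snd fun t ht =>
    hR2 _ (by linarith [hζ₂.side t ht]) (hV _ (hζ₂V t (Ioo_subset_Icc_self ht)))
  -- On each arc `y` is strictly monotone, and the two arcs lie on opposite sides of the line.
  have hinj : InjOn γ (Ico 0 (T₁ + T₂)) := by
    have hlt : ∀ s ∈ Ico 0 (T₁ + T₂), ∀ t ∈ Ico 0 (T₁ + T₂), s < t → γ s ≠ γ t := by
      intro s hs t ht hst heq
      rcases le_or_gt t T₁ with htT | htT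
      · have := hanti ⟨hs.1, hst.le.trans htT⟩ ⟨ht.1, htT⟩ hst
        simp only [← hγ1 s ⟨hs.1, hst.le.trans htT⟩, ← hγ1 t ⟨ht.1, htT⟩, heq,
          lt_self_iff_false] at this
      · rcases le_or_gt s T₁ with hsT | hsT
        · have h1 := hright t ⟨htT, ht.2⟩
          have h2 : (γ s).1 ≤ 0 := by
            rcases hs.1.eq_or_lt with h0 | h0
            · rw [← h0, hγ0]
            · rcases hsT.eq_or_lt with h3 | h3
              · rw [h3, hγT₁]
              · exact (hleft s ⟨h0, h3⟩).le
          rw [heq] at h2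
          linarith
        · have := hmono (a := s - T₁) ⟨by linarith, by linarith [hs.2]⟩ (b := t - T₁)
            ⟨by linarith, by linarith [ht.2]⟩ (by linarith)
          simp only [← hγ2' s ⟨hsT.le, hs.2.le⟩, ← hγ2' t ⟨htT.le, ht.2.le⟩, heq,
            lt_self_iff_false] at this
    intro s hs t ht heq
    rcases lt_trichotomy s t with h | h | h
    · exact absurd heq (hlt s hs t ht h)
    · exact h
    · exact absurd heq.symm (hlt t ht s hs h)
  have hTpos : 0 < T₁ + T₂ := by positivity
  have hrange : range γ = γ '' Icc 0 (T₁ + T₂) := by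
    have := hper.image_Icc hTpos 0
    rw [zero_add] at this
    exact this.symm
  have hcross : ∀ t ∈ Icc 0 (T₁ + T₂), (γ t).1 = 0 → γ t = (0, ρ₀) ∨ γ t = (0, -A ρ₀) := by
    intro t ht h0
    rcases ht.1.eq_or_lt with h1 | h1
    · left; rw [← h1, hγ0]
    · rcases lt_trichotomy t T₁ with h2 | h2 | h2
      · exact absurd h0 (hleft t ⟨h1, h2⟩).ne
      · right; rw [h2, hγT₁]
      · rcases ht.2.eq_or_lt with h3 | h3
        · left; rw [h3, ← zero_add (T₁ + T₂), hper 0, hγ0]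
        · exact absurd h0 (hright t ⟨h2, h3⟩).ne'
  have hΓV : range γ ⊆ V := by
    rw [hrange]
    rintro _ ⟨t, ht, rfl⟩
    rcases le_total t T₁ with h1 | h1
    · rw [hγ1 t ⟨ht.1, h1⟩]; exact hζ₁V t ⟨ht.1, h1⟩
    · rw [hγ2' t ⟨h1, ht.2⟩]; exact hζ₂V _ ⟨by linarith, by linarith [ht.2]⟩
  refine ⟨range γ, ⟨⟨γ, T₁ + T₂, hTpos, hsol, hper, hinj, rfl⟩, ?_, ?_, ?_⟩, hΓV, ⟨0, hγ0⟩⟩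
  · rw [hrange]
    rintro _ ⟨t, ht, rfl⟩ h0
    rcases hcross t ht h0 with h | h
    · rw [h]
      obtain ⟨h1, h2⟩ := htop ρ₀ hρ₀
      exact mul_pos_of_neg_of_neg h1 h2
    · rw [h]
      obtain ⟨h1, h2⟩ := hbot _ hA₀
      exact mul_pos h1 h2
  · refine ⟨-A ρ₀, ρ₀, by linarith [hA₀.1], hB₀, ?_⟩
    ext z
    constructor
    · rintro ⟨hz, hz0⟩
      rw [hrange] at hz
      obtain ⟨t, ht, rfl⟩ := hz
      rcases hcross t ht hz0 with h | h
      · right; exact h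
      · left; exact h
    · rintro (rfl | rfl)
      · exact ⟨⟨T₁, hγT₁⟩, rfl⟩
      · exact ⟨⟨0, hγ0⟩, rfl⟩
  -- This neighborhood restricts an orbit only by `x < 1` and by the heights at which it may meet
  -- the line. That suffices: every such height then lies in a window where the half maps are
  -- defined and both fields cross in the same direction.
  · refine ⟨{z | z.1 < 1} ∩ ({z | z.1 ≠ 0} ∪ ({z | z.2 ∈ Ioo a b} ∪ {z | -z.2 ∈ Ioo a' b'})),
      ?_, ?_, ?_⟩
    · refine (isOpen_lt continuous_fst continuous_const).inter
        ((isOpen_ne_fun continuous_fst continuous_const).union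
          ((isOpen_Ioo.preimage continuous_snd).union (isOpen_Ioo.preimage continuous_snd.neg)))
    · intro z hz
      refine ⟨hV z (hΓV hz), ?_⟩
      rw [hrange] at hz
      obtain ⟨t, ht, rfl⟩ := hz
      by_cases h0 : (γ t).1 = 0
      · right
        rcases hcross t ht h0 with h | h
        · left; rw [h]; exact hρ₀
        · right; rw [h]; simpa using hA₀
      · left; exact h0
    · rintro Γ' ⟨g, T', hT', hgsol, hgper, -, rfl⟩ hU
      have hgU := fun t => hU ⟨t, rfl⟩
      have hgline : ∀ t y, g t = (0, y) → y ∈ Ioo a b ∨ -y ∈ Ioo a' b' := by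
        intro t y hy
        have := (hgU t).2
        rw [hy] at this
        rcases this with h | h | h
        · exact absurd rfl h
        · left; exact h
        · right; exact h
      have hstepL : ∀ t ρ, g t = (0, ρ) → ρ ∈ Ioo a b → ∀ T ζ, IsArc L 1 (0, ρ) (0, -A ρ) T ζ →
          ∀ u ∈ Icc 0 T, g (t + u) = ζ u := by
        intro t ρ hg hρ T ζ hζ
        refine hgsol.follow hRc hLc hL (fun z => filippov_left) hζ hg rfl ?_ ?_
        · simpa using (htop ρ hρ).1
        · simpa using (htop ρ hρ).2
      have hstepR : ∀ t ρ, g t = (0, -ρ) → ρ ∈ Ioo a' b' → ∀ T ζ,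
          IsArc R (-1) (0, -ρ) (0, B ρ) T ζ → ∀ u ∈ Icc 0 T, g (t + u) = ζ u := by
        intro t ρ hg hρ T ζ hζ
        refine hgsol.follow hRc hLc hR (fun z => filippov_right) hζ hg rfl ?_ ?_
        · simpa using (hbot ρ hρ).1
        · simpa using (hbot ρ hρ).2
      have hbottop : ∀ t ρ, g t = (0, -ρ) → ρ ∈ Ioo a' b' →
          (∃ t', g t' = (0, B ρ)) ∧ B ρ ∈ Ioo a b := by
        intro t ρ hg hρ
        obtain ⟨hBpos, T, ζ, hζ, -⟩ := hB ρ hρ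
        have h1 : g (t + T) = (0, B ρ) := by
          rw [hstepR t ρ hg hρ T ζ hζ T ⟨hζ.pos.le, le_rfl⟩, hζ.target]
        refine ⟨⟨_, h1⟩, ?_⟩
        rcases hgline _ _ h1 with h | h
        · exact h
        · linarith [h.1]
      have hreturn : ∀ t ρ, g t = (0, ρ) → ρ ∈ Ioo a b →
          (∃ t', g t' = (0, B (A ρ))) ∧ B (A ρ) ∈ Ioo a b := by
        intro t ρ hg hρ
        obtain ⟨hAρ, T, ζ, hζ, -⟩ := hA ρ hρ
        refine hbottop (t + T) (A ρ) ?_ hAρ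
        rw [hstepL t ρ hg hρ T ζ hζ T ⟨hζ.pos.le, le_rfl⟩, hζ.target]
      have hgc := hgsol.continuous
      -- The upper crossings of the competing orbit form a nonempty compact set that `B ∘ A` maps
      -- into itself. Under expansion its point farthest from `ρ₀`, under contraction its nearest
      -- point, can only be `ρ₀` itself.
      set Y : Set ℝ := {ρ | 0 ≤ ρ ∧ (0, ρ) ∈ range g} with hY
      have hYmem : ∀ ρ ∈ Y, ρ ∈ Ioo a b := by
        rintro ρ ⟨h0, t, ht⟩
        rcases hgline t ρ ht with h | h
        · exact h
        · linarith [h.1]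
      have hYret : ∀ ρ ∈ Y, B (A ρ) ∈ Y := by
        intro ρ hρ
        obtain ⟨t, ht⟩ := hρ.2
        obtain ⟨h1, h2⟩ := hreturn t ρ ht (hYmem ρ hρ)
        exact ⟨by linarith [h2.1], h1⟩
      have hYne : Y.Nonempty := by
        obtain ⟨t, ht⟩ := hgsol.exists_fst_eq_zero hRc hLc hR2 hL2 hT' hgper fun t => (hgU t).1
        have hgt : g t = (0, (g t).2) := Prod.ext ht rfl
        rcases hgline t _ hgt with h | h
        · exact ⟨_, by linarith [h.1], t, hgt⟩
        · obtain ⟨h1, h2⟩ := hbottop t (-(g t).2) (by rwa [neg_neg]) h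
          exact ⟨_, by linarith [h2.1], h1⟩
      have hYcpt : IsCompact Y := by
        have hcl : IsClosed Y := by
          refine IsClosed.inter isClosed_Ici ?_
          exact ((hgper.compact_of_continuous hT'.ne' hgc).isClosed).preimage
            (Continuous.prodMk_right (0 : ℝ))
        exact Metric.isCompact_of_isClosed_isBounded hcl
          ((Metric.isBounded_Ioo a b).subset hYmem)
      have hdc : ContinuousOn (fun ρ => |ρ - ρ₀|) Y := by fun_prop
      have hρ₀Y : ρ₀ ∈ Y := by
        rcases hiso with hexp | hcon
        · obtain ⟨ρ, hρ, hmax⟩ := hYcpt.exists_isMaxOn hYne hdc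
          by_cases h : ρ = ρ₀
          · rwa [← h]
          · exact absurd (hmax (hYret ρ hρ)) (not_le.2 (hexp ρ (hYmem ρ hρ) h))
        · obtain ⟨ρ, hρ, hmin⟩ := hYcpt.exists_isMinOn hYne hdc
          by_cases h : ρ = ρ₀
          · rwa [← h]
          · exact absurd (hmin (hYret ρ hρ)) (not_le.2 (hcon ρ (hYmem ρ hρ) h))
      obtain ⟨-, t₀, ht₀⟩ := hρ₀Y
      have hturn : ∀ t, g t = (0, ρ₀) → ∀ u ∈ Icc 0 (T₁ + T₂), g (t + u) = γ u := by
        intro t ht u hu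
        have h1 := hstepL t ρ₀ ht hρ₀ T₁ ζ₁ hζ₁
        have h2 := hstepR (t + T₁) (A ρ₀) (by rw [h1 T₁ ⟨hT₁.le, le_rfl⟩, hζ₁.target]) hA₀ T₂ ζ₂
          (by rw [hfix]; exact hζ₂)
        rcases le_total u T₁ with h3 | h3
        · rw [h1 u ⟨hu.1, h3⟩, hγ1 u ⟨hu.1, h3⟩]
        · have := h2 (u - T₁) ⟨by linarith, by linarith [hu.2]⟩
          rw [hγ2' u ⟨h3, hu.2⟩, ← this]
          congr 1
          ring
      have hiter : ∀ k : ℕ, g (t₀ + k * (T₁ + T₂)) = (0, ρ₀) := by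
        intro k
        induction k with
        | zero => simpa using ht₀
        | succ k ih =>
          have := hturn _ ih (T₁ + T₂) ⟨hTpos.le, le_rfl⟩
          rw [← zero_add (T₁ + T₂), hper 0, hγ0, zero_add] at this
          rw [← this]
          congr 1
          push_cast
          ring
      apply Subset.antisymm
      · rintro _ ⟨s, rfl⟩
        -- The curves are known to agree only forward in time from `t₀`, so `s` is first moved
        -- beyond `t₀` by periods of `g`.
        obtain ⟨j, hj⟩ := exists_nat_ge ((t₀ - s) / T')
        have hj' : t₀ ≤ s + j * T' := by
          rw [div_le_iff₀ hT'] at hj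
          linarith
        have hs : g (s + j * T') = g s := hgper.nat_mul j s
        rw [← hs]
        set w := s + j * T' - t₀ with hw
        have hw0 : 0 ≤ w / (T₁ + T₂) := div_nonneg (by linarith) hTpos.le
        have hf1 := Nat.floor_le hw0
        have hf2 := (Nat.lt_floor_add_one (w / (T₁ + T₂))).le
        rw [le_div_iff₀ hTpos] at hf1
        rw [div_le_iff₀ hTpos] at hf2
        have := hturn _ (hiter ⌊w / (T₁ + T₂)⌋₊) (w - ⌊w / (T₁ + T₂)⌋₊ * (T₁ + T₂))
          ⟨by linarith, by linarith⟩
        refine ⟨_, this.symm.trans ?_⟩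
        congr 1
        rw [hw]
        ring
      · rw [hrange]
        rintro _ ⟨u, hu, rfl⟩
        exact ⟨t₀ + u, hturn t₀ ht₀ u hu⟩

end PiecewiseHam


namespace PiecewiseHam

open Set Filter Topology MeasureTheory

/-! ### Limit cycles from simple zeros of the first order displacement -/

/-- The five units of `e η |ρ - ρ'|` are: two from the error of `B` over an increment of `A` of size
at most `2 |ρ - ρ'|`, two from the error of `A` multiplied by `|1 + e μB| ≤ 2`, and one from the
cross term `e² μA μB`. -/
theorem abs_comp_sub_le {A B : ℝ → ℝ} {r δ e μA μB η : ℝ} (he : 0 < e) (hη : 0 ≤ η)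
    (hA : ∀ ρ ρ', |ρ - r| ≤ δ → |ρ' - r| ≤ δ →
      |A ρ - A ρ' - (1 + e * μA) * (ρ - ρ')| ≤ e * η * |ρ - ρ'|)
    (hB : ∀ ρ ρ', |ρ - r| ≤ δ → |ρ' - r| ≤ δ →
      |B ρ - B ρ' - (1 + e * μB) * (ρ - ρ')| ≤ e * η * |ρ - ρ'|)
    (h1 : e * (|μA| + η) ≤ 1) (h2 : e * |μB| ≤ 1) (h3 : e * |μA * μB| ≤ η) {ρ ρ' : ℝ}
    (hρ : |ρ - r| ≤ δ) (hρ' : |ρ' - r| ≤ δ) (hAρ : |A ρ - r| ≤ δ) (hAρ' : |A ρ' - r| ≤ δ) :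
    |B (A ρ) - B (A ρ') - (ρ - ρ') - e * (μA + μB) * (ρ - ρ')| ≤ 5 * (e * η) * |ρ - ρ'| := by
  have a1 := hA ρ ρ' hρ hρ'
  have b1 := hB _ _ hAρ hAρ'
  set Δ := ρ - ρ'
  set α := A ρ - A ρ'
  have hΔ := abs_nonneg Δ
  have hα : |α| ≤ 2 * |Δ| := by
    have e1 : α = (α - (1 + e * μA) * Δ) + Δ + e * μA * Δ := by ring
    have e2 : |e * μA * Δ| = e * |μA| * |Δ| := by rw [abs_mul, abs_mul, abs_of_pos he]
    calc |α| ≤ |α - (1 + e * μA) * Δ| + |Δ| + |e * μA * Δ| := by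
          conv_lhs => rw [e1]
          exact abs_add_three _ _ _
      _ ≤ e * η * |Δ| + |Δ| + e * |μA| * |Δ| := by rw [e2]; linarith
      _ = |Δ| + e * (|μA| + η) * |Δ| := by ring
      _ ≤ |Δ| + 1 * |Δ| := by gcongr
      _ = 2 * |Δ| := by ring
  have e3 : B (A ρ) - B (A ρ') - Δ - e * (μA + μB) * Δ
      = (B (A ρ) - B (A ρ') - (1 + e * μB) * α) + (1 + e * μB) * (α - (1 + e * μA) * Δ)
        + e * (e * (μA * μB)) * Δ := by ring
  have hb : |1 + e * μB| ≤ 2 := by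
    have := abs_add_le 1 (e * μB)
    rw [abs_one, abs_mul, abs_of_pos he] at this
    linarith
  have t1 : e * η * |α| ≤ e * η * (2 * |Δ|) := by gcongr
  have t2 : |(1 + e * μB) * (α - (1 + e * μA) * Δ)| ≤ 2 * (e * η * |Δ|) := by
    rw [abs_mul]
    gcongr
  have t3 : |e * (e * (μA * μB)) * Δ| ≤ e * η * |Δ| := by
    rw [abs_mul, abs_mul, abs_mul, abs_of_pos he]
    gcongr
  rw [e3]
  calc _ ≤ _ := abs_add_three _ _ _
    _ ≤ e * η * (2 * |Δ|) + 2 * (e * η * |Δ|) + e * η * |Δ| := by linarith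
    _ = 5 * (e * η) * |Δ| := by ring

/-- The first order displacement at `r` cancels because `mA + mB = 0`; the rest is `e` times a
quantity proportional to `η₂`. -/
theorem abs_comp_sub_self_le {A B : ℝ → ℝ} {r δ e μB mA mB η η₂ : ℝ} (he : 0 < e) (hη : 0 ≤ η)
    (hB : ∀ ρ ρ', |ρ - r| ≤ δ → |ρ' - r| ≤ δ →
      |B ρ - B ρ' - (1 + e * μB) * (ρ - ρ')| ≤ e * η * |ρ - ρ'|) (hδ : 0 ≤ δ) (hη₂ : η₂ ≤ δ)
    (hAr : |A r - r - e * mA| ≤ η₂ * e) (hBr : |B r - r - e * mB| ≤ η₂ * e)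
    (hAm : |A r - r| ≤ η₂) (hm : mA + mB = 0) :
    |B (A r) - r| ≤ e * (η₂ * (η + 2 + |μB|)) := by
  have h1 := hB (A r) r (hAm.trans hη₂) (by simpa using hδ)
  have e1 : B (A r) - r = (B (A r) - B r - (1 + e * μB) * (A r - r)) + (A r - r - e * mA)
      + (B r - r - e * mB) + e * μB * (A r - r) + e * (mA + mB) := by ring
  rw [hm, mul_zero, add_zero] at e1
  have h2 : e * η * |A r - r| ≤ e * η * η₂ := by gcongr
  have h3 : |e * μB * (A r - r)| ≤ e * |μB| * η₂ := by
    rw [abs_mul, abs_mul, abs_of_pos he]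
    gcongr
  rw [e1]
  have h4 := abs_add_le ((B (A r) - B r - (1 + e * μB) * (A r - r)) + (A r - r - e * mA)
      + (B r - r - e * mB)) (e * μB * (A r - r))
  have h5 := abs_add_three (B (A r) - B r - (1 + e * μB) * (A r - r)) (A r - r - e * mA)
    (B r - r - e * mB)
  calc _ ≤ e * η * η₂ + η₂ * e + η₂ * e + e * |μB| * η₂ := by linarith
    _ = _ := by ring

/-- A function with slope close to `e μ ≠ 0` and small at the centre has a zero. -/
theorem exists_zero_of_slope {D : ℝ → ℝ} {r w e μ : ℝ} (hw : 0 < w) (he : 0 < e)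
    (hD : ∀ ρ ρ', |ρ - r| ≤ w → |ρ' - r| ≤ w →
      |D ρ - D ρ' - e * μ * (ρ - ρ')| ≤ e * (|μ| / 2) * |ρ - ρ'|)
    (hDr : |D r| < e * (|μ| / 2) * w) : ∃ ρ ∈ Ioo (r - w) (r + w), D ρ = 0 := by
  -- Multiplying by `μ` makes the function increase across the window, whatever the sign of `μ`.
  have hcont : ContinuousOn (fun ρ => μ * D ρ) (Icc (r - w) (r + w)) := by
    refine continuousOn_const.mul ?_
    have : LipschitzOnWith (2 * e * |μ|).toNNReal D (Icc (r - w) (r + w)) := by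
      refine LipschitzOnWith.of_dist_le_mul fun ρ hρ ρ' hρ' => ?_
      rw [Real.coe_toNNReal _ (by positivity), Real.dist_eq, Real.dist_eq]
      have h1 := hD ρ ρ' (by rw [abs_le]; constructor <;> linarith [hρ.1, hρ.2])
        (by rw [abs_le]; constructor <;> linarith [hρ'.1, hρ'.2])
      have h2 := abs_sub_abs_le_abs_sub (D ρ - D ρ') (e * μ * (ρ - ρ'))
      rw [abs_mul (e * μ), abs_mul e, abs_of_pos he] at h2
      have h3 : 0 ≤ e * |μ| * |ρ - ρ'| := by positivity
      linarith
    exact this.continuousOn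
  have hrr : |r - r| ≤ w := by simpa using hw.le
  have hμr : |μ * D r| ≤ |μ| * |D r| := (abs_mul _ _).le
  have hsq : μ * μ = |μ| * |μ| := (abs_mul_abs_self μ).symm
  have hμ : 0 < |μ| := by
    rcases (abs_nonneg μ).eq_or_lt with h | h
    · rw [← h] at hDr
      have := abs_nonneg (D r)
      nlinarith
    · exact h
  have hpos : 0 < μ * D (r + w) := by
    have h1 := hD (r + w) r (by simp [abs_of_pos hw]) hrr
    rw [add_sub_cancel_left, abs_of_pos hw] at h1
    have h2 : |μ * (D (r + w) - D r - e * μ * w)| ≤ |μ| * (e * (|μ| / 2) * w) := by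
      rw [abs_mul]; gcongr
    have h3 := (abs_le.1 h2).1
    have h4 := (abs_le.1 hμr).1
    have h5 := mul_lt_mul_of_pos_left hDr hμ
    have h6 : μ * (D (r + w) - D r - e * μ * w) = μ * D (r + w) - μ * D r - e * (|μ| * |μ|) * w := by
      rw [← hsq]; ring
    rw [h6] at h3
    linarith
  have hneg : μ * D (r - w) < 0 := by
    have h1 := hD (r - w) r (by simp [abs_of_pos hw]) hrr
    rw [sub_sub_cancel_left, abs_neg, abs_of_pos hw] at h1
    have h2 : |μ * (D (r - w) - D r - e * μ * -w)| ≤ |μ| * (e * (|μ| / 2) * w) := by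
      rw [abs_mul]; gcongr
    have h3 := (abs_le.1 h2).2
    have h4 := (abs_le.1 hμr).2
    have h5 := mul_lt_mul_of_pos_left hDr hμ
    have h6 : μ * (D (r - w) - D r - e * μ * -w) = μ * D (r - w) - μ * D r + e * (|μ| * |μ|) * w := by
      rw [← hsq]; ring
    rw [h6] at h3
    linarith
  obtain ⟨ρ, hρ, hzero⟩ := intermediate_value_Ioo (by linarith) hcont ⟨hneg, hpos⟩
  exact ⟨ρ, hρ, (mul_eq_zero.1 hzero).resolve_left (abs_pos.1 hμ)⟩

theorem eventually_mul_lt (C : ℝ) {B : ℝ} (hB : 0 < B) : ∀ᶠ e in 𝓝[>] (0 : ℝ), e * C < B := by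
  have : Tendsto (fun e : ℝ => e * C) (𝓝[>] 0) (𝓝 (0 * C)) :=
    (tendsto_id.mul_const C).mono_left nhdsWithin_le_nhds
  rw [zero_mul] at this
  exact this.eventually_lt_const hB

/-- A simple zero `r` of the sum of the first order terms of the two half maps persists as a limit
cycle. -/
theorem eventually_exists_limitCycle {p q : ℝ × ℝ → ℝ} (hp : ContDiff ℝ 1 p) (hq : ContDiff ℝ 1 q)
    {r mL mR mL' mR' : ℝ} (hr : 0 < r) {V : Set (ℝ × ℝ)} (hV : ∀ z ∈ V, z.1 < 1)
    (hLmap : IsHalfMap (fun e z => (-z.2 + e * q z, z.1)) 1 r mL mL' V)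
    (hRmap : IsHalfMap (fun e z => (-z.2 + e * p z, 1 - z.1)) (-1) r mR mR' V)
    (hm : mL + mR = 0) (hm' : mL' + mR' ≠ 0) {δ₁ : ℝ} (hδ₁ : 0 < δ₁) :
    ∀ᶠ e in 𝓝[>] (0 : ℝ), ∃ Γ, IsLimitCycle (fun z => (-z.2 + e * p z, 1 - z.1))
      (fun z => (-z.2 + e * q z, z.1)) Γ ∧ Γ ⊆ V ∧ ∃ ρ, |ρ - r| < δ₁ ∧ 0 < ρ ∧ (0, ρ) ∈ Γ := by
  set μ := mL' + mR' with hμdef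
  have hμ : 0 < |μ| := abs_pos.2 hm'
  -- With this choice the composition error `5 e η` is half of the slope `e |μ|`.
  set η := |μ| / 10 with hη
  have hη0 : 0 < η := by positivity
  obtain ⟨δ, hδL, hδR, hδ0, hδ⟩ := ((hLmap η hη0).and ((hRmap η hη0).and
    (Ioo_mem_nhdsGT (lt_min hδ₁ (by positivity : 0 < r / 4))))).exists
  rw [lt_min_iff] at hδ
  set c := η + 2 + |mR'| with hc
  have hc0 : 0 < c := by positivity
  -- The first bound lets `A` map the window of radius `δ / 2` into the one of radius `δ`. The
  -- second makes the displacement at `r` at most `e |μ| δ / 8`, below the variation `e |μ| δ / 4`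
  -- of the displacement over the half-window.
  set η₂ := min (δ / 4) (|μ| * δ / (8 * c)) with hη₂
  have hη₂0 : 0 < η₂ := lt_min (by positivity) (by positivity)
  have hη₂δ : η₂ ≤ δ / 4 := min_le_left _ _
  have hη₂c : η₂ * c ≤ |μ| * δ / 8 := by
    calc η₂ * c ≤ |μ| * δ / (8 * c) * c := by gcongr; exact min_le_right _ _
      _ = |μ| * δ / 8 := by field_simp
  have hbound : ∃ C, ∀ y ∈ Icc (-(2 * r)) (2 * r), |p (0, y)| ≤ C ∧ |q (0, y)| ≤ C := by
    have cp : ContinuousOn (fun y : ℝ => p (0, y)) (Icc (-(2 * r)) (2 * r)) :=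
      (hp.continuous.comp (Continuous.prodMk_right (0 : ℝ))).continuousOn
    have cq : ContinuousOn (fun y : ℝ => q (0, y)) (Icc (-(2 * r)) (2 * r)) :=
      (hq.continuous.comp (Continuous.prodMk_right (0 : ℝ))).continuousOn
    obtain ⟨C₁, hC₁⟩ := isCompact_Icc.exists_bound_of_continuousOn cp
    obtain ⟨C₂, hC₂⟩ := isCompact_Icc.exists_bound_of_continuousOn cq
    exact ⟨max C₁ C₂, fun y hy => ⟨(hC₁ y hy).trans (le_max_left _ _),
      (hC₂ y hy).trans (le_max_right _ _)⟩⟩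
  obtain ⟨C, hC⟩ := hbound
  filter_upwards [hδL η₂ hη₂0, hδR η₂ hη₂0, self_mem_nhdsWithin,
    eventually_mul_lt (|mL'| + η) one_pos, eventually_mul_lt |mR'| one_pos,
    eventually_mul_lt |mL' * mR'| hη0, eventually_mul_lt |μ| one_pos,
    eventually_mul_lt C (half_pos hr)]
    with e ⟨A, hAr, hAs, hA⟩ ⟨B, hBr, hBs, hB⟩ he0 he1 he2 he3 he4 he5
  have he0 : 0 < e := he0
  have hwin : ∀ ρ, |ρ - r| ≤ δ / 2 → |A ρ - r| ≤ δ / 4 + δ / 2 := by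
    intro ρ hρ
    have h1 := abs_sub_le (A ρ) ρ r
    have h2 := (hA ρ (by linarith)).1
    linarith
  have hslope : ∀ ρ ρ', |ρ - r| ≤ δ / 2 → |ρ' - r| ≤ δ / 2 →
      |(B (A ρ) - ρ) - (B (A ρ') - ρ') - e * μ * (ρ - ρ')| ≤ e * (|μ| / 2) * |ρ - ρ'| := by
    intro ρ ρ' hρ hρ'
    have h1 := abs_comp_sub_le he0 hη0.le hAs hBs he1.le he2.le he3.le (ρ := ρ) (ρ' := ρ')
      (by linarith) (by linarith) (by linarith [hwin ρ hρ]) (by linarith [hwin ρ' hρ'])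
    have e1 : (B (A ρ) - ρ) - (B (A ρ') - ρ') - e * μ * (ρ - ρ')
        = B (A ρ) - B (A ρ') - (ρ - ρ') - e * μ * (ρ - ρ') := by ring
    rw [e1]
    refine h1.trans (le_of_eq ?_)
    rw [hη]
    ring
  have hcentre : |B (A r) - r| < e * (|μ| / 2) * (δ / 2) := by
    have h1 := abs_comp_sub_self_le he0 hη0.le hBs hδ0.le (by linarith) hAr hBr
      (hA r (by simpa using hδ0.le)).1 hm
    have h2 : e * (η₂ * c) ≤ e * (|μ| * δ / 8) := by gcongr
    have h3 : 0 < e * (|μ| * δ) := by positivity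
    calc _ ≤ _ := h1
      _ ≤ _ := h2
      _ < _ := by linarith
  obtain ⟨ρ₀, hρ₀, hzero⟩ := exists_zero_of_slope (D := fun ρ => B (A ρ) - ρ) (half_pos hδ0) he0
    hslope hcentre
  have hfix : B (A ρ₀) = ρ₀ := sub_eq_zero.1 hzero
  have hIoo : ∀ {w ρ : ℝ}, ρ ∈ Ioo (r - w) (r + w) → |ρ - r| ≤ w := by
    intro w ρ hρ
    rw [abs_le]
    constructor <;> linarith [hρ.1, hρ.2]
  have hsmall : ∀ y ∈ Icc (-(2 * r)) (2 * r), |e * p (0, y)| < r / 2 ∧ |e * q (0, y)| < r / 2 := by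
    intro y hy
    obtain ⟨h1, h2⟩ := hC y hy
    rw [abs_mul, abs_mul, abs_of_pos he0]
    exact ⟨(mul_le_mul_of_nonneg_left h1 he0.le).trans_lt he5,
      (mul_le_mul_of_nonneg_left h2 he0.le).trans_lt he5⟩
  obtain ⟨Γ, hΓ, hΓV, hmem⟩ := exists_limitCycle
    (R := fun z => (-z.2 + e * p z, 1 - z.1)) (L := fun z => (-z.2 + e * q z, z.1))
    (by fun_prop) (by fun_prop) (fun z _ h => by simpa using h) (fun z h => h) hV
    (A := A) (B := B) (a := r - δ / 2) (b := r + δ / 2) (a' := r - δ) (b' := r + δ)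
    (by linarith) (by linarith)
    (fun ρ hρ => by
      have h1 := hwin ρ (hIoo hρ)
      rw [abs_le] at h1
      refine ⟨⟨by linarith, by linarith⟩, ?_⟩
      obtain ⟨T, ζ, h2, h3⟩ := (hA ρ (by linarith [hIoo hρ])).2
      rw [one_mul, one_mul] at h2
      exact ⟨T, ζ, h2, h3⟩)
    (fun ρ hρ => by
      obtain ⟨h1, T, ζ, h2, h3⟩ := hB ρ (hIoo hρ)
      rw [neg_one_mul, neg_one_mul, neg_neg] at h2
      refine ⟨?_, T, ζ, h2, h3⟩
      have := (abs_le.1 h1).1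
      linarith [hρ.1])
    (fun ρ hρ => by
      obtain ⟨h1, h2⟩ := hsmall ρ ⟨by linarith [hρ.1], by linarith [hρ.2]⟩
      rw [abs_lt] at h1 h2
      constructor
      · simp only; linarith [hρ.1]
      · simp only; linarith [hρ.1])
    (fun ρ hρ => by
      obtain ⟨h1, h2⟩ := hsmall (-ρ) ⟨by linarith [hρ.2], by linarith [hρ.1]⟩
      rw [abs_lt] at h1 h2
      constructor
      · simp only; linarith [hρ.1]
      · simp only; linarith [hρ.1])
    hρ₀ hfix
    (by
      have hρ₀' := hIoo hρ₀
      have hdev : ∀ ρ ∈ Ioo (r - δ / 2) (r + δ / 2),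
          |(B (A ρ) - ρ₀) - (1 + e * μ) * (ρ - ρ₀)| ≤ e * (|μ| / 2) * |ρ - ρ₀| := by
        intro ρ hρ
        have h1 := hslope ρ ρ₀ (hIoo hρ) hρ₀'
        rw [hfix, sub_self, sub_zero] at h1
        convert h1 using 2
        ring
      -- Difference quotients of the return map at `ρ₀` lie within `e |μ| / 2` of `1 + e μ`: below
      -- `1` in absolute value if `μ < 0`, as `e |μ| < 1`, and above `1` if `μ > 0`.
      rcases lt_or_gt_of_ne hm' with hneg | hpos
      · right
        intro ρ hρ hne
        have h1 := hdev ρ hρ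
        have h2 : 0 < |ρ - ρ₀| := abs_pos.2 (sub_ne_zero.2 hne)
        have h3 := abs_sub_abs_le_abs_sub (B (A ρ) - ρ₀) ((1 + e * μ) * (ρ - ρ₀))
        rw [abs_of_neg hneg] at he4 h1
        rw [abs_mul, abs_of_nonneg (by linarith : 0 ≤ 1 + e * μ)] at h3
        nlinarith [mul_pos (mul_pos he0 (neg_pos.2 hneg)) h2]
      · left
        intro ρ hρ hne
        have h1 := hdev ρ hρ
        have h2 : 0 < |ρ - ρ₀| := abs_pos.2 (sub_ne_zero.2 hne)
        have h3 := abs_sub_abs_le_abs_sub ((1 + e * μ) * (ρ - ρ₀)) (B (A ρ) - ρ₀)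
        rw [abs_sub_comm ((1 + e * μ) * (ρ - ρ₀))] at h3
        rw [abs_of_pos hpos] at h1
        rw [abs_mul, abs_of_nonneg (by positivity : 0 ≤ 1 + e * μ)] at h3
        nlinarith [mul_pos (mul_pos he0 hpos) h2])
  refine ⟨Γ, hΓ, hΓV, ρ₀, ?_, by linarith [hρ₀.1], hmem⟩
  have := hIoo hρ₀
  linarith

end PiecewiseHam


namespace PiecewiseHam

open Set Filter Topology MeasureTheory

/-! ### Functions with many simple zeros in a finite-dimensional space -/

/-- While there are fewer nodes than the dimension, some nonzero element vanishes at all of them. A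
point of `J` where it does not vanish is the next node, and a multiple of it corrects the value
there without disturbing the others. -/
theorem exists_interpolation {V : Type*} [AddCommGroup V] [Module ℝ V] [FiniteDimensional ℝ V]
    (M : V →ₗ[ℝ] ℝ → ℝ) {J : Set ℝ} (hM : ∀ c, (∀ ρ ∈ J, M c ρ = 0) → c = 0) (k : ℕ)
    (hk : k ≤ Module.finrank ℝ V) :
    ∃ s : Finset ℝ, ↑s ⊆ J ∧ s.card = k ∧ ∀ v : ℝ → ℝ, ∃ c, ∀ ρ ∈ s, M c ρ = v ρ := by
  classical
  induction k with
  | zero => exact ⟨∅, by simp, rfl, fun v => ⟨0, by simp⟩⟩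
  | succ k ih =>
    obtain ⟨s, hsJ, hcard, hs⟩ := ih (by lia)
    let ev : V →ₗ[ℝ] (s → ℝ) := (LinearMap.funLeft ℝ ℝ (fun ρ : s => (ρ : ℝ))).comp M
    have hker : LinearMap.ker ev ≠ ⊥ := by
      apply LinearMap.ker_ne_bot_of_finrank_lt
      rw [Module.finrank_fintype_fun_eq_card, Fintype.card_coe]
      lia
    obtain ⟨c₀, hc₀, hne⟩ := Submodule.exists_mem_ne_zero_of_ne_bot hker
    have hzero : ∀ ρ ∈ s, M c₀ ρ = 0 := fun ρ hρ => congrFun (LinearMap.mem_ker.1 hc₀) ⟨ρ, hρ⟩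
    have hex : ∃ ρ ∈ J, M c₀ ρ ≠ 0 := by
      by_contra hcon
      push Not at hcon
      exact hne (hM c₀ hcon)
    obtain ⟨ρ₁, hρ₁, hM₁⟩ := hex
    have hnot : ρ₁ ∉ s := fun h => hM₁ (hzero ρ₁ h)
    refine ⟨insert ρ₁ s, ?_, by rw [Finset.card_insert_of_notMem hnot, hcard], fun v => ?_⟩
    · rw [Finset.coe_insert]
      exact insert_subset hρ₁ hsJ
    · obtain ⟨c, hc⟩ := hs v
      refine ⟨c + ((v ρ₁ - M c ρ₁) / M c₀ ρ₁) • c₀, fun ρ hρ => ?_⟩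
      rw [map_add, map_smul, Pi.add_apply, Pi.smul_apply, smul_eq_mul]
      rcases Finset.mem_insert.1 hρ with rfl | h
      · field_simp
        ring
      · rw [hzero ρ h, hc ρ h, mul_zero, add_zero]

/-- One-dimensional Sard: the set of critical values is null, so it cannot contain an interval. -/
theorem exists_regular_value {f : ℝ → ℝ} {s : Set ℝ} (hf : ∀ x ∈ s, DifferentiableAt ℝ f x)
    {u v : ℝ} (huv : u < v) : ∃ y ∈ Ioo u v, ∀ x ∈ s, f x = y → deriv f x ≠ 0 := by
  have hnull : volume (f '' {x ∈ s | deriv f x = 0}) = 0 := by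
    refine addHaar_image_eq_zero_of_det_fderivWithin_eq_zero volume
      (f' := fun x => ContinuousLinearMap.toSpanSingleton ℝ (deriv f x))
      (fun x hx => (hf x hx.1).hasDerivAt.hasFDerivAt.hasFDerivWithinAt) fun x hx => ?_
    rw [hx.2]
    simp [ContinuousLinearMap.det]
  by_contra hcon
  push Not at hcon
  have hsub : Ioo u v ⊆ f '' {x ∈ s | deriv f x = 0} := by
    intro y hy
    obtain ⟨x, hx, hxy, hd⟩ := hcon y hy
    exact ⟨x, ⟨hx, hd⟩, hxy⟩
  have := measure_mono_null hsub hnull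
  rw [Real.volume_Ioo, ENNReal.ofReal_eq_zero] at this
  linarith

/-- A space of functions of dimension `k + 1` that contains the constants has an element with `k`
simple zeros. -/
theorem exists_simple_zeros {V : Type*} [AddCommGroup V] [Module ℝ V] [FiniteDimensional ℝ V]
    (M : V →ₗ[ℝ] ℝ → ℝ) {a b : ℝ} (hM : ∀ c, (∀ ρ ∈ Ioo a b, M c ρ = 0) → c = 0)
    (hdiff : ∀ c, ∀ ρ ∈ Ioo a b, DifferentiableAt ℝ (M c) ρ) {c₁ : V} (hone : ∀ ρ, M c₁ ρ = 1)
    {k : ℕ} (hk : k + 1 = Module.finrank ℝ V) :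
    ∃ (c : V) (r : Fin k → ℝ), Function.Injective r ∧
      ∀ j, r j ∈ Ioo a b ∧ M c (r j) = 0 ∧ deriv (M c) (r j) ≠ 0 := by
  obtain ⟨s, hsJ, hcard, hs⟩ := exists_interpolation M hM (k + 1) hk.le
  let o := s.orderEmbOfFin hcard
  have hos : ∀ j, o j ∈ s := fun j => Finset.orderEmbOfFin_mem s hcard j
  -- The alternating values force every level `y ∈ (-1, 1)` to be attained between any two
  -- consecutive nodes.
  obtain ⟨c, hc⟩ := hs (Function.extend o (fun j => (-1 : ℝ) ^ (j : ℕ)) 0)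
  have hval : ∀ j, M c (o j) = (-1) ^ (j : ℕ) := fun j => by
    rw [hc _ (hos j), o.injective.extend_apply]
  obtain ⟨y, hy, hreg⟩ := exists_regular_value (hdiff c) (show (-1 : ℝ) < 1 by norm_num)
  have hMy : M (c - y • c₁) = fun ρ => M c ρ - y := by
    ext ρ
    rw [map_sub, map_smul, Pi.sub_apply, Pi.smul_apply, hone, smul_eq_mul, mul_one]
  have hroot : ∀ j : Fin k, ∃ ρ ∈ Ioo (o j.castSucc) (o j.succ), M c ρ = y := by
    intro j
    have hlt : o j.castSucc < o j.succ := o.strictMono Fin.castSucc_lt_succ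
    have hsub : Icc (o j.castSucc) (o j.succ) ⊆ Ioo a b := fun x hx =>
      ⟨(hsJ (hos _)).1.trans_le hx.1, hx.2.trans_lt (hsJ (hos _)).2⟩
    have hcont : ContinuousOn (M c) (Icc (o j.castSucc) (o j.succ)) := fun x hx =>
      (hdiff c x (hsub hx)).continuousAt.continuousWithinAt
    have h1 := hval j.castSucc
    have h2 := hval j.succ
    rw [Fin.val_castSucc] at h1
    rw [Fin.val_succ, pow_succ] at h2
    rcases neg_one_pow_eq_or ℝ (j : ℕ) with h | h
    · rw [h] at h1 h2
      exact intermediate_value_Ioo' hlt.le hcont ⟨by rw [h2]; linarith [hy.1], by rw [h1]; exact hy.2⟩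
    · rw [h] at h1 h2
      exact intermediate_value_Ioo hlt.le hcont ⟨by rw [h1]; exact hy.1, by rw [h2]; linarith [hy.2]⟩
  choose r hr hry using hroot
  have hrJ : ∀ j, r j ∈ Ioo a b := fun j =>
    ⟨(hsJ (hos j.castSucc)).1.trans (hr j).1, (hr j).2.trans (hsJ (hos j.succ)).2⟩
  refine ⟨c - y • c₁, r, ?_, fun j => ⟨hrJ j, ?_, ?_⟩⟩
  · refine StrictMono.injective (f := r) fun i j hij => ?_
    have h1 : o i.succ ≤ o j.castSucc := o.monotone (by
      rw [Fin.le_def, Fin.val_succ, Fin.val_castSucc]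
      exact hij)
    exact ((hr i).2.trans_le h1).trans (hr j).1
  · rw [hMy]
    exact sub_eq_zero.2 (hry j)
  · rw [hMy, deriv_sub_const]
    exact hreg _ (hrJ j) (hry j)

/-! ### The logarithm is not a rational function -/

open Polynomial in
theorem eq_zero_of_eval_eq_mul_log {a b : ℝ} (ha : 0 ≤ a) (hab : a < b) (hb : b ≤ 1) (A B : ℝ[X])
    (h : ∀ ρ ∈ Ioo a b, A.eval ρ = B.eval ρ * (Real.log (1 + ρ) - Real.log (1 - ρ))) : B = 0 := by
  induction hd : B.natDegree using Nat.strong_induction_on generalizing A B with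
  | _ d ih =>
  by_contra hB
  have hinf : (Ioo a b).Infinite := Ioo_infinite hab
  -- This is `(A / B)' = 2 / (1 - ρ²)` cleared of denominators. It forces `B(1) = 0`. If also `A(1)
  -- = 0`, the common factor cancels and the degree drops.
  have hid : (1 - X ^ 2) * (derivative A * B - A * derivative B) = 2 * B ^ 2 := by
    refine eq_of_infinite_eval_eq _ _ (hinf.mono fun ρ hρ => ?_)
    have h1 : 0 < 1 + ρ := by linarith [hρ.1]
    have h2 : 0 < 1 - ρ := by linarith [hρ.2]
    have hd1 : HasDerivAt (fun ρ : ℝ => Real.log (1 + ρ)) (1 / (1 + ρ)) ρ :=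
      ((hasDerivAt_id' ρ).const_add 1).log h1.ne'
    have hd2 : HasDerivAt (fun ρ : ℝ => Real.log (1 - ρ)) (-1 / (1 - ρ)) ρ :=
      ((hasDerivAt_id' ρ).const_sub 1).log h2.ne'
    have hd3 := (B.hasDerivAt ρ).mul (hd1.sub hd2)
    have hd4 : HasDerivAt (fun x => A.eval x) _ ρ := hd3.congr_of_eventuallyEq (by
      filter_upwards [Ioo_mem_nhds hρ.1 hρ.2] with x hx using h x hx)
    have heq := (A.hasDerivAt ρ).unique hd4
    simp only [Pi.sub_apply] at heq
    have hv := h ρ hρ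
    simp only [mem_ofPred_eq, eval_mul, eval_sub, eval_one, eval_pow, eval_X, eval_ofNat]
    set ℓ := Real.log (1 + ρ) - Real.log (1 - ρ)
    rw [heq, hv]
    have h3 : (1 - ρ ^ 2) * (1 / (1 + ρ) - -1 / (1 - ρ)) = 2 := by
      field_simp
      ring
    linear_combination (eval ρ B) ^ 2 * h3
  have hB1 : B.eval 1 = 0 := by
    have := congrArg (eval 1) hid
    simp only [eval_mul, eval_sub, eval_one, eval_pow, eval_X, eval_ofNat] at this
    have h0 : (eval 1 B) ^ 2 = 0 := by linarith
    exact pow_eq_zero_iff two_ne_zero |>.1 h0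
  by_cases hA1 : A.eval 1 = 0
  · obtain ⟨A₁, hA₁⟩ := dvd_iff_isRoot.2 (show A.IsRoot 1 from hA1)
    obtain ⟨B₁, hB₁⟩ := dvd_iff_isRoot.2 (show B.IsRoot 1 from hB1)
    have hB₁0 : B₁ ≠ 0 := by
      rintro rfl
      exact hB (by rw [hB₁, mul_zero])
    refine hB₁0 (ih B₁.natDegree ?_ A₁ B₁ (fun ρ hρ => ?_) rfl)
    · rw [← hd, hB₁, natDegree_mul (X_sub_C_ne_zero 1) hB₁0, natDegree_X_sub_C]
      lia
    · have h1 := h ρ hρ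
      rw [hA₁, hB₁] at h1
      simp only [eval_mul, eval_sub, eval_X, eval_C] at h1
      have h2 : ρ - 1 ≠ 0 := by linarith [hρ.2]
      rw [mul_assoc] at h1
      exact mul_left_cancel₀ h2 h1
  · obtain ⟨q, hq, hndvd⟩ := B.exists_eq_pow_rootMultiplicity_mul_and_not_dvd hB 1
    have hq1 : q.eval 1 ≠ 0 := fun h0 => hndvd (dvd_iff_isRoot.2 h0)
    obtain ⟨k, hk⟩ := Nat.exists_eq_succ_of_ne_zero
      ((rootMultiplicity_pos hB).2 (show B.IsRoot 1 from hB1)).ne'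
    rw [hk, Nat.succ_eq_add_one] at hq
    have hder : derivative B = (X - C 1) ^ k * ((k + 1 : ℝ[X]) * q + (X - C 1) * derivative q) := by
      rw [hq, derivative_mul, derivative_X_sub_C_pow, Nat.add_sub_cancel,
        pow_succ]
      simp only [Nat.cast_add, Nat.cast_one, map_add, map_natCast, map_one]
      ring
    -- Orders of vanishing at `1`: if `B` has order `k + 1` and `A(1) ≠ 0`, the left side of `hid`
    -- has order exactly `k + 1` and the right side `2k + 2`.
    have hprod : (X - C 1) ^ (k + 1) * ((1 + X) * (A * ((k + 1 : ℝ[X]) * q + (X - C 1) * derivative q)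
        - (X - C 1) * (derivative A * q)) - 2 * ((X - C 1) ^ (k + 1) * q ^ 2)) = 0 := by
      have h1 : B ^ 2 = (X - C 1) ^ (k + 1) * ((X - C 1) ^ (k + 1) * q ^ 2) := by
        rw [hq]; ring
      rw [h1, hder] at hid
      have h2 : derivative A * B = (X - C 1) ^ k * ((X - C 1) * (derivative A * q)) := by
        rw [hq]; ring
      rw [h2] at hid
      have h3 : (1 - X ^ 2 : ℝ[X]) = -((X - C 1) * (1 + X)) := by
        rw [map_one]; ring
      rw [h3] at hid
      rw [mul_sub, sub_eq_zero]
      linear_combination hid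
    have hfac := (mul_eq_zero.1 hprod).resolve_left (pow_ne_zero _ (X_sub_C_ne_zero 1))
    have heval := congrArg (eval 1) hfac
    simp only [eval_mul, eval_sub, eval_add, eval_one, eval_pow, eval_X, eval_C, eval_ofNat,
      eval_natCast, sub_self, zero_mul, add_zero, sub_zero, eval_zero, mul_zero, ne_eq,
      Nat.add_eq_zero_iff, one_ne_zero, and_false, not_false_eq_true, zero_pow] at heval
    have hk0 : (k : ℝ) + 1 ≠ 0 := by positivity
    have : (1 + 1 : ℝ) * (eval 1 A * ((k + 1) * eval 1 q)) ≠ 0 :=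
      mul_ne_zero (by norm_num) (mul_ne_zero hA1 (mul_ne_zero hk0 hq1))
    exact this heval

end PiecewiseHam


namespace PiecewiseHam

open Set Filter Topology MeasureTheory

/-! ### Polynomial perturbations -/

/-- The polynomial functions of degree at most `n`. -/
def polySpace (n : ℕ) : Submodule ℝ (ℝ × ℝ → ℝ) :=
  Submodule.span ℝ {f | ∃ i j, i + j ≤ n ∧ f = fun z => z.1 ^ i * z.2 ^ j}

theorem monomial_mem_polySpace {n i j : ℕ} (h : i + j ≤ n) :
    (fun z : ℝ × ℝ => z.1 ^ i * z.2 ^ j) ∈ polySpace n :=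
  Submodule.subset_span ⟨i, j, h, rfl⟩

theorem polySpace_mono {m n : ℕ} (h : m ≤ n) : polySpace m ≤ polySpace n :=
  Submodule.span_mono fun _ ⟨i, j, hij, hf⟩ => ⟨i, j, hij.trans h, hf⟩

theorem mul_mem_polySpace {m n : ℕ} {f g : ℝ × ℝ → ℝ} (hf : f ∈ polySpace m)
    (hg : g ∈ polySpace n) : f * g ∈ polySpace (m + n) := by
  have h := Submodule.mul_mem_mul hf hg
  rw [polySpace, polySpace, Submodule.span_mul_span] at h
  refine Submodule.span_mono ?_ h
  rintro _ ⟨_, ⟨i, j, hij, rfl⟩, _, ⟨k, l, hkl, rfl⟩, rfl⟩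
  refine ⟨i + k, j + l, by lia, ?_⟩
  ext z
  simp only [Pi.mul_apply]
  ring

theorem pow_mem_polySpace {m : ℕ} {f : ℝ × ℝ → ℝ} (hf : f ∈ polySpace m) (k : ℕ) :
    f ^ k ∈ polySpace (m * k) := by
  induction k with
  | zero => simpa [Pi.one_def] using monomial_mem_polySpace (n := 0) (i := 0) (j := 0) le_rfl
  | succ k ih =>
    rw [pow_succ, mul_add, mul_one]
    exact mul_mem_polySpace ih hf

theorem exists_poly_eq {n : ℕ} {f : ℝ × ℝ → ℝ} (hf : f ∈ polySpace n) : ∃ c, poly n c = f := by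
  induction hf using Submodule.span_induction with
  | mem f hf =>
    obtain ⟨i, j, hij, rfl⟩ := hf
    refine ⟨fun i' j' => if i' = i ∧ j' = j then 1 else 0, funext fun z => ?_⟩
    rw [poly, Finset.sum_eq_single (i + j), Finset.sum_eq_single (i, j)]
    · simp
    · rintro ⟨i', j'⟩ - hne
      rw [if_neg (by simpa using hne)]
      ring
    · intro h
      simp at h
    · intro l _ hl
      refine Finset.sum_eq_zero fun ij hij' => ?_
      rw [if_neg, zero_mul, zero_mul]
      rintro ⟨h₁, h₂⟩
      rw [Finset.HasAntidiagonal.mem_antidiagonal, h₁, h₂] at hij'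
      exact hl hij'.symm
    · intro h
      exact absurd (Finset.mem_range.2 (by lia)) h
  | zero => exact ⟨0, funext fun z => by simp [poly]⟩
  | add f g _ _ hf hg =>
    obtain ⟨c, rfl⟩ := hf
    obtain ⟨d, rfl⟩ := hg
    refine ⟨c + d, funext fun z => ?_⟩
    simp [poly, add_mul, Finset.sum_add_distrib]
  | smul t f _ hf =>
    obtain ⟨c, rfl⟩ := hf
    refine ⟨t • c, funext fun z => ?_⟩
    simp [poly, Finset.mul_sum, mul_assoc]

theorem contDiff_poly (n : ℕ) (c : ℕ → ℕ → ℝ) : ContDiff ℝ 1 (poly n c) := by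
  unfold poly
  fun_prop

theorem poly_zero (n : ℕ) (z : ℝ × ℝ) : poly n 0 z = 0 := by simp [poly]

/-- The perturbation in the left half plane. -/
def leftPert {m : ℕ} (a : Fin m → ℝ) (z : ℝ × ℝ) : ℝ := ∑ i, a i * z.1 ^ (i : ℕ)

/-- The perturbation in the right half plane, adapted to the Hamiltonian `((x - 1)² - y²) / 2`. -/
def rightPert {m : ℕ} (b : Fin m → ℝ) (z : ℝ × ℝ) : ℝ :=
  ∑ j, b j * ((1 - z.1) * ((1 - z.1) ^ 2 - z.2 ^ 2) ^ (j : ℕ))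

theorem leftPert_mem {n : ℕ} (a : Fin (n + 1) → ℝ) : leftPert a ∈ polySpace n := by
  have : leftPert a = ∑ i, a i • fun z : ℝ × ℝ => z.1 ^ (i : ℕ) * z.2 ^ 0 := by
    ext z
    simp [leftPert, Finset.sum_apply]
  rw [this]
  exact Submodule.sum_mem _ fun i _ => Submodule.smul_mem _ _ (monomial_mem_polySpace (by lia))

/-- The `j`-th term has degree `2j + 1`, which is at most `n` exactly for `j < (n + 1) / 2`. -/
theorem rightPert_mem {n : ℕ} (b : Fin ((n + 1) / 2) → ℝ) : rightPert b ∈ polySpace n := by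
  have hx : (fun z : ℝ × ℝ => 1 - z.1) ∈ polySpace 1 := by
    have h := Submodule.sub_mem _ (monomial_mem_polySpace (n := 1) (i := 0) (j := 0) (by lia))
      (monomial_mem_polySpace (n := 1) (i := 1) (j := 0) (by lia))
    convert h using 1
    ext z
    simp
  have hH : (fun z : ℝ × ℝ => (1 - z.1) ^ 2 - z.2 ^ 2) ∈ polySpace 2 := by
    have h := Submodule.sub_mem _ (pow_mem_polySpace hx 2)
      (monomial_mem_polySpace (n := 1 * 2) (i := 0) (j := 2) (by lia))
    convert h using 1
    ext z
    simp
  have : rightPert b = ∑ j, b j • ((fun z : ℝ × ℝ => 1 - z.1) *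
      (fun z : ℝ × ℝ => (1 - z.1) ^ 2 - z.2 ^ 2) ^ (j : ℕ)) := by
    ext z
    simp [rightPert, Finset.sum_apply]
  rw [this]
  exact Submodule.sum_mem _ fun j _ => Submodule.smul_mem _ _
    (polySpace_mono (by lia) (mul_mem_polySpace hx (pow_mem_polySpace hH j)))

/-! ### The Melnikov function -/

/-- The integral of `√(1 - ρ² + ρ² s²)` over `[-1, 1]`. -/
noncomputable def saddleIntegral (ρ : ℝ) : ℝ :=
  1 + (1 - ρ ^ 2) / (2 * ρ) * (Real.log (1 + ρ) - Real.log (1 - ρ))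

theorem integral_sqrt_eq_saddleIntegral {ρ : ℝ} (h₀ : 0 < ρ) (h₁ : ρ < 1) :
    ∫ s in (-1 : ℝ)..1, √(1 - ρ ^ 2 + ρ ^ 2 * s ^ 2) = saddleIntegral ρ := by
  have hE : 0 < 1 - ρ ^ 2 := by nlinarith
  have hpos : ∀ s : ℝ, 0 < 1 - ρ ^ 2 + ρ ^ 2 * s ^ 2 := fun s => by positivity
  have hlog : ∀ s : ℝ, 0 < ρ * s + √(1 - ρ ^ 2 + ρ ^ 2 * s ^ 2) := by
    intro s
    have : |ρ * s| < √(1 - ρ ^ 2 + ρ ^ 2 * s ^ 2) := by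
      rw [← Real.sqrt_sq_eq_abs]
      exact Real.sqrt_lt_sqrt (sq_nonneg _) (by nlinarith)
    linarith [neg_abs_le (ρ * s)]
  have hderiv : ∀ s ∈ uIcc (-1 : ℝ) 1, HasDerivAt (fun s => (ρ * s * √(1 - ρ ^ 2 + ρ ^ 2 * s ^ 2) +
      (1 - ρ ^ 2) * Real.log (ρ * s + √(1 - ρ ^ 2 + ρ ^ 2 * s ^ 2))) / (2 * ρ))
      (√(1 - ρ ^ 2 + ρ ^ 2 * s ^ 2)) s := by
    intro s _
    have hin : HasDerivAt (fun s : ℝ => 1 - ρ ^ 2 + ρ ^ 2 * s ^ 2) (ρ ^ 2 * (2 * s)) s := by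
      simpa using ((hasDerivAt_pow 2 s).const_mul (ρ ^ 2)).const_add (1 - ρ ^ 2)
    have hw := hin.sqrt (hpos s).ne'
    have hy : HasDerivAt (fun s : ℝ => ρ * s) ρ s := by
      simpa using (hasDerivAt_id' s).const_mul ρ
    have h := ((hy.fun_mul hw).fun_add (((hy.fun_add hw).log (hlog s).ne').const_mul (1 - ρ ^ 2))).div_const
      (2 * ρ)
    refine h.congr_deriv ?_
    have hsq := Real.sq_sqrt (hpos s).le
    have hw0 := Real.sqrt_pos.2 (hpos s)
    have hl := hlog s
    set w := √(1 - ρ ^ 2 + ρ ^ 2 * s ^ 2) with hwdef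
    have hE' : 1 - ρ ^ 2 = w ^ 2 - ρ ^ 2 * s ^ 2 := by rw [hsq]; ring
    rw [hE']
    field_simp
    ring
  rw [intervalIntegral.integral_eq_sub_of_hasDerivAt hderiv
    (Continuous.intervalIntegrable (by fun_prop) _ _), saddleIntegral]
  have e1 : √(1 - ρ ^ 2 + ρ ^ 2 * 1 ^ 2) = 1 := by norm_num
  have e2 : √(1 - ρ ^ 2 + ρ ^ 2 * (-1) ^ 2) = 1 := by norm_num
  rw [e1, e2, show ρ * 1 + 1 = 1 + ρ by ring, show ρ * -1 + 1 = 1 - ρ by ring]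
  field_simp
  ring

theorem differentiableAt_saddleIntegral {ρ : ℝ} (h₀ : 0 < ρ) (h₁ : ρ < 1) :
    DifferentiableAt ℝ saddleIntegral ρ := by
  unfold saddleIntegral
  have h1 : (1 : ℝ) + ρ ≠ 0 := by linarith
  have h2 : (1 : ℝ) - ρ ≠ 0 := by linarith
  have h3 : 2 * ρ ≠ 0 := by linarith
  fun_prop (disch := assumption)

/-- The cosine keeps its sign on the left half circle. The left Melnikov coefficients can therefore
be prescribed by dividing by these integrals. -/
theorem integral_cos_pow_succ_ne_zero (i : ℕ) :
    ∫ s in (Real.pi / 2)..(3 * Real.pi / 2), Real.cos s ^ (i + 1) ≠ 0 := by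
  have hlt : Real.pi / 2 < 3 * Real.pi / 2 := by linarith [Real.pi_pos]
  have h : 0 < ∫ s in (Real.pi / 2)..(3 * Real.pi / 2), (-Real.cos s) ^ (i + 1) := by
    refine intervalIntegral.intervalIntegral_pos_of_pos_on
      (Continuous.intervalIntegrable (by fun_prop) _ _) (fun s hs => ?_) hlt
    refine pow_pos (neg_pos.2 (Real.cos_neg_of_pi_div_two_lt_of_lt hs.1 ?_)) _
    linarith [hs.2]
  intro h0
  simp_rw [neg_pow (Real.cos _), intervalIntegral.integral_const_mul, h0, mul_zero] at h
  exact h.false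

theorem integral_leftPert {m : ℕ} (a : Fin m → ℝ) (ρ : ℝ) :
    ∫ s in (Real.pi / 2)..(3 * Real.pi / 2), Real.cos s * leftPert a (leftChart s ρ) =
      ∑ i, a i * (∫ s in (Real.pi / 2)..(3 * Real.pi / 2), Real.cos s ^ ((i : ℕ) + 1)) *
        ρ ^ (i : ℕ) := by
  simp only [leftPert, leftChart, Finset.mul_sum]
  rw [intervalIntegral.integral_finsetSum fun i _ =>
    Continuous.intervalIntegrable (by fun_prop) _ _]
  refine Finset.sum_congr rfl fun i _ => ?_
  rw [mul_right_comm, ← intervalIntegral.integral_const_mul]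
  congr 1
  ext s
  ring

/-- Along the level `ρ` the factor `(1 - x)² - y²` is the constant `1 - ρ²`, so only `1 - x`, the
square root, remains to be integrated. -/
theorem integral_rightPert {m : ℕ} (b : Fin m → ℝ) {ρ : ℝ} (h₀ : 0 < ρ) (h₁ : ρ < 1) :
    ∫ s in (-1 : ℝ)..1, 1 * rightPert b (rightChart s ρ) =
      ∑ j, b j * ((1 - ρ ^ 2) ^ (j : ℕ) * saddleIntegral ρ) := by
  have hE : 0 < 1 - ρ ^ 2 := by nlinarith
  have hfun : ∀ s : ℝ, 1 * rightPert b (rightChart s ρ) =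
      (∑ j, b j * (1 - ρ ^ 2) ^ (j : ℕ)) * √(1 - ρ ^ 2 + ρ ^ 2 * s ^ 2) := by
    intro s
    have hs : 0 ≤ 1 - ρ ^ 2 + ρ ^ 2 * s ^ 2 := by positivity
    simp only [rightPert, rightChart, one_mul, Finset.sum_mul, sub_sub_cancel, Real.sq_sqrt hs]
    refine Finset.sum_congr rfl fun j _ => ?_
    rw [show 1 - ρ ^ 2 + ρ ^ 2 * s ^ 2 - (ρ * s) ^ 2 = 1 - ρ ^ 2 by ring]
    ring
  simp_rw [hfun]
  rw [intervalIntegral.integral_const_mul, integral_sqrt_eq_saddleIntegral h₀ h₁, Finset.sum_mul]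
  exact Finset.sum_congr rfl fun j _ => by ring

/-- The Melnikov function, as a function of its coefficients. -/
noncomputable def melnikov (m k : ℕ) : (Fin m ⊕ Fin k → ℝ) →ₗ[ℝ] ℝ → ℝ where
  toFun c ρ := ∑ i, c (.inl i) * ρ ^ (i : ℕ) +
    ∑ j, c (.inr j) * ((1 - ρ ^ 2) ^ (j : ℕ) * saddleIntegral ρ)
  map_add' c d := by
    ext ρ
    simp only [Pi.add_apply, add_mul, Finset.sum_add_distrib]
    ring
  map_smul' t c := by
    ext ρ
    simp only [Pi.smul_apply, smul_eq_mul, RingHom.id_apply, mul_add, Finset.mul_sum, mul_assoc]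

theorem melnikov_apply {m k : ℕ} (c : Fin m ⊕ Fin k → ℝ) (ρ : ℝ) :
    melnikov m k c ρ = ∑ i, c (.inl i) * ρ ^ (i : ℕ) +
      ∑ j, c (.inr j) * ((1 - ρ ^ 2) ^ (j : ℕ) * saddleIntegral ρ) := rfl

open Polynomial in
theorem eq_zero_of_sum_mul_X_pow_eq_zero {m : ℕ} {a : Fin m → ℝ}
    (h : ∑ i, C (a i) * X ^ (i : ℕ) = (0 : ℝ[X])) (i : Fin m) : a i = 0 := by
  have := congrArg (fun P : ℝ[X] => P.coeff i) h
  simpa [Polynomial.finsetSum_coeff, Polynomial.coeff_C_mul, Polynomial.coeff_X_pow, Fin.val_inj]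
    using this

open Polynomial in
theorem eq_zero_of_forall_mem_Ioo_eval_eq_zero {a b : ℝ} (hab : a < b) {P : ℝ[X]}
    (h : ∀ x ∈ Ioo a b, P.eval x = 0) : P = 0 :=
  Polynomial.eq_zero_of_infinite_isRoot P ((Ioo_infinite hab).mono h)

open Polynomial in
-- Multiplication by `2ρ` turns the relation into a polynomial equal to `T(1 - ρ²) (1 - ρ²)` times
-- the logarithm. Irrationality of the logarithm kills `T`, and then the polynomial part `Q`.
theorem eq_zero_of_melnikov_eq_zero {m k : ℕ} {a b : ℝ} (ha : 0 ≤ a) (hab : a < b) (hb : b ≤ 1)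
    {c : Fin m ⊕ Fin k → ℝ} (h : ∀ ρ ∈ Ioo a b, melnikov m k c ρ = 0) : c = 0 := by
  let Q : ℝ[X] := ∑ i, C (c (.inl i)) * X ^ (i : ℕ)
  let T : ℝ[X] := ∑ j, C (c (.inr j)) * X ^ (j : ℕ)
  have hQ : ∀ ρ, Q.eval ρ = ∑ i, c (.inl i) * ρ ^ (i : ℕ) := fun ρ => by
    simp [Q, Polynomial.eval_finsetSum]
  have hT : ∀ ρ, T.eval ρ = ∑ j, c (.inr j) * ρ ^ (j : ℕ) := fun ρ => by
    simp [T, Polynomial.eval_finsetSum]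
  have hM : ∀ ρ, melnikov m k c ρ = Q.eval ρ + T.eval (1 - ρ ^ 2) * saddleIntegral ρ := fun ρ => by
    rw [melnikov_apply, hQ, hT, Finset.sum_mul]
    congr 1
    exact Finset.sum_congr rfl fun j _ => by ring
  have hS : T.comp (1 - X ^ 2) * (1 - X ^ 2) = 0 := by
    refine eq_zero_of_eval_eq_mul_log ha hab hb (-(2 * X * (Q + T.comp (1 - X ^ 2)))) _ ?_
    intro ρ hρ
    have hρ0 : 0 < ρ := ha.trans_lt hρ.1
    have h0 := h ρ hρ
    rw [hM, saddleIntegral] at h0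
    simp only [eval_neg, eval_mul, eval_ofNat, eval_X, eval_add, eval_comp, eval_sub, eval_one,
      eval_pow]
    field_simp at h0
    linear_combination (-1 : ℝ) * h0
  have hX : (1 - X ^ 2 : ℝ[X]) ≠ 0 := fun hX => by simpa using congrArg (Polynomial.eval 0) hX
  have hcomp : T.comp (1 - X ^ 2) = 0 := (mul_eq_zero.1 hS).resolve_right hX
  have hT0 : T = 0 := by
    refine eq_zero_of_forall_mem_Ioo_eval_eq_zero zero_lt_one fun y hy => ?_
    have := congrArg (Polynomial.eval √(1 - y)) hcomp
    simpa [eval_comp, Real.sq_sqrt (sub_nonneg.2 hy.2.le)] using this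
  have hQ0 : Q = 0 := by
    refine eq_zero_of_forall_mem_Ioo_eval_eq_zero hab fun ρ hρ => ?_
    simpa [hM, hT0] using h ρ hρ
  funext x
  rcases x with i | j
  · exact eq_zero_of_sum_mul_X_pow_eq_zero hQ0 i
  · exact eq_zero_of_sum_mul_X_pow_eq_zero hT0 j

end PiecewiseHam


namespace PiecewiseHam

open Set Filter Topology MeasureTheory

/-! ### Bifurcation of limit cycles -/

theorem eventually_exists_limitCycle_of_melnikov {n k : ℕ} {c : Fin n ⊕ Fin k → ℝ} {r a b δ : ℝ}
    {U : Set (ℝ × ℝ)} (ha : 0 ≤ a) (hb : b ≤ 1)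
    (hleft : ∀ ρ ∈ Ioo a b, ∀ s ∈ Icc (Real.pi / 2) (3 * Real.pi / 2), leftChart s ρ ∈ U)
    (hright : ∀ ρ ∈ Ioo a b, ∀ s ∈ Icc (-1 : ℝ) 1, rightChart s ρ ∈ U)
    (hr : r ∈ Ioo a b) (hzero : melnikov n k c r = 0) (hsimple : deriv (melnikov n k c) r ≠ 0)
    {p q : ℝ × ℝ → ℝ} (hp : ContDiff ℝ 1 p) (hq : ContDiff ℝ 1 q)
    (hpc : p = rightPert fun j => c (.inr j))
    (hqc : q = leftPert fun i : Fin n => c (.inl i) /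
      ∫ s in (Real.pi / 2)..(3 * Real.pi / 2), Real.cos s ^ ((i : ℕ) + 1))
    (hδ : 0 < δ) :
    ∀ᶠ e in 𝓝[>] (0 : ℝ), ∃ Γ, IsLimitCycle (fun z => (-z.2 + e * p z, 1 - z.1))
      (fun z => (-z.2 + e * q z, z.1)) Γ ∧ Γ ⊆ U ∧ ∃ ρ, |ρ - r| < δ ∧ 0 < ρ ∧ (0, ρ) ∈ Γ := by
  have hr0 : 0 < r := ha.trans_lt hr.1
  have hr1 : r < 1 := hr.2.trans_le hb
  let V : Set (ℝ × ℝ) := U ∩ {z | z.1 < 1}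
  have hJ : Ioo a b ∈ 𝓝 r := Ioo_mem_nhds hr.1 hr.2
  have hVleft : ∀ ρ ∈ Ioo a b, ∀ s ∈ Icc (Real.pi / 2) (3 * Real.pi / 2), leftChart s ρ ∈ V := by
    refine fun ρ hρ s hs => ⟨hleft ρ hρ s hs, ?_⟩
    have : ρ * Real.cos s ≤ ρ * 1 :=
      mul_le_mul_of_nonneg_left (Real.cos_le_one s) (ha.trans hρ.1.le)
    simp only [leftChart, mem_ofPred_eq]
    linarith [hρ.2]
  have hVright : ∀ ρ ∈ Ioo a b, ∀ s ∈ Icc (-1 : ℝ) 1, rightChart s ρ ∈ V := by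
    refine fun ρ hρ s hs => ⟨hright ρ hρ s hs, ?_⟩
    have h0 : 0 < ρ := ha.trans_lt hρ.1
    have h1 : ρ < 1 := hρ.2.trans_le hb
    have hE : 0 < 1 - ρ ^ 2 := by nlinarith
    have : 0 < √(1 - ρ ^ 2 + ρ ^ 2 * s ^ 2) := Real.sqrt_pos.2 (by positivity)
    simp only [rightChart, mem_ofPred_eq]
    linarith
  have hL : (fun ρ => ∫ s in (Real.pi / 2)..(3 * Real.pi / 2), Real.cos s * q (leftChart s ρ)) =
      fun ρ => ∑ i : Fin n, c (.inl i) * ρ ^ (i : ℕ) := by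
    ext ρ
    rw [hqc, integral_leftPert]
    exact Finset.sum_congr rfl fun i _ => by
      rw [div_mul_cancel₀ _ (integral_cos_pow_succ_ne_zero i)]
  have hR : (fun ρ => ∫ s in (-1 : ℝ)..1, 1 * p (rightChart s ρ)) =ᶠ[𝓝 r]
      fun ρ => ∑ j : Fin k, c (.inr j) * ((1 - ρ ^ 2) ^ (j : ℕ) * saddleIntegral ρ) := by
    filter_upwards [Ioo_mem_nhds hr0 hr1] with ρ hρ
    rw [hpc, integral_rightPert _ hρ.1 hρ.2]
  have hLd : DifferentiableAt ℝ (fun ρ => ∑ i : Fin n, c (.inl i) * ρ ^ (i : ℕ)) r := by fun_prop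
  have hRd : DifferentiableAt ℝ
      (fun ρ => ∑ j : Fin k, c (.inr j) * ((1 - ρ ^ 2) ^ (j : ℕ) * saddleIntegral ρ)) r := by
    have := differentiableAt_saddleIntegral hr0 hr1
    fun_prop
  refine (eventually_exists_limitCycle (V := V) hp hq hr0 (fun z hz => hz.2)
    (isHalfMap_left hq hr0 hJ hVleft (by rw [hL]; exact hLd.hasDerivAt))
    (isHalfMap_right hp hr0 hr1 hJ hVright (hRd.hasDerivAt.congr_of_eventuallyEq hR)) ?_ ?_
    hδ).mono fun e ⟨Γ, hΓ, hΓV, hρ⟩ => ⟨Γ, hΓ, hΓV.trans inter_subset_left, hρ⟩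
  · rw [hR.eq_of_nhds, ← hzero, melnikov_apply]
    exact congrArg (· + _) (congrFun hL r)
  · rw [← deriv_fun_add hLd hRd]
    exact hsimple

theorem differentiableAt_melnikov {m k : ℕ} (c : Fin m ⊕ Fin k → ℝ) {ρ : ℝ} (h₀ : 0 < ρ)
    (h₁ : ρ < 1) : DifferentiableAt ℝ (melnikov m k c) ρ := by
  have : melnikov m k c = fun ρ => ∑ i, c (.inl i) * ρ ^ (i : ℕ) +
      ∑ j, c (.inr j) * ((1 - ρ ^ 2) ^ (j : ℕ) * saddleIntegral ρ) := rfl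
  rw [this]
  have := differentiableAt_saddleIntegral h₀ h₁
  fun_prop

theorem exists_separation {k : ℕ} {r : Fin k → ℝ} (hr : Function.Injective r) :
    ∃ δ > 0, ∀ i j ρ, |ρ - r i| < δ → |ρ - r j| < δ → i = j := by
  have h : ∀ᶠ δ in 𝓝[>] (0 : ℝ), ∀ i j, i ≠ j → 2 * δ < |r i - r j| := by
    rw [eventually_all]
    intro i
    rw [eventually_all]
    intro j
    by_cases hij : i = j
    · simp [hij]
    · have hpos : 0 < |r i - r j| / 2 := by
        have := abs_pos.2 (sub_ne_zero.2 fun h => hij (hr h))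
        positivity
      filter_upwards [Ioo_mem_nhdsGT hpos] with δ hδ _
      linarith [hδ.2]
  obtain ⟨δ, hδ, hδ0⟩ := (h.and self_mem_nhdsWithin).exists
  refine ⟨δ, hδ0, fun i j ρ hi hj => ?_⟩
  by_contra hij
  have := abs_sub_le (r i) ρ (r j)
  rw [abs_sub_comm (r i) ρ] at this
  linarith [hδ i j hij]

/-- A cycle crosses the line only once above the origin. Cycles born from different zeros are
thereby distinct. -/
theorem IsLimitCycle.eq_of_mem {R L : ℝ × ℝ → ℝ × ℝ} {Γ : Set (ℝ × ℝ)} (h : IsLimitCycle R L Γ)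
    {ρ ρ' : ℝ} (h₀ : 0 < ρ) (h₀' : 0 < ρ') (hρ : (0, ρ) ∈ Γ) (hρ' : (0, ρ') ∈ Γ) : ρ = ρ' := by
  obtain ⟨-, -, ⟨y₁, y₂, hy₁, -, hΓ⟩, -⟩ := h
  have key : ∀ {x : ℝ}, 0 < x → (0, x) ∈ Γ → x = y₂ := by
    intro x hx hxΓ
    have hmem : ((0 : ℝ), x) ∈ Γ ∩ {z | z.1 = 0} := ⟨hxΓ, rfl⟩
    rw [hΓ] at hmem
    rcases hmem with h | h
    · have h2 : x = y₁ := congrArg Prod.snd h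
      linarith
    · exact congrArg Prod.snd h
  rw [key h₀ hρ, key h₀' hρ']

/-- Simple zeros can be placed in any interval of levels, so it is enough that every neighborhood of
`S` contains all unperturbed orbits with `ρ` in some interval. -/
theorem canBifurcate_of_charts {n : ℕ} {S : Set (ℝ × ℝ)}
    (h : ∀ U ∈ 𝓝ˢ S, ∃ a b : ℝ, 0 ≤ a ∧ a < b ∧ b ≤ 1 ∧
      (∀ ρ ∈ Ioo a b, ∀ s ∈ Icc (Real.pi / 2) (3 * Real.pi / 2), leftChart s ρ ∈ U) ∧
      ∀ ρ ∈ Ioo a b, ∀ s ∈ Icc (-1 : ℝ) 1, rightChart s ρ ∈ U) :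
    CanBifurcate n S (n + (n + 1) / 2) := by
  intro U hU
  obtain ⟨a, b, ha, hab, hb, hleft, hright⟩ := h U hU
  obtain ⟨c, r, hinj, hr⟩ := exists_simple_zeros (k := n + (n + 1) / 2)
    (c₁ := Pi.single (.inl 0) 1) (melnikov (n + 1) ((n + 1) / 2))
    (fun c hc => eq_zero_of_melnikov_eq_zero ha hab hb hc)
    (fun c ρ hρ => differentiableAt_melnikov c (ha.trans_lt hρ.1) (hρ.2.trans_le hb))
    (fun ρ => by
      rw [melnikov_apply, Finset.sum_eq_single 0] <;> simp +contextual)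
    (by simp; lia)
  obtain ⟨δ, hδ, hsep⟩ := exists_separation hinj
  obtain ⟨cp, hcp⟩ := exists_poly_eq (rightPert_mem fun j : Fin ((n + 1) / 2) => c (.inr j))
  obtain ⟨cq, hcq⟩ := exists_poly_eq (leftPert_mem fun i : Fin (n + 1) => c (.inl i) /
      ∫ s in (Real.pi / 2)..(3 * Real.pi / 2), Real.cos s ^ ((i : ℕ) + 1))
  have hev := eventually_all.2 fun j => eventually_exists_limitCycle_of_melnikov ha hb hleft hright
    (hr j).1 (hr j).2.1 (hr j).2.2 (contDiff_poly n cp) (contDiff_poly n cq) hcp hcq hδ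
  obtain ⟨ε₀, hε₀, hsub⟩ := mem_nhdsGT_iff_exists_Ioo_subset.1 hev
  refine ⟨⟨cp, 0, cq, 0⟩, ε₀, hε₀, fun ε hε => ?_⟩
  have hε' := hsub hε
  simp only [mem_ofPred_eq] at hε'
  choose Γ hΓ hΓU ρ hρr hρ0 hρΓ using hε'
  have hfR : rightField n ⟨cp, 0, cq, 0⟩ ε = fun z => (-z.2 + ε * poly n cp z, 1 - z.1) := by
    ext z <;> simp [rightField, poly_zero]
  have hfL : leftField n ⟨cp, 0, cq, 0⟩ ε = fun z => (-z.2 + ε * poly n cq z, z.1) := by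
    ext z <;> simp [leftField, poly_zero]
  have hΓinj : Function.Injective Γ := by
    intro i j hij
    have hρ : ρ i = ρ j := (hΓ i).eq_of_mem (hρ0 i) (hρ0 j) (hρΓ i) (hij ▸ hρΓ j)
    exact hsep i j (ρ i) (hρr i) (hρ ▸ hρr j)
  calc ((n + (n + 1) / 2 : ℕ) : ℕ∞) = (range Γ).encard := by
        rw [← image_univ, hΓinj.encard_image, encard_univ]
        simp
    _ ≤ _ := encard_le_encard (range_subset_iff.2 fun j => by
        refine ⟨?_, hΓU j⟩
        rw [hfR, hfL]
        exact hΓ j)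

/-- By compactness of the parameter intervals, orbits close to the level `ρ₀` stay in `U`. The
charts extend continuously to `ρ₀ = 0`, where they collapse to the origin, and to `ρ₀ = 1`, where
they trace the loop. -/
theorem eventually_charts_mem {S U : Set (ℝ × ℝ)} (hU : U ∈ 𝓝ˢ S) {ρ₀ : ℝ}
    (hleft : ∀ s ∈ Icc (Real.pi / 2) (3 * Real.pi / 2), leftChart s ρ₀ ∈ S)
    (hright : ∀ s ∈ Icc (-1 : ℝ) 1, rightChart s ρ₀ ∈ S) :
    ∀ᶠ ρ in 𝓝 ρ₀, (∀ s ∈ Icc (Real.pi / 2) (3 * Real.pi / 2), leftChart s ρ ∈ U) ∧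
      ∀ s ∈ Icc (-1 : ℝ) 1, rightChart s ρ ∈ U := by
  have key : ∀ {Φ : ℝ → ℝ → ℝ × ℝ}, (Continuous fun z : ℝ × ℝ => Φ z.1 z.2) → ∀ {u v : ℝ},
      (∀ s ∈ Icc u v, Φ s ρ₀ ∈ S) → ∀ᶠ ρ in 𝓝 ρ₀, ∀ s ∈ Icc u v, Φ s ρ ∈ U := by
    intro Φ hΦ u v hS
    refine isCompact_Icc.eventually_forall_of_forall_eventually fun s hs => ?_
    have hc : ContinuousAt (fun z : ℝ × ℝ => Φ z.2 z.1) (ρ₀, s) :=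
      (hΦ.comp continuous_swap).continuousAt
    exact hc (mem_nhdsSet_iff_forall.1 hU _ (hS s hs))
  exact (key continuous_leftChart hleft).and (key continuous_rightChart hright)

theorem canBifurcate_origin (n : ℕ) : CanBifurcate n {(0, 0)} (n + (n + 1) / 2) := by
  refine canBifurcate_of_charts fun U hU => ?_
  have h := eventually_charts_mem hU (ρ₀ := 0) (fun s _ => by simp [leftChart])
    (fun s _ => by simp [rightChart])
  obtain ⟨δ, hδ, hsub⟩ := Metric.eventually_nhds_iff.1 h
  have hd : ∀ ρ ∈ Ioo 0 (min δ 1), dist ρ 0 < δ := fun ρ hρ => by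
    rw [Real.dist_0_eq_abs, abs_of_pos hρ.1]
    exact hρ.2.trans_le (min_le_left _ _)
  exact ⟨0, min δ 1, le_rfl, lt_min hδ one_pos, min_le_right _ _,
    fun ρ hρ => (hsub (hd ρ hρ)).1, fun ρ hρ => (hsub (hd ρ hρ)).2⟩

theorem leftChart_one_mem_homoclinicLoop {s : ℝ} (hs : s ∈ Icc (Real.pi / 2) (3 * Real.pi / 2)) :
    leftChart s 1 ∈ homoclinicLoop := by
  have hsc := Real.sin_sq_add_cos_sq s
  have hcos : Real.cos s ≤ 0 :=
    Real.cos_nonpos_of_pi_div_two_le_of_le hs.1 (by linarith [hs.2])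
  rcases hcos.eq_or_lt with h | h
  · left
    simp only [leftChart, mem_ofPred_eq, one_mul, h] at hsc ⊢
    refine ⟨le_rfl, zero_le_one, ?_⟩
    linarith
  · right
    simp only [leftChart, mem_ofPred_eq, one_mul]
    exact ⟨h, by linarith⟩

theorem rightChart_one_mem_homoclinicLoop {s : ℝ} (hs : s ∈ Icc (-1 : ℝ) 1) :
    rightChart s 1 ∈ homoclinicLoop := by
  left
  have h : √(1 - 1 ^ 2 + 1 ^ 2 * s ^ 2) = |s| := by
    rw [← Real.sqrt_sq_eq_abs]
    norm_num
  have h1 : |s| ≤ 1 := abs_le.2 hs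
  simp only [rightChart, mem_ofPred_eq, h, one_mul]
  refine ⟨by linarith, by linarith [abs_nonneg s], ?_⟩
  have := sq_abs s
  nlinarith

theorem canBifurcate_homoclinicLoop (n : ℕ) :
    CanBifurcate n homoclinicLoop (n + (n + 1) / 2) := by
  refine canBifurcate_of_charts fun U hU => ?_
  have h := eventually_charts_mem hU (ρ₀ := 1) (fun s hs => leftChart_one_mem_homoclinicLoop hs)
    (fun s hs => rightChart_one_mem_homoclinicLoop hs)
  obtain ⟨δ, hδ, hsub⟩ := Metric.eventually_nhds_iff.1 h
  have hd : ∀ ρ ∈ Ioo (max 0 (1 - δ)) 1, dist ρ 1 < δ := fun ρ hρ => by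
    rw [dist_comm, Real.dist_eq, abs_of_pos (sub_pos.2 hρ.2)]
    linarith [(le_max_right 0 (1 - δ)).trans_lt hρ.1]
  exact ⟨max 0 (1 - δ), 1, le_max_left _ _, max_lt one_pos (by linarith), le_rfl,
    fun ρ hρ => (hsub (hd ρ hρ)).1, fun ρ hρ => (hsub (hd ρ hρ)).2⟩

end PiecewiseHam

theorem theorem1p1 (n : ℕ) (hn : 1 ≤ n) :
    ((n + (n + 1) / 2 : ℕ) : ℕ∞) ≤ PiecewiseHam.NHopf n ∧
      ((n + (n + 1) / 2 : ℕ) : ℕ∞) ≤ PiecewiseHam.NHomoc n := by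
  constructor
  · exact le_iSup₂_of_le (n + (n + 1) / 2) (PiecewiseHam.canBifurcate_origin n) le_rfl
  · exact le_iSup₂_of_le (n + (n + 1) / 2) (PiecewiseHam.canBifurcate_homoclinicLoop n) le_rfl
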